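/- **Lemma ($\chi^2$ Random Rotations).** *Notation.* For $S\subseteq[N]$ let $\mathcal M(N,S,P,Q)$ be the law of an $N\times N$ zero-one matrix with independent entries, $M_{ij}\sim\mathrm{Bern}(P)$ if $i,j\in S$ and $M_{ij}\sim\mathrm{Bern}(Q)$ otherwise, and let $\mathrm{Bern}(Q)^{\otimes N\times N}$, $\mathcal N(0,1)^{\otimes N\times N}$ be the laws of matrices with i.i.d. entries. Let $v_S=k^{-1/2}\mathbf 1_S\in\mathbb R^N$ for $|S|=k$, and let $\mathcal N(0,\Sigma)^{\otimes N}$ denote the law of a matrix with $N$ i.i.d. columns distributed as $\mathcal N(0,\Sigma)$. Let $d_{\mathrm{TV}}(\mu,\nu)=\sup_B|\mu(B)-\nu(B)|$, let $$\delta=\min\left\{\log\frac PQ,\ \log\frac{1-Q}{1-P}\right\}$$ (the second term is $+\infty$ if $P=1$), and let $\varphi_\mu$ be the density of $\mathcal N(\mu,1)$. *Rejection kernel.* $\mathrm{RK}(\mu,B)$, for $\mu\in\mathbb R$ and $B\in\{0,1\}$, makes at most $\lceil 6\delta^{-1}\log N\rceil$ iterations. Each iteration samples a fresh $z'\sim\mathcal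 N(0,1)$. If $B=0$ and $P\varphi_0(z')\ge Q\varphi_\mu(z')$, it stops and outputs $z'$ with probability $1-\frac{Q\varphi_\mu(z')}{P\varphi_0(z')}$. If $B=1$ and $(1-Q)\varphi_\mu(z'+\mu)\ge(1-P)\varphi_0(z'+\mu)$, it stops and outputs $z'+\mu$ with probability $1-\frac{(1-P)\varphi_0(z'+\mu)}{(1-Q)\varphi_\mu(z'+\mu)}$. If no iteration stops, the output is $0$. *Algorithm $\mathcal A=\chi^2$-Random-Rotation* (input $M\in\{0,1\}^{N\times N}$, parameters $0<Q<P\le1$, $k\mid N$, $\tau>0$): sample $r_1,\dots,r_N$ i.i.d. from $\sqrt{\chi^2(N/k)}$ and replace $r_j$ by $\min\{r_j,2\sqrt{N/k}\}$; form $X_{ij}=\mathrm{RK}(\mu_{ij},M_{ij})$, independently over $i,j$ given $r$, with $\mu_{ij}=\frac12\tau r_j\sqrt{k/N}$; sample an independent $R$ from the Haar probability measure on the orthogonal group $\mathcal O_N$; output (the columns of) $XR$. For a law $\mathcal P$ on inputs, $\mathcal A(\mathcal P)$ is the law of the output on an input drawn from $\mathcal P$. *Statement.* There is one randomized program, on natural-number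 variables and real arrays, in which exact arithmetic, $\sqrt{\cdot}$, $\exp$, $\log$, comparisons, and sampling from $\mathcal N(0,1)$ and $\mathrm{Unif}[0,1]$ are unit-cost operations, such that for all $c>0$ and $A\in\mathbb N$ there are constants $C\in\mathbb R$, $d\in\mathbb N$ for which the following holds. Let $N\ge1$, let $k\ge 1$ divide $N$, and let $0<Q<P\le1$ satisfy $\min(Q,1-Q)\ge c$ and $P-Q\ge cN^{-A}$. Let $$0<\tau\le\frac{\delta}{2\sqrt{6\log N+2\log (P-Q)^{-1}}}.$$ Then: 1. On every input matrix $M\in\{0,1\}^{N\times N}$, the output of the program, run with $N,k,P,Q,\tau$ and $M$, has exactly the law of $\mathcal A(M)$, and its running time is at most $CN^d$ for every outcome of the random samples. 2. For every $S\subseteq[N]$ with $|S|=k$, $$d_{\mathrm{TV}}\left(\mathcal A(\mathcal M(N,S,P,Q)),\ \mathcal N\Big(0,I_N+\frac{\tau^2k^2}{4N}v_Sv_S^\top\Big)^{\otimes N}\right)\le CN^{-1}+k\,(4e^{-3})^{N/(2k)}.$$ 3. $$d_{\mathrm{TV}}\left(\mathcal A\big(\mathrm{Bern}(Q)^{\otimes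 N\times N}\big),\ \mathcal N(0,1)^{\otimes N\times N}\right)\le CN^{-1}.$$ -/

import Mathlib

open MeasureTheory ProbabilityTheory

noncomputable section

/-! ### Total variation and the input and target distributions -/

/-- Total variation distance `sup_B |μ(B) - ν(B)|` over measurable sets `B`
(used for probability measures). -/
def tvDist {α : Type*} [MeasurableSpace α] (μ ν : Measure α) : ℝ :=
  ⨆ B : {B : Set α // MeasurableSet B}, |μ.real B.1 - ν.real B.1|

/-- `Bern(p)` on `Bool` (`true` is the value `1`), for `p ∈ [0, 1]`. -/
def bern (p : ℝ) : Measure Bool :=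
  bernoulliMeasure true false (Set.projIcc 0 1 zero_le_one p)

/-- `M(N, S, P, Q)`: independent entries, `Bern(P)` on `S × S` and `Bern(Q)` elsewhere. -/
def plantedBernoulli (N : ℕ) (S : Finset (Fin N)) (P Q : ℝ) :
    Measure (Fin N → Fin N → Bool) :=
  Measure.pi fun i => Measure.pi fun j => bern (if i ∈ S ∧ j ∈ S then P else Q)

/-- `Bern(Q)^{⊗ N × N}`. -/
def nullBernoulli (N : ℕ) (Q : ℝ) : Measure (Fin N → Fin N → Bool) :=
  Measure.pi fun _ => Measure.pi fun _ => bern Q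

/-- `N(0, 1)^{⊗ N × N}`. -/
def gaussianMatrix (N : ℕ) : Measure (Fin N → Fin N → ℝ) :=
  Measure.pi fun _ => Measure.pi fun _ => gaussianReal 0 1

/-- The vector `v_S = k^{-1/2} 1_S`. -/
def plantedVec {N : ℕ} (k : ℕ) (S : Finset (Fin N)) : Fin N → ℝ :=
  fun i => if i ∈ S then 1 / √(k : ℝ) else 0

/-- `N(0, I_N + θ v vᵀ)^{⊗ N}`, as the law of the matrix whose `N` columns are the samples. -/
def spikedMatrix (N : ℕ) (θ : ℝ) (v : Fin N → ℝ) : Measure (Fin N → Fin N → ℝ) :=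
  (Measure.pi fun _ : Fin N =>
      multivariateGaussian (0 : EuclideanSpace ℝ (Fin N))
        ((1 : Matrix (Fin N) (Fin N) ℝ) + θ • Matrix.vecMulVec v v)).map
    fun Y i j => Y j i

/-! ### The algorithm as a Markov kernel -/

/-- The uniform distribution on `[0, 1]`. -/
def unifMeasure : Measure ℝ := volume.restrict (Set.Icc 0 1)

/-- `√(χ²(m))`: the law of the square root of a sum of squares of `m` independent
standard Gaussians. -/
def sqrtChiSq (m : ℕ) : Measure ℝ :=
  (Measure.pi fun _ : Fin m => gaussianReal 0 1).map fun g => √(∑ i, g i ^ 2)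

/-- `δ = min {log (P / Q), log ((1 - Q) / (1 - P))}`, the second term being `+∞` when `P = 1`. -/
def rkDelta (P Q : ℝ) : ℝ :=
  if P = 1 then Real.log (P / Q)
  else min (Real.log (P / Q)) (Real.log ((1 - Q) / (1 - P)))

/-- One iteration of the Gaussian rejection kernel with mean `μ`, Bernoulli probabilities
`q < p` and input bit `b`, from the proposal `z ∼ N(0, 1)` and the acceptance variable
`u ∼ Unif[0, 1]` (`u < a` is the event "with probability `a`"). `none` means rejection. -/
def rkTry (p q μ : ℝ) (b : Bool) (z u : ℝ) : Option ℝ :=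
  let φ : ℝ → ℝ → ℝ := fun m x => gaussianPDFReal m 1 x
  if b then
    if (1 - q) * φ μ (z + μ) ≥ (1 - p) * φ 0 (z + μ) ∧
        u < 1 - (1 - p) * φ 0 (z + μ) / ((1 - q) * φ μ (z + μ))
    then some (z + μ) else none
  else
    if p * φ 0 z ≥ q * φ μ z ∧ u < 1 - q * φ μ z / (p * φ 0 z)
    then some z else none

/-- The rejection kernel with `n` iterations: the first accepted value, or `0` if there is none. -/
def rkRun (p q μ : ℝ) (b : Bool) : (n : ℕ) → (Fin n → ℝ × ℝ) → ℝ
  | 0, _ => 0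
  | n + 1, ω => (rkTry p q μ b (ω 0).1 (ω 0).2).getD (rkRun p q μ b n (Fin.tail ω))

/-- The number of iterations `⌈6 δ⁻¹ log N⌉`. -/
def rkIter (N : ℕ) (P Q : ℝ) : ℕ := ⌈6 * (rkDelta P Q)⁻¹ * Real.log N⌉₊

/-- `Gaussianize` with target means `μ`: rejection kernels applied entrywise,
with their own independent randomness `ω i j`. -/
def gaussianize (N : ℕ) (P Q : ℝ) (μ : Fin N → Fin N → ℝ) (M : Fin N → Fin N → Bool)
    (ω : Fin N → Fin N → Fin (rkIter N P Q) → ℝ × ℝ) : Matrix (Fin N) (Fin N) ℝ :=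
  Matrix.of fun i j => rkRun P Q (μ i j) (M i j) (rkIter N P Q) (ω i j)

/-- The randomness used by `gaussianize`. -/
def gaussianizeNoise (N : ℕ) (P Q : ℝ) :
    Measure (Fin N → Fin N → Fin (rkIter N P Q) → ℝ × ℝ) :=
  Measure.pi fun _ => Measure.pi fun _ => Measure.pi fun _ =>
    (gaussianReal 0 1).prod unifMeasure

instance orthogonalGroup_compactSpace (N : ℕ) :
    CompactSpace (Matrix.orthogonalGroup (Fin N) ℝ) := by
  have hK : IsCompact (Set.univ.pi fun _ : Fin N => Set.univ.pi fun _ : Fin N =>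
      Set.Icc (-1 : ℝ) 1) :=
    isCompact_univ_pi fun _ => isCompact_univ_pi fun _ => isCompact_Icc
  refine isCompact_iff_compactSpace.mp (IsCompact.of_isClosed_subset hK
    (isClosed_unitary (R := Matrix (Fin N) (Fin N) ℝ)) fun U hU => ?_)
  intro i _ j _
  have h := entry_norm_bound_of_unitary (𝕜 := ℝ) hU i j
  exact abs_le.mp h

/-- The Borel σ-algebra on the orthogonal group. -/
instance orthogonalGroup_measurableSpace (N : ℕ) :
    MeasurableSpace (Matrix.orthogonalGroup (Fin N) ℝ) := borel _

instance orthogonalGroup_borelSpace (N : ℕ) :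
    BorelSpace (Matrix.orthogonalGroup (Fin N) ℝ) := ⟨rfl⟩

/-- The Haar probability measure on the orthogonal group. -/
def haarOrthogonal (N : ℕ) : Measure (Matrix.orthogonalGroup (Fin N) ℝ) :=
  Measure.haarMeasure ⊤

/-- `χ²`-Random-Rotation on the input matrix `M`: the law of `X R`, where `X` is `Gaussianize(M)`
with target means `μ_ij = (1/2) τ min {r_j, 2 √(N/k)} √(k/N)`, the `r_j` are i.i.d. `√(χ²(N/k))`,
and `R` is an independent Haar orthogonal matrix. -/
def chiSqRandomRotation (N k : ℕ) (P Q τ : ℝ) (M : Fin N → Fin N → Bool) :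
    Measure (Fin N → Fin N → ℝ) :=
  ((Measure.pi fun _ : Fin N => sqrtChiSq (N / k)).prod
      ((gaussianizeNoise N P Q).prod (haarOrthogonal N))).map fun ω =>
    let μ : Fin N → Fin N → ℝ := fun _ j =>
      1 / 2 * τ * min (ω.1 j) (2 * √((N : ℝ) / k)) * √((k : ℝ) / N)
    fun i j => (gaussianize N P Q μ M ω.2.1 * (ω.2.2 : Matrix (Fin N) (Fin N) ℝ)) i j

/-! ### Randomized real-number programs with a step count

A fixed finite program works on natural-number variables (the sizes `N`, `k` and loop counters)
and on two-dimensional real arrays. Real arithmetic, `√`, `exp`, `log`, comparisons and sampling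
from `N(0, 1)` and `Unif[0, 1]` take one step each. -/

/-- Index expressions over the natural-number variables. -/
inductive NatExpr : Type
  | lit (n : ℕ)
  | var (v : ℕ)
  | add (a b : NatExpr)
  | mul (a b : NatExpr)
  | div (a b : NatExpr)

def NatExpr.eval (x : ℕ → ℕ) : NatExpr → ℕ
  | .lit n => n
  | .var v => x v
  | .add a b => a.eval x + b.eval x
  | .mul a b => a.eval x * b.eval x
  | .div a b => a.eval x / b.eval x

def NatExpr.cost : NatExpr → ℕ
  | .lit _ => 1
  | .var _ => 1
  | .add a b => a.cost + b.cost + 1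
  | .mul a b => a.cost + b.cost + 1
  | .div a b => a.cost + b.cost + 1

/-- Real expressions; `read a i j` is entry `(i, j)` of array `a`, and `sum v n e` is
`∑_{v < n} e`. -/
inductive RealExpr : Type
  | lit (q : ℚ)
  | ofNat (n : NatExpr)
  | read (a : ℕ) (i j : NatExpr)
  | add (e f : RealExpr)
  | sub (e f : RealExpr)
  | mul (e f : RealExpr)
  | div (e f : RealExpr)
  | sqrt (e : RealExpr)
  | exp (e : RealExpr)
  | log (e : RealExpr)
  | sum (v : ℕ) (n : NatExpr) (e : RealExpr)

def RealExpr.eval (mem : ℕ → ℕ → ℕ → ℝ) : RealExpr → (ℕ → ℕ) → ℝ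
  | .lit q, _ => (q : ℝ)
  | .ofNat n, x => (n.eval x : ℝ)
  | .read a i j, x => mem a (i.eval x) (j.eval x)
  | .add e f, x => e.eval mem x + f.eval mem x
  | .sub e f, x => e.eval mem x - f.eval mem x
  | .mul e f, x => e.eval mem x * f.eval mem x
  | .div e f, x => e.eval mem x / f.eval mem x
  | .sqrt e, x => √(e.eval mem x)
  | .exp e, x => Real.exp (e.eval mem x)
  | .log e, x => Real.log (e.eval mem x)
  | .sum v n e, x => ∑ t ∈ Finset.range (n.eval x), e.eval mem (Function.update x v t)

/-- The number of elementary steps used to evaluate an expression; a sum pays for each term. -/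
def RealExpr.cost : RealExpr → (ℕ → ℕ) → ℕ
  | .lit _, _ => 1
  | .ofNat n, _ => n.cost + 1
  | .read _ i j, _ => i.cost + j.cost + 1
  | .add e f, x => e.cost x + f.cost x + 1
  | .sub e f, x => e.cost x + f.cost x + 1
  | .mul e f, x => e.cost x + f.cost x + 1
  | .div e f, x => e.cost x + f.cost x + 1
  | .sqrt e, x => e.cost x + 1
  | .exp e, x => e.cost x + 1
  | .log e, x => e.cost x + 1
  | .sum v n e, x =>
      n.cost + 1 + ∑ t ∈ Finset.range (n.eval x), (e.cost (Function.update x v t) + 1)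

/-- Programs: `assign a i j e` stores `e` in entry `(i, j)` of array `a`; `gauss` and `unif`
store a fresh sample; `ite e f c d` runs `c` if `e < f` and `d` otherwise;
`loop v e c` runs `c` for `v = 0, 1, …` as long as `v < e`, with `e` evaluated once at the start. -/
inductive RealProg : Type
  | skip
  | assign (a : ℕ) (i j : NatExpr) (e : RealExpr)
  | gauss (a : ℕ) (i j : NatExpr)
  | unif (a : ℕ) (i j : NatExpr)
  | seq (c d : RealProg)
  | ite (e f : RealExpr) (c d : RealProg)
  | loop (v : ℕ) (e : RealExpr) (c : RealProg)

/-- Machine state: natural-number variables, real arrays, the number of random samples drawn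
so far, and the number of steps taken so far. -/
structure RealState where
  idx : ℕ → ℕ
  mem : ℕ → ℕ → ℕ → ℝ
  drawn : ℕ
  steps : ℕ

/-- Add `n` to the step count. -/
def RealState.tick (s : RealState) (n : ℕ) : RealState := { s with steps := s.steps + n }

/-- Store `x` in entry `(i, j)` of array `a`. -/
def RealState.store (s : RealState) (a i j : ℕ) (x : ℝ) : RealState :=
  let row : ℕ → ℝ := Function.update (s.mem a i) j x
  { s with mem := Function.update s.mem a (Function.update (s.mem a) i row) }

/-- Set the natural-number variable `v` to `t`. -/
def RealState.setIdx (s : RealState) (v t : ℕ) : RealState :=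
  { s with idx := Function.update s.idx v t }

/-- Record that one more random sample has been drawn. -/
def RealState.draw (s : RealState) : RealState := { s with drawn := s.drawn + 1 }

/-- Execution. The `n`-th sampling instruction executed uses coordinate `n` of the random tape
`ω`: its first component if it is `gauss`, its second component if it is `unif`. -/
def RealProg.run (ω : ℕ → ℝ × ℝ) : RealProg → RealState → RealState
  | .skip, s => s.tick 1
  | .assign a i j e, s =>
      (s.store a (i.eval s.idx) (j.eval s.idx) (e.eval s.mem s.idx)).tick
        (i.cost + j.cost + e.cost s.idx + 1)
  | .gauss a i j, s =>
      ((s.store a (i.eval s.idx) (j.eval s.idx) (ω s.drawn).1).tick (i.cost + j.cost + 1)).draw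
  | .unif a i j, s =>
      ((s.store a (i.eval s.idx) (j.eval s.idx) (ω s.drawn).2).tick (i.cost + j.cost + 1)).draw
  | .seq c d, s => d.run ω (c.run ω s)
  | .ite e f c d, s =>
      let s' := s.tick (e.cost s.idx + f.cost s.idx + 1)
      if e.eval s.mem s.idx < f.eval s.mem s.idx then c.run ω s' else d.run ω s'
  | .loop v e c, s =>
      Nat.rec (motive := fun _ => RealState) (s.tick (e.cost s.idx + 1))
        (fun t s' => c.run ω ((s'.tick 1).setIdx v t))
        ⌈e.eval s.mem s.idx⌉₊

/-- The random tape: independent coordinates, each an independent pair of an `N(0, 1)` and a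
`Unif[0, 1]` variable. -/
def tapeMeasure : Measure (ℕ → ℝ × ℝ) :=
  Measure.infinitePi fun _ : ℕ => (gaussianReal 0 1).prod unifMeasure

/-- Initial state: variables `0`, `1` hold `N`, `k`; array `0` holds the zero-one matrix `M`;
row `0` of array `1` starts with `P, Q, τ`; everything else is `0`. -/
def inputState (N k : ℕ) (P Q τ : ℝ) (M : Fin N → Fin N → Bool) : RealState where
  idx := fun v => if v = 0 then N else if v = 1 then k else 0
  mem := fun a i j =>
    if a = 0 then
      if h : i < N ∧ j < N then (if M ⟨i, h.1⟩ ⟨j, h.2⟩ then 1 else 0) else 0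
    else if a = 1 ∧ i = 0 then
      if j = 0 then P else if j = 1 then Q else if j = 2 then τ else 0
    else 0
  drawn := 0
  steps := 0

/-- Law of the output matrix, which is the `N × N` part of array `2` of the final state. -/
def RealProg.outputLaw (c : RealProg) (N k : ℕ) (P Q τ : ℝ) (M : Fin N → Fin N → Bool) :
    Measure (Fin N → Fin N → ℝ) :=
  tapeMeasure.map fun ω i j => (c.run ω (inputState N k P Q τ M)).mem 2 i j

/-- Running time on the input, with random tape `ω`. -/
def RealProg.time (c : RealProg) (N k : ℕ) (P Q τ : ℝ) (M : Fin N → Fin N → Bool)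
    (ω : ℕ → ℝ × ℝ) : ℕ :=
  (c.run ω (inputState N k P Q τ M)).steps

end

/-! The core is an exact identity for the rejection kernel. Apart from truncation, bit 1 is sent to
the density `((1-Q)φ_μ - (1-P)φ_0)/(P-Q)` and bit 0 to `(Pφ_0 - Qφ_μ)/(P-Q)`. Mixing them with
weights `P, 1-P` gives `φ_μ`, and with weights `Q, 1-Q` gives `φ_0`. Two errors remain. Where these
expressions are negative one is in a Gaussian tail beyond `s`, with `exp(-s²/2) = (P-Q) N⁻³` by the
bound on `τ`; and all iterations may reject, which is exponentially unlikely in `δ` times their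
number. An entry thus costs `4 N⁻³` (`rkLaw_rkIter_tvLe`), and the `N²` entries, independent given
`r`, cost `4/N`.

So `X` may be replaced by `G + 1_S uᵀ`, where `G` is Gaussian and `u` is supported on `S`. A
Chernoff bound for `χ²` and a union bound over the `k` columns of `S` remove the cap on `r`, so that
`u_j = σ r_j` with `σ = (τ/2)√(k/N)`. Now `G R` has the law of `G` for each fixed orthogonal `R`,
while `1_S uᵀ R = 1_S (Rᵀu)ᵀ`, and for Haar `R` the law of `Rᵀu` depends only on the norm of `u`.
Each `r_j` is the norm of a Gaussian vector of length `N/k`; the `k` vectors in `S` join to a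
Gaussian vector `h` of length `N` with `|u| = |σh|`. As `Rᵀh` has the law of `h`, the output is `G +
σ 1_S hᵀ`, whose columns are independent with covariance `I + σ² 1_S 1_Sᵀ`
(`lintegral_rankOne_rotation`). Under the null there is no shift and only the first error remains.

The program obtains Haar measure by Gram–Schmidt on a Gaussian matrix: the procedure commutes with
orthogonal maps, so its law is left invariant, and Haar measure is unique
(`gaussianMatrix_map_gsOrth`). For given parameters every run draws the same number of samples, so
each random input sits at fixed addresses of the tape, and disjoint addresses give independence
(`tapeMeasure_map`). Loops cannot stop early, so the last accepted proposal is kept instead of the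
first; reading the trials backwards shows that the law is the same. Loops run at most `N` or `⌈6 δ⁻¹
log N⌉` times, which is polynomial in `N` because `δ ≥ P - Q ≥ c N⁻ᴬ`. -/

noncomputable section

/-! ### Total variation bounds tested against `[0, 1]`-valued functions -/

/-- `μ` is within one-sided total variation distance `ε` of `ν`. -/
def TVLe {α : Type*} [MeasurableSpace α] (μ ν : Measure α) (ε : ENNReal) : Prop :=
  ∀ f : α → ENNReal, Measurable f → (∀ x, f x ≤ 1) → ∫⁻ x, f x ∂μ ≤ ∫⁻ x, f x ∂ν + ε

section TV
variable {α β : Type*} [MeasurableSpace α] [MeasurableSpace β]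

theorem tvDist_le_one (μ ν : Measure α) [IsProbabilityMeasure μ] [IsProbabilityMeasure ν] :
    tvDist μ ν ≤ 1 := by
  have : Nonempty {B : Set α // MeasurableSet B} := ⟨⟨∅, MeasurableSet.empty⟩⟩
  refine ciSup_le fun B => abs_le.mpr ⟨?_, ?_⟩
  · linarith [measureReal_nonneg (μ := μ) (s := B.1), measureReal_le_one (μ := ν) (s := B.1)]
  · linarith [measureReal_nonneg (μ := ν) (s := B.1), measureReal_le_one (μ := μ) (s := B.1)]

theorem TVLe.measure_le {μ ν : Measure α} {ε : ENNReal} (h : TVLe μ ν ε) {B : Set α}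
    (hB : MeasurableSet B) : μ B ≤ ν B + ε := by
  have := h (B.indicator 1) (measurable_one.indicator hB)
    (fun x => Set.indicator_le (fun _ _ => le_refl _) x |>.trans (by simp))
  simpa [lintegral_indicator_one hB] using this

theorem TVLe.tvDist_le {μ ν : Measure α} [IsProbabilityMeasure μ] [IsProbabilityMeasure ν]
    {ε : ℝ} (hε : 0 ≤ ε) (h : TVLe μ ν (ENNReal.ofReal ε)) : tvDist μ ν ≤ ε := by
  have : Nonempty {B : Set α // MeasurableSet B} := ⟨⟨∅, MeasurableSet.empty⟩⟩
  have key : ∀ B : Set α, MeasurableSet B → μ.real B ≤ ν.real B + ε := fun B hB => by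
    have := ENNReal.toReal_mono (by finiteness) (h.measure_le hB)
    rwa [ENNReal.toReal_add (by finiteness) (by finiteness), ENNReal.toReal_ofReal hε] at this
  refine ciSup_le fun B => abs_le.mpr ⟨?_, ?_⟩
  -- For probability measures, the reverse inequality is the one-sided bound on the complement.
  · have := key _ B.2.compl
    rw [probReal_compl_eq_one_sub B.2, probReal_compl_eq_one_sub B.2] at this
    linarith
  · linarith [key _ B.2]

theorem TVLe.mono {μ ν : Measure α} {ε ε' : ENNReal} (h : TVLe μ ν ε) (h' : ε ≤ ε') :
    TVLe μ ν ε' := fun f hf h1 => (h f hf h1).trans (by gcongr)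

theorem TVLe.refl (μ : Measure α) : TVLe μ μ 0 := fun f _ _ => by simp

theorem TVLe.map {μ ν : Measure α} {ε : ENNReal} (h : TVLe μ ν ε) {g : α → β}
    (hg : Measurable g) : TVLe (μ.map g) (ν.map g) ε := fun f hf h1 => by
  rw [lintegral_map hf hg, lintegral_map hf hg]
  exact h _ (hf.comp hg) fun x => h1 _

/-- Hybrid argument, one factor replaced at a time. The inner integral is itself a `[0, 1]`-valued
test function, which is why distances are tested on functions and not only on sets. -/
theorem TVLe.prod {μ μ' : Measure α} {ν ν' : Measure β} [IsProbabilityMeasure μ]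
    [IsProbabilityMeasure μ'] [IsProbabilityMeasure ν] [IsProbabilityMeasure ν'] {ε ε' : ENNReal}
    (h : TVLe μ μ' ε) (h' : TVLe ν ν' ε') : TVLe (μ.prod ν) (μ'.prod ν') (ε + ε') :=
  fun f hf h1 => by
  rw [lintegral_prod _ hf.aemeasurable, lintegral_prod _ hf.aemeasurable]
  calc ∫⁻ x, ∫⁻ y, f (x, y) ∂ν ∂μ ≤ ∫⁻ x, ∫⁻ y, f (x, y) ∂ν ∂μ' + ε :=
        h _ hf.lintegral_prod_right' fun x => by
          calc ∫⁻ y, f (x, y) ∂ν ≤ ∫⁻ y, 1 ∂ν := lintegral_mono fun y => h1 _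
            _ = 1 := by simp
    _ ≤ ∫⁻ x, (∫⁻ y, f (x, y) ∂ν' + ε') ∂μ' + ε := by
        gcongr with x
        exact h' _ (hf.comp measurable_prodMk_left) fun y => h1 _
    _ = _ := by
        rw [lintegral_add_right _ measurable_const]; simp [add_assoc, add_comm ε]

/-- Errors add over independent coordinates, by splitting off coordinate `0`. The coordinates may
have different types and laws. -/
theorem TVLe.pi_fin {n : ℕ} {X : Fin n → Type*} [∀ i, MeasurableSpace (X i)]
    (μ ν : ∀ i, Measure (X i)) [∀ i, IsProbabilityMeasure (μ i)] [∀ i, IsProbabilityMeasure (ν i)]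
    (ε : ENNReal) (h : ∀ i, TVLe (μ i) (ν i) ε) :
    TVLe (Measure.pi μ) (Measure.pi ν) (n * ε) := by
  induction n with
  | zero =>
    have : Measure.pi μ = Measure.pi ν := by
      rw [Measure.pi_of_empty μ (x := fun i => i.elim0),
        Measure.pi_of_empty ν (x := fun i => i.elim0)]
    rw [this]; exact (TVLe.refl _).mono (by simp)
  | succ n ih =>
    have e := (measurePreserving_piFinSuccAbove μ 0).symm
    have e' := (measurePreserving_piFinSuccAbove ν 0).symm
    rw [← e.map_eq, ← e'.map_eq]
    refine TVLe.map ?_ (MeasurableEquiv.measurable _)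
    refine ((h 0).prod (ih _ _ fun i => h _)).mono ?_
    push_cast
    rw [add_mul, one_mul, add_comm]

end TV
end

noncomputable section

/-! ### The rejection kernel -/

instance isProbabilityMeasure_unifMeasure : IsProbabilityMeasure unifMeasure :=
  ⟨by simp [unifMeasure]⟩

instance isProbabilityMeasure_bern (p : ℝ) : IsProbabilityMeasure (bern p) := by
  unfold bern; infer_instance

theorem lintegral_bern {p : ℝ} (h0 : 0 ≤ p) (h1 : p ≤ 1) (f : Bool → ENNReal) :
    ∫⁻ b, f b ∂(bern p) = ENNReal.ofReal p * f true + ENNReal.ofReal (1 - p) * f false := by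
  have hp : Set.projIcc (0 : ℝ) 1 zero_le_one p = ⟨p, h0, h1⟩ := Set.projIcc_of_mem _ ⟨h0, h1⟩
  rw [bern, bernoulliMeasure_def, hp, lintegral_add_measure]
  have e1 : unitInterval.toNNReal ⟨p, h0, h1⟩ = p.toNNReal := by
    ext; simp [h0]
  have e2 : unitInterval.toNNReal (unitInterval.symm ⟨p, h0, h1⟩) = (1 - p).toNNReal := by
    ext; simp [h1]
  rw [e1, e2]
  rw [lintegral_smul_measure, lintegral_smul_measure, lintegral_dirac, lintegral_dirac]
  rfl

theorem unifMeasure_Iio_le (a : ℝ) : unifMeasure {u | u < a} ≤ ENNReal.ofReal a := by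
  change (volume.restrict _) (Set.Iio a) ≤ _
  rw [Measure.restrict_apply measurableSet_Iio]
  calc volume (Set.Iio a ∩ Set.Icc 0 1) ≤ volume (Set.Icc 0 a) :=
        measure_mono fun x hx => ⟨hx.2.1, hx.1.le⟩
    _ = _ := by simp

theorem unifMeasure_Ici_le (ρ : ℝ) :
    unifMeasure {u | 1 - ρ ≤ u} ≤ ENNReal.ofReal ρ := by
  change (volume.restrict _) (Set.Ici _) ≤ _
  rw [Measure.restrict_apply measurableSet_Ici]
  calc volume (Set.Ici (1 - ρ) ∩ Set.Icc 0 1) ≤ volume (Set.Icc (1 - ρ) 1) :=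
        measure_mono fun x hx => ⟨hx.1, hx.2.2⟩
    _ = _ := by simp

theorem unifMeasure_Iio_zero : unifMeasure {u | u < 0} = 0 :=
  le_antisymm ((unifMeasure_Iio_le 0).trans (by simp)) bot_le

/-- The noise of a rejection kernel with `n` iterations. -/
def rkNoise (n : ℕ) : Measure (Fin n → ℝ × ℝ) :=
  Measure.pi fun _ => (gaussianReal 0 1).prod unifMeasure

instance isProbabilityMeasure_rkNoise (n : ℕ) : IsProbabilityMeasure (rkNoise n) := by
  unfold rkNoise; infer_instance

/-- The value proposed in an iteration of the rejection kernel. -/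
def rkProposal (μ : ℝ) (b : Bool) (z : ℝ) : ℝ := if b then z + μ else z

/-- The likelihood ratio whose complement to `1` is the acceptance probability. -/
def rkRatio (p q μ : ℝ) (b : Bool) (x : ℝ) : ℝ :=
  if b then (1 - p) * gaussianPDFReal 0 1 x / ((1 - q) * gaussianPDFReal μ 1 x)
  else q * gaussianPDFReal μ 1 x / (p * gaussianPDFReal 0 1 x)

/-- Acceptance of an iteration of the rejection kernel. -/
def rkAccept (p q μ : ℝ) (b : Bool) (z u : ℝ) : Prop :=
  (if b then (1 - q) * gaussianPDFReal μ 1 (z + μ) ≥ (1 - p) * gaussianPDFReal 0 1 (z + μ)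
    else p * gaussianPDFReal 0 1 z ≥ q * gaussianPDFReal μ 1 z) ∧
  u < 1 - rkRatio p q μ b (rkProposal μ b z)

open Classical in
theorem rkTry_eq (p q μ : ℝ) (b : Bool) (z u : ℝ) :
    rkTry p q μ b z u = if rkAccept p q μ b z u then some (rkProposal μ b z) else none := by
  cases b <;> simp [rkTry, rkAccept, rkProposal, rkRatio]

theorem measurable_rkProposal (b : Bool) :
    Measurable fun a : ℝ × ℝ => rkProposal a.1 b a.2 := by
  cases b <;> simp only [rkProposal, if_true, Bool.false_eq_true, if_false] <;> fun_prop

theorem measurable_gaussianPDFReal_comp {α : Type*} [MeasurableSpace α] {g h : α → ℝ}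
    (hg : Measurable g) (hh : Measurable h) :
    Measurable fun a => gaussianPDFReal (g a) 1 (h a) :=
  measurable_uncurry_gaussianPDFReal.comp (hg.prodMk (measurable_const.prodMk hh))

theorem measurable_rkRatio (p q : ℝ) (b : Bool) :
    Measurable fun a : ℝ × ℝ => rkRatio p q a.1 b a.2 := by
  have h0 := measurable_gaussianPDFReal_comp (g := fun _ : ℝ × ℝ => 0) (h := fun a => a.2)
    (by fun_prop) (by fun_prop)
  have h1 := measurable_gaussianPDFReal_comp (g := fun a : ℝ × ℝ => a.1) (h := fun a => a.2)
    (by fun_prop) (by fun_prop)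
  cases b <;> simp only [rkRatio, if_true, Bool.false_eq_true, if_false] <;> fun_prop

theorem measurableSet_rkAccept (p q : ℝ) (b : Bool) :
    MeasurableSet {a : ℝ × ℝ × ℝ | rkAccept p q a.1 b a.2.1 a.2.2} := by
  refine MeasurableSet.inter (s₁ := {a : ℝ × ℝ × ℝ | (if b then _ else _)}) ?_
    (measurableSet_lt (by fun_prop) ((measurable_rkRatio p q b).comp (f := fun a : ℝ × ℝ × ℝ =>
      (a.1, rkProposal a.1 b a.2.1)) (measurable_fst.prodMk ((measurable_rkProposal b).comp
        (f := fun a : ℝ × ℝ × ℝ => (a.1, a.2.1)) (by fun_prop))) |>.const_sub 1))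
  cases b
  · simp only [Bool.false_eq_true, if_false]
    have h0 := measurable_gaussianPDFReal_comp (g := fun _ : ℝ × ℝ × ℝ => 0)
      (h := fun a => a.2.1) (by fun_prop) (by fun_prop)
    have h1 := measurable_gaussianPDFReal_comp (g := fun a : ℝ × ℝ × ℝ => a.1)
      (h := fun a => a.2.1) (by fun_prop) (by fun_prop)
    exact measurableSet_le (by fun_prop) (by fun_prop)
  · simp only [if_true]
    have h0 := measurable_gaussianPDFReal_comp (g := fun _ : ℝ × ℝ × ℝ => 0)
      (h := fun a => a.2.1 + a.1) (by fun_prop) (by fun_prop)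
    have h1 := measurable_gaussianPDFReal_comp (g := fun a : ℝ × ℝ × ℝ => a.1)
      (h := fun a => a.2.1 + a.1) (by fun_prop) (by fun_prop)
    exact measurableSet_le (by fun_prop) (by fun_prop)

open Classical in
theorem rkRun_succ (p q μ : ℝ) (b : Bool) (n : ℕ) (ω : Fin (n + 1) → ℝ × ℝ) :
    rkRun p q μ b (n + 1) ω = if rkAccept p q μ b (ω 0).1 (ω 0).2 then rkProposal μ b (ω 0).1
      else rkRun p q μ b n (Fin.tail ω) := by
  rw [rkRun, rkTry_eq]; split_ifs <;> rfl

theorem measurable_rkRun_of_bit (p q : ℝ) (b : Bool) (n : ℕ) :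
    Measurable fun a : ℝ × (Fin n → ℝ × ℝ) => rkRun p q a.1 b n a.2 := by
  classical
  induction n with
  | zero => simp only [rkRun]; fun_prop
  | succ n ih =>
    simp only [rkRun_succ]
    refine Measurable.ite ((measurableSet_rkAccept p q b).preimage
      (f := fun a : ℝ × (Fin (n + 1) → ℝ × ℝ) => (a.1, (a.2 0).1, (a.2 0).2)) (by fun_prop)) ?_ ?_
    · exact (measurable_rkProposal b).comp (f := fun a : ℝ × (Fin (n + 1) → ℝ × ℝ) =>
        (a.1, (a.2 0).1)) (by fun_prop)
    · exact ih.comp (f := fun a : ℝ × (Fin (n + 1) → ℝ × ℝ) => (a.1, Fin.tail a.2))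
        (measurable_fst.prodMk (measurable_pi_lambda _ fun i => by unfold Fin.tail; fun_prop))

theorem measurable_rkRun (p q : ℝ) (n : ℕ) :
    Measurable fun a : ℝ × Bool × (Fin n → ℝ × ℝ) => rkRun p q a.1 a.2.1 n a.2.2 := by
  have : (fun a : ℝ × Bool × (Fin n → ℝ × ℝ) => rkRun p q a.1 a.2.1 n a.2.2) = fun a =>
      if a.2.1 = true then rkRun p q a.1 true n a.2.2 else rkRun p q a.1 false n a.2.2 := by
    funext a; rcases a with ⟨m, b, ω⟩; cases b <;> rfl
  rw [this]
  have h := fun b => (measurable_rkRun_of_bit p q b n).comp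
    (f := fun a : ℝ × Bool × (Fin n → ℝ × ℝ) => (a.1, a.2.2)) (by fun_prop)
  exact Measurable.ite ((MeasurableSet.singleton true).preimage (measurable_fst.comp measurable_snd))
    (h true) (h false)

/-- Law of the output of the rejection kernel, tested against `f`. -/
theorem lintegral_rkRun_le {p q μ : ℝ} {b : Bool} {f : ℝ → ENNReal} (hf : Measurable f)
    (h1 : ∀ x, f x ≤ 1) {A : ENNReal} {ρ : ℝ} (hρ0 : 0 ≤ ρ) (hρ : ρ < 1)
    (hA : ∫⁻ a, Set.indicator {a | rkAccept p q μ b a.1 a.2} (fun a => f (rkProposal μ b a.1)) a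
      ∂(gaussianReal 0 1).prod unifMeasure ≤ A)
    (hR : ((gaussianReal 0 1).prod unifMeasure) {a | ¬ rkAccept p q μ b a.1 a.2} ≤
      ENNReal.ofReal ρ) (n : ℕ) :
    ∫⁻ ω, f (rkRun p q μ b n ω) ∂rkNoise n ≤
      A * ENNReal.ofReal (1 / (1 - ρ)) + ENNReal.ofReal ρ ^ n := by
  have hS : MeasurableSet {a : ℝ × ℝ | rkAccept p q μ b a.1 a.2} :=
    (measurableSet_rkAccept p q b).preimage (f := fun a : ℝ × ℝ => (μ, a.1, a.2)) (by fun_prop)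
  have hP : Measurable fun z => rkProposal μ b z :=
    (measurable_rkProposal b).comp (f := fun z : ℝ => (μ, z)) (by fun_prop)
  induction n with
  -- With no iterations the output is the default `0`, about which nothing is claimed: the term `ρ ^
  -- 0 = 1` absorbs it.
  | zero => exact (lintegral_mono fun ω => h1 _).trans (by simp [rkNoise])
  | succ n ih =>
    have hrun : Measurable fun ω => f (rkRun p q μ b n ω) :=
      hf.comp ((measurable_rkRun_of_bit p q b n).comp (f := fun ω => (μ, ω)) (by fun_prop))
    have e := (measurePreserving_piFinSuccAbove
      (fun _ : Fin (n + 1) => (gaussianReal 0 1).prod unifMeasure) 0)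
    calc ∫⁻ ω, f (rkRun p q μ b (n + 1) ω) ∂rkNoise (n + 1)
        ≤ ∫⁻ ω, (fun a : (ℝ × ℝ) × (Fin n → ℝ × ℝ) =>
            Set.indicator {a | rkAccept p q μ b a.1 a.2} (fun a => f (rkProposal μ b a.1)) a.1 +
            Set.indicator {a | ¬ rkAccept p q μ b a.1 a.2} 1 a.1 * f (rkRun p q μ b n a.2))
            (MeasurableEquiv.piFinSuccAbove (fun _ => ℝ × ℝ) 0 ω) ∂rkNoise (n + 1) := by
          refine lintegral_mono fun ω => ?_
          have et : (MeasurableEquiv.piFinSuccAbove (fun _ => ℝ × ℝ) 0 ω) = (ω 0, Fin.tail ω) := rfl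
          simp only [et, rkRun_succ]
          by_cases h : rkAccept p q μ b (ω 0).1 (ω 0).2 <;> simp [h]
      _ = ∫⁻ a, (Set.indicator {a | rkAccept p q μ b a.1 a.2} (fun a => f (rkProposal μ b a.1)) a.1 +
            Set.indicator {a | ¬ rkAccept p q μ b a.1 a.2} 1 a.1 * f (rkRun p q μ b n a.2))
            ∂((gaussianReal 0 1).prod unifMeasure).prod (rkNoise n) := by
          exact e.lintegral_comp_emb (MeasurableEquiv.measurableEmbedding _) (fun a =>
            Set.indicator {a | rkAccept p q μ b a.1 a.2} (fun a => f (rkProposal μ b a.1)) a.1 +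
            Set.indicator {a | ¬ rkAccept p q μ b a.1 a.2} 1 a.1 * f (rkRun p q μ b n a.2))
      _ = ∫⁻ a, Set.indicator {a | rkAccept p q μ b a.1 a.2} (fun a => f (rkProposal μ b a.1)) a
            ∂(gaussianReal 0 1).prod unifMeasure +
          ((gaussianReal 0 1).prod unifMeasure) {a | ¬ rkAccept p q μ b a.1 a.2} *
            ∫⁻ ω, f (rkRun p q μ b n ω) ∂rkNoise n := by
          have hm : Measurable (Set.indicator {a | rkAccept p q μ b a.1 a.2}
              (fun a : ℝ × ℝ => f (rkProposal μ b a.1))) :=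
            (hf.comp (hP.comp measurable_fst)).indicator hS
          have hm' : Measurable fun a : (ℝ × ℝ) × (Fin n → ℝ × ℝ) =>
              Set.indicator {a | rkAccept p q μ b a.1 a.2}
                (fun a : ℝ × ℝ => f (rkProposal μ b a.1)) a.1 := hm.comp measurable_fst
          have hC : Measurable (Set.indicator {a : ℝ × ℝ | ¬ rkAccept p q μ b a.1 a.2}
              (1 : ℝ × ℝ → ENNReal)) := measurable_one.indicator hS.compl
          rw [lintegral_add_left hm', lintegral_prod_mul hC.aemeasurable hrun.aemeasurable]
          congr 1
          · rw [lintegral_prod _ hm'.aemeasurable]; simp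
          · congr 1
            exact lintegral_indicator_one hS.compl
      _ ≤ A + ENNReal.ofReal ρ * (A * ENNReal.ofReal (1 / (1 - ρ)) + ENNReal.ofReal ρ ^ n) := by
          gcongr
      _ = _ := by
          -- The sum `1 / (1 - ρ)` of the geometric series is the fixed point of `x ↦ 1 + ρ x`, so
          -- the bound reproduces itself with one more factor `ρ` in the failure term.
          have : ENNReal.ofReal (1 / (1 - ρ)) = 1 + ENNReal.ofReal ρ * ENNReal.ofReal (1 / (1 - ρ)) := by
            rw [← ENNReal.ofReal_mul hρ0, ← ENNReal.ofReal_one, ← ENNReal.ofReal_add (by norm_num)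
              (mul_nonneg hρ0 (div_nonneg zero_le_one (by linarith)))]
            congr 1
            have : 1 - ρ ≠ 0 := by linarith
            field_simp; ring
          conv_rhs => rw [this]
          ring
end

/-! ### One iteration of the kernel and the mixture identity -/

noncomputable section

theorem ofReal_max_zero (a : ℝ) : ENNReal.ofReal (max a 0) = ENNReal.ofReal a := by
  rw [ENNReal.ofReal_max, ENNReal.ofReal_zero]; simp

theorem map_rkProposal (μ : ℝ) (b : Bool) :
    (gaussianReal 0 1).map (rkProposal μ b) = gaussianReal (if b then μ else 0) 1 := by
  cases b
  · have : rkProposal μ false = id := rfl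
    simp [this]
  · have : rkProposal μ true = fun z => z + μ := rfl
    rw [this, gaussianReal_map_add_const]; simp

/-- Given the proposal `x`, acceptance forces `u < 1 - rkRatio`, of probability at most `ofReal (1 -
rkRatio)`. The density comparison can be dropped here, since `ofReal` already vanishes when the
ratio exceeds `1`. -/
theorem lintegral_rkAccept_le {p q μ : ℝ} {b : Bool} {f : ℝ → ENNReal} (hf : Measurable f) :
    ∫⁻ a, Set.indicator {a | rkAccept p q μ b a.1 a.2} (fun a => f (rkProposal μ b a.1)) a
      ∂(gaussianReal 0 1).prod unifMeasure ≤
    ∫⁻ x, f x * ENNReal.ofReal (1 - rkRatio p q μ b x) ∂gaussianReal (if b then μ else 0) 1 := by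
  have hS : MeasurableSet {a : ℝ × ℝ | rkAccept p q μ b a.1 a.2} :=
    (measurableSet_rkAccept p q b).preimage (f := fun a : ℝ × ℝ => (μ, a.1, a.2)) (by fun_prop)
  have hP : Measurable fun z => rkProposal μ b z :=
    (measurable_rkProposal b).comp (f := fun z : ℝ => (μ, z)) (by fun_prop)
  have hr : Measurable fun z => rkRatio p q μ b z :=
    (measurable_rkRatio p q b).comp (f := fun z : ℝ => (μ, z)) (by fun_prop)
  have hm : Measurable (Set.indicator {a | rkAccept p q μ b a.1 a.2}
      (fun a : ℝ × ℝ => f (rkProposal μ b a.1))) :=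
    (hf.comp (hP.comp measurable_fst)).indicator hS
  rw [lintegral_prod _ hm.aemeasurable, ← map_rkProposal, lintegral_map (by fun_prop) hP]
  refine lintegral_mono fun z => ?_
  calc _ ≤ ∫⁻ u, f (rkProposal μ b z) *
        Set.indicator {u | u < 1 - rkRatio p q μ b (rkProposal μ b z)} 1 u ∂unifMeasure := by
        refine lintegral_mono fun u => ?_
        by_cases h : rkAccept p q μ b z u
        · simp [h, h.2]
        · simp [h]
    _ ≤ _ := by
        refine (lintegral_const_mul _ (measurable_one.indicator measurableSet_Iio)).trans_le ?_
        gcongr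
        exact (lintegral_indicator_one measurableSet_Iio).trans_le (unifMeasure_Iio_le _)

/-- If `0 ≤ u < 1 - rkRatio`, then the ratio is below `1`, so the density comparison holds and the
proposal is accepted. Rejection therefore needs `u ≥ 1 - rkRatio` or the null event `u < 0`. -/
theorem measure_not_rkAccept_le {p q μ : ℝ} {b : Bool} (hq : 0 < q) (hqp : q < p) (hp : p ≤ 1) :
    ((gaussianReal 0 1).prod unifMeasure) {a | ¬ rkAccept p q μ b a.1 a.2} ≤
    ∫⁻ x, ENNReal.ofReal (rkRatio p q μ b x) ∂gaussianReal (if b then μ else 0) 1 := by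
  have hS : MeasurableSet {a : ℝ × ℝ | rkAccept p q μ b a.1 a.2} :=
    (measurableSet_rkAccept p q b).preimage (f := fun a : ℝ × ℝ => (μ, a.1, a.2)) (by fun_prop)
  have hP : Measurable fun z => rkProposal μ b z :=
    (measurable_rkProposal b).comp (f := fun z : ℝ => (μ, z)) (by fun_prop)
  have hr : Measurable fun z => rkRatio p q μ b z :=
    (measurable_rkRatio p q b).comp (f := fun z : ℝ => (μ, z)) (by fun_prop)
  refine (Measure.prod_apply hS.compl).trans_le ?_
  rw [← map_rkProposal, lintegral_map (by fun_prop) hP]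
  refine lintegral_mono fun z => ?_
  calc _ ≤ unifMeasure ({u | 1 - rkRatio p q μ b (rkProposal μ b z) ≤ u} ∪ {u | u < 0}) := by
        refine measure_mono fun u hu => ?_
        by_contra hcon
        simp only [Set.mem_union, Set.mem_ofPred_eq, not_or, not_le, not_lt] at hcon
        refine hu ⟨?_, hcon.1⟩
        have h1 : rkRatio p q μ b (rkProposal μ b z) < 1 := by linarith
        cases b
        · simp only [rkRatio, rkProposal, Bool.false_eq_true, if_false] at h1 ⊢
          rw [div_lt_one (mul_pos (by linarith) (gaussianPDFReal_pos _ _ _ (by simp)))] at h1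
          exact h1.le
        · simp only [rkRatio, rkProposal, if_true] at h1 ⊢
          rw [div_lt_one (mul_pos (by linarith) (gaussianPDFReal_pos _ _ _ (by simp)))] at h1
          exact h1.le
    _ ≤ unifMeasure _ + unifMeasure _ := measure_union_le _ _
    _ ≤ ENNReal.ofReal (rkRatio p q μ b (rkProposal μ b z)) + 0 := by
        gcongr
        · exact unifMeasure_Ici_le _
        · exact unifMeasure_Iio_zero.le
    _ = _ := add_zero _

theorem lintegral_gaussianReal_eq {m : ℝ} {f : ℝ → ENNReal} (hf : Measurable f) :
    ∫⁻ x, f x ∂gaussianReal m 1 = ∫⁻ x, f x * ENNReal.ofReal (gaussianPDFReal m 1 x) := by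
  rw [gaussianReal_of_var_ne_zero _ one_ne_zero,
    lintegral_withDensity_eq_lintegral_mul _ (measurable_gaussianPDF _ _) hf]
  exact lintegral_congr fun x => mul_comm _ _

/-- The mean of `rkRatio` under the proposal distribution. -/
def rkRejectBound (p q : ℝ) (b : Bool) : ℝ := if b then (1 - p) / (1 - q) else q / p

/-- The proposal density cancels against the denominator of the ratio, leaving a constant times the
other Gaussian density, which has mass `1`. -/
theorem lintegral_rkRatio {p q μ : ℝ} {b : Bool} (hq : 0 < q) (hqp : q < p) (hp : p ≤ 1) :
    ∫⁻ x, ENNReal.ofReal (rkRatio p q μ b x) ∂gaussianReal (if b then μ else 0) 1 =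
      ENNReal.ofReal (rkRejectBound p q b) := by
  have hr : Measurable fun z => rkRatio p q μ b z :=
    (measurable_rkRatio p q b).comp (f := fun z : ℝ => (μ, z)) (by fun_prop)
  have hp0 : p ≠ 0 := by linarith
  have hq1 : 1 - q ≠ 0 := by linarith
  have hb : 0 ≤ rkRejectBound p q b := by
    cases b <;> simp only [rkRejectBound, if_true, Bool.false_eq_true, if_false]
    · exact div_nonneg hq.le (by linarith)
    · exact div_nonneg (by linarith) (by linarith)
  rw [lintegral_gaussianReal_eq (by fun_prop)]
  calc _ = ∫⁻ x, ENNReal.ofReal (rkRejectBound p q b) *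
        ENNReal.ofReal (gaussianPDFReal (if b then 0 else μ) 1 x) := by
        refine lintegral_congr fun x => ?_
        rw [← ENNReal.ofReal_mul' (gaussianPDFReal_nonneg _ _ _), ← ENNReal.ofReal_mul hb]
        congr 1
        have h0 := (gaussianPDFReal_pos 0 1 x one_ne_zero).ne'
        have h1 := (gaussianPDFReal_pos μ 1 x one_ne_zero).ne'
        cases b <;> simp only [rkRatio, rkRejectBound, if_true, Bool.false_eq_true, if_false] <;>
          field_simp
    _ = _ := by
        rw [lintegral_const_mul _ (by fun_prop), lintegral_gaussianPDFReal_eq_one _ one_ne_zero,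
          mul_one]

/-- Dividing the accepted sub-density by the acceptance probability, `(p - q) / p` for bit 0 and `(p
- q) / (1 - q)` for bit 1, gives both bits the denominator `p - q`. This makes the two densities
combine exactly. -/
theorem lintegral_rkRun_le' {p q μ : ℝ} {b : Bool} (hq : 0 < q) (hqp : q < p) (hp : p ≤ 1)
    {f : ℝ → ENNReal} (hf : Measurable f) (h1 : ∀ x, f x ≤ 1) (n : ℕ) :
    ∫⁻ ω, f (rkRun p q μ b n ω) ∂rkNoise n ≤
      (∫⁻ x, f x * ENNReal.ofReal ((if b then (1 - q) * gaussianPDFReal μ 1 x -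
          (1 - p) * gaussianPDFReal 0 1 x else
          p * gaussianPDFReal 0 1 x - q * gaussianPDFReal μ 1 x) / (p - q))) +
        ENNReal.ofReal (rkRejectBound p q b) ^ n := by
  have hr : Measurable fun z => rkRatio p q μ b z :=
    (measurable_rkRatio p q b).comp (f := fun z : ℝ => (μ, z)) (by fun_prop)
  have hp0 : p ≠ 0 := by linarith
  have hq1 : 1 - q ≠ 0 := by linarith
  have hpq : p - q ≠ 0 := by linarith
  have hb : 0 ≤ rkRejectBound p q b ∧ rkRejectBound p q b < 1 := by
    cases b <;> simp only [rkRejectBound, if_true, Bool.false_eq_true, if_false]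
    · exact ⟨div_nonneg hq.le (by linarith), (div_lt_one (by linarith)).2 hqp⟩
    · exact ⟨div_nonneg (by linarith) (by linarith), (div_lt_one (by linarith)).2 (by linarith)⟩
  refine (lintegral_rkRun_le hf h1 hb.1 hb.2 (lintegral_rkAccept_le hf)
    ((measure_not_rkAccept_le hq hqp hp).trans (lintegral_rkRatio hq hqp hp).le) n).trans ?_
  refine add_le_add (le_of_eq ?_) le_rfl
  rw [lintegral_gaussianReal_eq (by fun_prop), ← lintegral_mul_const _ (by fun_prop)]
  refine lintegral_congr fun x => ?_
  rw [mul_assoc, mul_assoc, ← ENNReal.ofReal_mul (gaussianPDFReal_nonneg _ _ _),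
    ← ENNReal.ofReal_mul' (mul_nonneg (gaussianPDFReal_nonneg _ _ _)
      (div_nonneg zero_le_one (by linarith [hb.2])))]
  congr 2
  have h0 := (gaussianPDFReal_pos 0 1 x one_ne_zero).ne'
  have h1 := (gaussianPDFReal_pos μ 1 x one_ne_zero).ne'
  cases b <;> simp only [rkRatio, rkRejectBound, if_true, Bool.false_eq_true, if_false]
  · rw [show (1 : ℝ) - q / p = (p - q) / p by field_simp]
    field_simp
  · rw [show (1 : ℝ) - (1 - p) / (1 - q) = (p - q) / (1 - q) by field_simp; ring]
    field_simp

/-- The rejection kernel on a Bernoulli input bit. -/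
def rkLaw (p q μ w : ℝ) (n : ℕ) : Measure ℝ :=
  ((bern w).prod (rkNoise n)).map fun a => rkRun p q μ a.1 n a.2

/-- The signed densities for the two bits mix with weights `w, 1 - w` to exactly the density of
`N(m, 1)` in both cases of `hw`. The first error term pays for cutting them off at `0`, the second
for runs in which every iteration rejects. -/
theorem rkLaw_tvLe {p q μ : ℝ} (hq : 0 < q) (hqp : q < p) (hp : p ≤ 1) {w m : ℝ}
    (hw : (w = p ∧ m = μ) ∨ (w = q ∧ m = 0)) (n : ℕ) :
    TVLe (rkLaw p q μ w n) (gaussianReal m 1)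
      (ENNReal.ofReal (1 / (p - q)) *
        (gaussianReal μ 1 {x | p * gaussianPDFReal 0 1 x < q * gaussianPDFReal μ 1 x} +
          gaussianReal 0 1 {x | (1 - q) * gaussianPDFReal μ 1 x <
            (1 - p) * gaussianPDFReal 0 1 x}) +
        (ENNReal.ofReal (rkRejectBound p q true) ^ n +
          ENNReal.ofReal (rkRejectBound p q false) ^ n)) := by
  intro f hf h1
  have hrun : Measurable fun a : Bool × (Fin n → ℝ × ℝ) => rkRun p q μ a.1 n a.2 :=
    (measurable_rkRun p q n).comp (f := fun a : Bool × (Fin n → ℝ × ℝ) => (μ, a.1, a.2))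
      (by fun_prop)
  have hw0 : 0 ≤ w := by rcases hw with h | h <;> linarith
  have hw1 : w ≤ 1 := by rcases hw with h | h <;> linarith
  have hpq : 0 < p - q := by linarith
  have mφ : ∀ m : ℝ, Measurable (gaussianPDFReal m 1) := fun m => measurable_gaussianPDFReal m 1
  set B0 := {x | p * gaussianPDFReal 0 1 x < q * gaussianPDFReal μ 1 x} with hB0
  set B1 := {x | (1 - q) * gaussianPDFReal μ 1 x < (1 - p) * gaussianPDFReal 0 1 x} with hB1
  have mB0 : MeasurableSet B0 := measurableSet_lt ((mφ 0).const_mul _) ((mφ μ).const_mul _)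
  have mB1 : MeasurableSet B1 := measurableSet_lt ((mφ μ).const_mul _) ((mφ 0).const_mul _)
  rw [rkLaw, lintegral_map hf hrun, lintegral_prod (fun a => f (rkRun p q μ a.1 n a.2))
    (hf.comp hrun).aemeasurable, lintegral_bern hw0 hw1]
  set g1 : ℝ → ℝ := fun x =>
    ((1 - q) * gaussianPDFReal μ 1 x - (1 - p) * gaussianPDFReal 0 1 x) / (p - q)
  set g0 : ℝ → ℝ := fun x =>
    (p * gaussianPDFReal 0 1 x - q * gaussianPDFReal μ 1 x) / (p - q)
  have mg1 : Measurable g1 := by have := mφ 0; have := mφ μ; fun_prop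
  have mg0 : Measurable g0 := by have := mφ 0; have := mφ μ; fun_prop
  have r1 : ∫⁻ ω, f (rkRun p q μ true n ω) ∂rkNoise n ≤
      (∫⁻ x, f x * ENNReal.ofReal (g1 x)) + ENNReal.ofReal (rkRejectBound p q true) ^ n := by
    simpa [g1] using lintegral_rkRun_le' (b := true) (μ := μ) hq hqp hp hf h1 n
  have r0 : ∫⁻ ω, f (rkRun p q μ false n ω) ∂rkNoise n ≤
      (∫⁻ x, f x * ENNReal.ofReal (g0 x)) + ENNReal.ofReal (rkRejectBound p q false) ^ n := by
    simpa [g0] using lintegral_rkRun_le' (b := false) (μ := μ) hq hqp hp hf h1 n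
  set φb : ℝ → ENNReal := fun x => ENNReal.ofReal (1 / (p - q)) *
    (B0.indicator 1 x * ENNReal.ofReal (gaussianPDFReal μ 1 x) +
      B1.indicator 1 x * ENNReal.ofReal (gaussianPDFReal 0 1 x))
  have pointwise : ∀ x, ENNReal.ofReal w * ENNReal.ofReal (g1 x) +
      ENNReal.ofReal (1 - w) * ENNReal.ofReal (g0 x) ≤
      ENNReal.ofReal (gaussianPDFReal m 1 x) + φb x := by
    intro x
    have e0 : B0.indicator (1 : ℝ → ENNReal) x = ENNReal.ofReal (B0.indicator 1 x) := by
      by_cases h : x ∈ B0 <;> simp [h]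
    have e1 : B1.indicator (1 : ℝ → ENNReal) x = ENNReal.ofReal (B1.indicator 1 x) := by
      by_cases h : x ∈ B1 <;> simp [h]
    have p0 := gaussianPDFReal_pos 0 1 x one_ne_zero
    have p1 := gaussianPDFReal_pos μ 1 x one_ne_zero
    have i0 : 0 ≤ B0.indicator (1 : ℝ → ℝ) x := Set.indicator_nonneg (by simp) x
    have i1 : 0 ≤ B1.indicator (1 : ℝ → ℝ) x := Set.indicator_nonneg (by simp) x
    have hinv : 0 < 1 / (p - q) := by positivity
    simp only [φb]
    rw [e0, e1, ← ENNReal.ofReal_mul i0, ← ENNReal.ofReal_mul i1,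
      ← ENNReal.ofReal_add (by positivity) (by positivity), ← ENNReal.ofReal_mul hinv.le,
      ← ENNReal.ofReal_add (gaussianPDFReal_nonneg _ _ _) (by positivity),
      ← ENNReal.ofReal_mul hw0, ← ENNReal.ofReal_mul (by linarith)]
    -- The negative part of `g1` lives on `B1` and is at most `(1 - p) φ_0 / (p - q) ≤ φ_0 / (p -
    -- q)`. Likewise that of `g0` lives on `B0` and is at most `φ_μ / (p - q)`.
    have k1 : max (g1 x) 0 ≤ g1 x + 1 / (p - q) * (B1.indicator 1 x * gaussianPDFReal 0 1 x) := by
      by_cases h : x ∈ B1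
      · refine max_le (by simp [h]; positivity) ?_
        simp only [g1, h, Set.indicator_of_mem, Pi.one_apply, one_mul]
        rw [div_eq_inv_mul, one_div, ← mul_add]
        refine mul_nonneg (by positivity) ?_
        nlinarith
      · have h' : (1 - p) * gaussianPDFReal 0 1 x ≤ (1 - q) * gaussianPDFReal μ 1 x :=
          not_lt.1 h
        refine max_le (by simp [h]) ?_
        simp only [h, not_false_eq_true, Set.indicator_of_notMem, zero_mul, mul_zero, add_zero]
        exact div_nonneg (by linarith) hpq.le
    have k0 : max (g0 x) 0 ≤ g0 x + 1 / (p - q) * (B0.indicator 1 x * gaussianPDFReal μ 1 x) := by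
      by_cases h : x ∈ B0
      · refine max_le (by simp [h]; positivity) ?_
        simp only [g0, h, Set.indicator_of_mem, Pi.one_apply, one_mul]
        rw [div_eq_inv_mul, one_div, ← mul_add]
        refine mul_nonneg (by positivity) ?_
        nlinarith
      · have h' : q * gaussianPDFReal μ 1 x ≤ p * gaussianPDFReal 0 1 x :=
          not_lt.1 h
        refine max_le (by simp [h]) ?_
        simp only [h, not_false_eq_true, Set.indicator_of_notMem, zero_mul, mul_zero, add_zero]
        exact div_nonneg (by linarith) hpq.le
    have hmix : w * g1 x + (1 - w) * g0 x = gaussianPDFReal m 1 x := by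
      simp only [g1, g0]
      rcases hw with ⟨rfl, rfl⟩ | ⟨rfl, rfl⟩ <;> field_simp <;> ring
    rw [← ofReal_max_zero (w * g1 x), ← ofReal_max_zero ((1 - w) * g0 x),
      ← ENNReal.ofReal_add (by simp) (by simp)]
    refine ENNReal.ofReal_le_ofReal ?_
    have t1 : max (w * g1 x) 0 = w * max (g1 x) 0 := by
      rw [mul_max_of_nonneg _ _ hw0, mul_zero]
    have t0 : max ((1 - w) * g0 x) 0 = (1 - w) * max (g0 x) 0 := by
      rw [mul_max_of_nonneg _ _ (by linarith), mul_zero]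
    rw [t1, t0]
    set a0 := 1 / (p - q) * (B0.indicator 1 x * gaussianPDFReal μ 1 x)
    set a1 := 1 / (p - q) * (B1.indicator 1 x * gaussianPDFReal 0 1 x)
    have ha0 : 0 ≤ a0 := by positivity
    have ha1 : 0 ≤ a1 := by positivity
    rw [mul_add]
    change _ ≤ gaussianPDFReal m 1 x + (a0 + a1)
    nlinarith [mul_le_mul_of_nonneg_left k1 hw0,
      mul_le_mul_of_nonneg_left k0 (sub_nonneg.2 hw1)]
  have hw1' : ENNReal.ofReal w ≤ 1 := by simpa using hw1
  have hw0' : ENNReal.ofReal (1 - w) ≤ 1 := by simpa using hw0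
  have mφb : Measurable φb := by
    have := mφ 0; have := mφ μ
    have : Measurable (B0.indicator (1 : ℝ → ENNReal)) := measurable_one.indicator mB0
    have : Measurable (B1.indicator (1 : ℝ → ENNReal)) := measurable_one.indicator mB1
    fun_prop
  have gB : ∀ (m : ℝ) (B : Set ℝ), MeasurableSet B →
      ∫⁻ x, B.indicator 1 x * ENNReal.ofReal (gaussianPDFReal m 1 x) = gaussianReal m 1 B := by
    intro m B hB
    rw [← lintegral_gaussianReal_eq (measurable_one.indicator hB), lintegral_indicator_one hB]
  set R1 := ENNReal.ofReal (rkRejectBound p q true) ^ n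
  set R0 := ENNReal.ofReal (rkRejectBound p q false) ^ n
  calc _ ≤ ENNReal.ofReal w * ((∫⁻ x, f x * ENNReal.ofReal (g1 x)) + R1) +
        ENNReal.ofReal (1 - w) * ((∫⁻ x, f x * ENNReal.ofReal (g0 x)) + R0) := by gcongr
    _ ≤ (ENNReal.ofReal w * (∫⁻ x, f x * ENNReal.ofReal (g1 x)) +
        ENNReal.ofReal (1 - w) * (∫⁻ x, f x * ENNReal.ofReal (g0 x))) + (R1 + R0) := by
        rw [mul_add, mul_add, add_add_add_comm]
        gcongr
        · exact mul_le_of_le_one_left' hw1'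
        · exact mul_le_of_le_one_left' hw0'
    _ = (∫⁻ x, f x * (ENNReal.ofReal w * ENNReal.ofReal (g1 x) +
          ENNReal.ofReal (1 - w) * ENNReal.ofReal (g0 x))) + (R1 + R0) := by
        rw [← lintegral_const_mul _ (by fun_prop), ← lintegral_const_mul _ (by fun_prop),
          ← lintegral_add_left (by fun_prop)]
        congr 1
        exact lintegral_congr fun x => by ring
    _ ≤ (∫⁻ x, (f x * ENNReal.ofReal (gaussianPDFReal m 1 x) + φb x)) + (R1 + R0) := by
        refine add_le_add (lintegral_mono fun x => ?_) le_rfl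
        calc _ ≤ f x * (ENNReal.ofReal (gaussianPDFReal m 1 x) + φb x) := by
              exact mul_le_mul_right (pointwise x) _
          _ ≤ _ := by rw [mul_add]; gcongr; exact mul_le_of_le_one_left' (h1 x)
    _ = _ := by
        rw [lintegral_add_right _ mφb, ← lintegral_gaussianReal_eq hf, add_assoc]
        congr 2
        simp only [φb]
        rw [lintegral_const_mul, lintegral_add_left, gB _ _ mB0, gB _ _ mB1]
        · have := mφ μ
          have : Measurable (B0.indicator (1 : ℝ → ENNReal)) := measurable_one.indicator mB0
          fun_prop
        · have := mφ 0; have := mφ μ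
          have : Measurable (B0.indicator (1 : ℝ → ENNReal)) := measurable_one.indicator mB0
          have : Measurable (B1.indicator (1 : ℝ → ENNReal)) := measurable_one.indicator mB1
          fun_prop
end

/-! ### Gaussian tails, the parameter `δ` and the error of one entry -/

noncomputable section

/-- Chernoff with exponent parameter `s`: `-s² + s²/2 = -s²/2`. -/
theorem gaussianReal_Ici_le {s : ℝ} (hs : 0 ≤ s) :
    gaussianReal 0 1 {x | s ≤ x} ≤ ENNReal.ofReal (Real.exp (-s ^ 2 / 2)) := by
  have h := measure_ge_le_exp_mul_mgf (μ := gaussianReal 0 1) (X := id) s hs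
    (by simpa using integrable_exp_mul_gaussianReal (μ := 0) (v := 1) s)
  rw [mgf_id_gaussianReal, ← Real.exp_add] at h
  rw [← ENNReal.ofReal_toReal (measure_ne_top (gaussianReal 0 1) _)]
  refine ENNReal.ofReal_le_ofReal (h.trans (le_of_eq ?_))
  congr 1
  simp only [NNReal.coe_one]
  ring

theorem gaussianReal_Iic_neg_le {s : ℝ} (hs : 0 ≤ s) :
    gaussianReal 0 1 {x | x ≤ -s} ≤ ENNReal.ofReal (Real.exp (-s ^ 2 / 2)) := by
  have h := measure_le_le_exp_mul_mgf (μ := gaussianReal 0 1) (X := id) (-s) (t := -s)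
    (by linarith) (by simpa using integrable_exp_mul_gaussianReal (μ := 0) (v := 1) (-s))
  rw [mgf_id_gaussianReal, ← Real.exp_add] at h
  rw [← ENNReal.ofReal_toReal (measure_ne_top (gaussianReal 0 1) _)]
  refine ENNReal.ofReal_le_ofReal (h.trans (le_of_eq ?_))
  congr 1
  simp only [NNReal.coe_one]
  ring

theorem gaussianPDFReal_mean_eq (μ x : ℝ) :
    gaussianPDFReal μ 1 x = gaussianPDFReal 0 1 x * Real.exp (μ * x - μ ^ 2 / 2) := by
  simp only [gaussianPDFReal]
  rw [mul_assoc _ (Real.exp _) (Real.exp _), ← Real.exp_add]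
  congr 2
  simp only [NNReal.coe_one]
  ring

theorem rkDelta_le_log_div (P Q : ℝ) : rkDelta P Q ≤ Real.log (P / Q) := by
  unfold rkDelta; split_ifs
  · exact le_rfl
  · exact min_le_left _ _

theorem rkDelta_le_log_one_sub_div {P Q : ℝ} (h : P < 1) :
    rkDelta P Q ≤ Real.log ((1 - Q) / (1 - P)) := by
  unfold rkDelta; rw [if_neg h.ne]; exact min_le_right _ _

/-- From `log x ≥ 1 - 1/x` the two logarithms are at least `(P - Q)/P` and `(P - Q)/(1 - Q)`, and
both denominators are at most `1`. This gives `δ > 0` and, later, a polynomial iteration count. -/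
theorem sub_le_rkDelta {P Q : ℝ} (hQ : 0 < Q) (hQP : Q < P) (hP : P ≤ 1) :
    P - Q ≤ rkDelta P Q := by
  have h1 : P - Q ≤ Real.log (P / Q) := by
    have := Real.one_sub_inv_le_log_of_pos (x := P / Q) (div_pos (by linarith) hQ)
    refine le_trans ?_ this
    rw [inv_div, ← div_self (by linarith : P ≠ 0), ← sub_div, le_div_iff₀ (by linarith)]
    nlinarith
  unfold rkDelta; split_ifs with h
  · exact h1
  · have hP1 : 0 < 1 - P := by
      rcases lt_or_eq_of_le hP with h' | h'
      · linarith
      · exact absurd h' h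
    refine le_min h1 ?_
    have := Real.one_sub_inv_le_log_of_pos (x := (1 - Q) / (1 - P)) (div_pos (by linarith) hP1)
    refine le_trans ?_ this
    have hQ1 : 1 - Q ≠ 0 := by linarith
    rw [inv_div, show 1 - (1 - P) / (1 - Q) = (P - Q) / (1 - Q) by field_simp; ring,
      le_div_iff₀ (by linarith)]
    nlinarith

theorem rkRejectBound_le {P Q : ℝ} (hQ : 0 < Q) (hQP : Q < P) (hP : P ≤ 1) (b : Bool) :
    rkRejectBound P Q b ≤ Real.exp (-rkDelta P Q) := by
  cases b <;> simp only [rkRejectBound, if_true, Bool.false_eq_true, if_false]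
  · rw [← inv_div, ← Real.exp_log (div_pos (hQ.trans hQP) hQ), ← Real.exp_neg]
    exact Real.exp_le_exp.2 (neg_le_neg (rkDelta_le_log_div P Q))
  · rcases lt_or_eq_of_le hP with h | h
    · rw [← inv_div, ← Real.exp_log (div_pos (by linarith : 0 < 1 - Q) (by linarith : 0 < 1 - P)),
        ← Real.exp_neg]
      exact Real.exp_le_exp.2 (neg_le_neg (rkDelta_le_log_one_sub_div h))
    · simp [h, Real.exp_nonneg]

/-- With `x = z + μ` the event says `μ z + μ²/2 > log (P/Q) ≥ δ`. Since `μ² ≤ δ`, this forces `μ z >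
δ/2 ≥ μ s`. For `μ = 0` the event is empty. -/
theorem rk_tail_false {P Q μ s : ℝ} (hQ : 0 < Q) (hQP : Q < P) (hP : P ≤ 1) (hμ : 0 ≤ μ)
    (hs : 0 ≤ s) (h1 : μ ^ 2 ≤ rkDelta P Q) (h2 : 2 * μ * s ≤ rkDelta P Q) :
    gaussianReal μ 1 {x | P * gaussianPDFReal 0 1 x < Q * gaussianPDFReal μ 1 x} ≤
      ENNReal.ofReal (Real.exp (-s ^ 2 / 2)) := by
  have hδ : 0 < rkDelta P Q := by linarith [sub_le_rkDelta hQ hQP hP]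
  have hmap : gaussianReal μ 1 = (gaussianReal 0 1).map (fun z => z + μ) := by
    rw [gaussianReal_map_add_const]; simp
  rw [hmap, Measure.map_apply (by fun_prop) (measurableSet_lt
    ((measurable_gaussianPDFReal _ _).const_mul _) ((measurable_gaussianPDFReal _ _).const_mul _))]
  refine (measure_mono fun z hz => ?_).trans (gaussianReal_Ici_le hs)
  have hz' : P * gaussianPDFReal 0 1 (z + μ) < Q * gaussianPDFReal μ 1 (z + μ) := hz
  have p0 := gaussianPDFReal_pos 0 1 (z + μ) one_ne_zero
  rw [gaussianPDFReal_mean_eq μ] at hz'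
  have : P / Q < Real.exp (μ * (z + μ) - μ ^ 2 / 2) := by
    rw [div_lt_iff₀ hQ]
    by_contra hcon
    nlinarith
  have := (Real.log_lt_iff_lt_exp (div_pos (by linarith) hQ)).2 this
  have h3 := rkDelta_le_log_div P Q
  change s ≤ z
  rcases hμ.eq_or_lt with h | h
  · subst h; simp at this; linarith
  · by_contra hcon
    nlinarith

/-- The event gives `μ z - μ²/2 < -δ`, hence `μ z < -δ/2 ≤ -μ s`. It is empty when `P = 1` or `μ =
0`. -/
theorem rk_tail_true {P Q μ s : ℝ} (hQ : 0 < Q) (hQP : Q < P) (hP : P ≤ 1) (hμ : 0 ≤ μ)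
    (hs : 0 ≤ s) (h1 : μ ^ 2 ≤ rkDelta P Q) (h2 : 2 * μ * s ≤ rkDelta P Q) :
    gaussianReal 0 1 {x | (1 - Q) * gaussianPDFReal μ 1 x < (1 - P) * gaussianPDFReal 0 1 x} ≤
      ENNReal.ofReal (Real.exp (-s ^ 2 / 2)) := by
  have hδ : 0 < rkDelta P Q := by linarith [sub_le_rkDelta hQ hQP hP]
  refine (measure_mono fun z hz => ?_).trans (gaussianReal_Iic_neg_le hs)
  have hz' : (1 - Q) * gaussianPDFReal μ 1 z < (1 - P) * gaussianPDFReal 0 1 z := hz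
  have p0 := gaussianPDFReal_pos 0 1 z one_ne_zero
  have p1 := gaussianPDFReal_pos μ 1 z one_ne_zero
  have hP1 : 0 < 1 - P := by
    by_contra hcon
    nlinarith
  rw [gaussianPDFReal_mean_eq μ] at hz'
  have : Real.exp (μ * z - μ ^ 2 / 2) < ((1 - Q) / (1 - P))⁻¹ := by
    rw [inv_div, lt_div_iff₀ (by linarith)]
    by_contra hcon
    nlinarith
  have := (Real.lt_log_iff_exp_lt (inv_pos.2 (div_pos (by linarith) hP1))).2 this
  rw [Real.log_inv] at this
  have h3 := rkDelta_le_log_one_sub_div (Q := Q) (by linarith : P < 1)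
  change z ≤ -s
  rcases hμ.eq_or_lt with h | h
  · subst h; simp at this; linarith
  · by_contra hcon
    nlinarith

/-- The rejection kernel maps `Bern(P)` and `Bern(Q)` close to `N(μ, 1)` and `N(0, 1)`. -/
theorem rkLaw_rkIter_tvLe {N : ℕ} {P Q μ τ c : ℝ} (hc : 0 < c) (hN : 1 / c ≤ N) (hcQ : c ≤ Q)
    (hQ1 : Q < 1) (hQP : Q < P) (hP : P ≤ 1)
    (hτ : τ ≤ rkDelta P Q / (2 * √(6 * Real.log N + 2 * Real.log (P - Q)⁻¹)))
    (hμ : 0 ≤ μ) (hμτ : μ ≤ τ) {w m : ℝ} (hw : (w = P ∧ m = μ) ∨ (w = Q ∧ m = 0)) :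
    TVLe (rkLaw P Q μ w (rkIter N P Q)) (gaussianReal m 1)
      (ENNReal.ofReal (4 * ((N : ℝ) ^ 3)⁻¹)) := by
  have hQ : 0 < Q := hc.trans_le hcQ
  have hδ : 0 < rkDelta P Q := by linarith [sub_le_rkDelta hQ hQP hP]
  have hc1 : c < 1 := by linarith
  have hN1 : (1 : ℝ) < N := lt_of_lt_of_le (by rw [lt_div_iff₀ hc]; linarith) hN
  have hN0 : (0 : ℝ) < N := by linarith
  have hlogN : 0 < Real.log N := Real.log_pos hN1
  have hPQ : 0 < P - Q := by linarith
  have hlogPQ : 0 < Real.log (P - Q)⁻¹ := Real.log_pos (by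
    rw [one_lt_inv₀ hPQ]; linarith)
  -- This `s` makes `exp (-s²/2) = N⁻³ (P - Q)`; the factor `P - Q` cancels the `1 / (P - Q)` in
  -- front of the tails.
  set s := √(6 * Real.log N + 2 * Real.log (P - Q)⁻¹) with hs
  have hs2 : s ^ 2 = 6 * Real.log N + 2 * Real.log (P - Q)⁻¹ :=
    Real.sq_sqrt (by positivity)
  have hspos : 0 < s := Real.sqrt_pos.2 (by positivity)
  -- Here `N ≥ 1/c` enters: `P/Q ≤ 1/c ≤ N`. Smaller `N` are trivial in the theorem, as total
  -- variation is at most `1`.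
  have hδN : rkDelta P Q ≤ Real.log N := by
    refine (rkDelta_le_log_div P Q).trans (Real.log_le_log (div_pos (by linarith) hQ) ?_)
    refine le_trans ?_ hN
    rw [div_le_div_iff₀ hQ hc]
    nlinarith
  have hμs : 2 * μ * s ≤ rkDelta P Q := by
    have := hμτ.trans hτ
    rw [le_div_iff₀ (by positivity)] at this
    linarith
  -- From `4 s² μ² ≤ δ²` and `δ ≤ log N ≤ 4 s²`.
  have hμ2 : μ ^ 2 ≤ rkDelta P Q := by
    have e1 : (2 * μ * s) ^ 2 ≤ rkDelta P Q ^ 2 := by gcongr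
    have e2 : rkDelta P Q ≤ 4 * s ^ 2 := by rw [hs2]; linarith
    have e3 : 4 * s ^ 2 * μ ^ 2 ≤ 4 * s ^ 2 * rkDelta P Q := by nlinarith
    exact le_of_mul_le_mul_left e3 (by positivity)
  have hexp : Real.exp (-s ^ 2 / 2) = ((N : ℝ) ^ 3)⁻¹ * (P - Q) := by
    have : -s ^ 2 / 2 = -(3 * Real.log N) + Real.log (P - Q) := by
      rw [hs2, Real.log_inv]; ring
    rw [this, Real.exp_add, Real.exp_log hPQ, Real.exp_neg, mul_comm 3, Real.exp_mul,
      Real.exp_log hN0]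
    norm_cast
  -- The iteration count gives a failure probability of at most `N⁻⁶`; only `N⁻³` is needed.
  have hrej : ∀ b, ENNReal.ofReal (rkRejectBound P Q b) ^ rkIter N P Q ≤
      ENNReal.ofReal ((N : ℝ) ^ 3)⁻¹ := by
    intro b
    calc _ ≤ ENNReal.ofReal (Real.exp (-rkDelta P Q)) ^ rkIter N P Q := by
          gcongr; exact rkRejectBound_le hQ hQP hP b
      _ = ENNReal.ofReal (Real.exp (-(rkIter N P Q * rkDelta P Q))) := by
          rw [← ENNReal.ofReal_pow (Real.exp_nonneg _), ← Real.exp_nat_mul]; ring_nf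
      _ ≤ _ := by
          refine ENNReal.ofReal_le_ofReal ?_
          have h6 : 6 * Real.log N ≤ rkIter N P Q * rkDelta P Q := by
            have := Nat.le_ceil (6 * (rkDelta P Q)⁻¹ * Real.log N)
            have h' := mul_le_mul_of_nonneg_right this hδ.le
            calc _ = 6 * (rkDelta P Q)⁻¹ * Real.log N * rkDelta P Q := by field_simp
              _ ≤ _ := h'
          calc _ ≤ Real.exp (-(3 * Real.log N)) := Real.exp_le_exp.2 (by linarith)
            _ = _ := by
              rw [Real.exp_neg, mul_comm 3, Real.exp_mul, Real.exp_log hN0]; norm_cast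
  refine (rkLaw_tvLe hQ hQP hP hw _).mono ?_
  calc _ ≤ ENNReal.ofReal (1 / (P - Q)) * (ENNReal.ofReal (((N : ℝ) ^ 3)⁻¹ * (P - Q)) +
        ENNReal.ofReal (((N : ℝ) ^ 3)⁻¹ * (P - Q))) +
        (ENNReal.ofReal ((N : ℝ) ^ 3)⁻¹ + ENNReal.ofReal ((N : ℝ) ^ 3)⁻¹) := by
        gcongr
        · rw [← hexp]; exact rk_tail_false hQ hQP hP hμ hspos.le hμ2 hμs
        · rw [← hexp]; exact rk_tail_true hQ hQP hP hμ hspos.le hμ2 hμs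
        · exact hrej _
        · exact hrej _
    _ = _ := by
        rw [← ENNReal.ofReal_add (by positivity) (by positivity),
          ← ENNReal.ofReal_mul (by positivity),
          ← ENNReal.ofReal_add (by positivity) (by positivity),
          ← ENNReal.ofReal_add (by positivity) (by positivity)]
        congr 1
        field_simp
        ring
end

noncomputable section

/-! ### Orthogonal invariance of Gaussian vectors and Gram–Schmidt -/

section Resample
variable {ι : Type*} [Fintype ι] [DecidableEq ι] {X : ι → Type*} [∀ i, MeasurableSpace (X i)]

theorem pi_map_update (μ : ∀ i, Measure (X i)) [∀ i, IsProbabilityMeasure (μ i)] (i : ι) :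
    ((Measure.pi μ).prod (μ i)).map (fun a => Function.update a.1 i a.2) = Measure.pi μ := by
  have hm : Measurable fun a : (∀ i, X i) × X i => Function.update a.1 i a.2 := by
    refine measurable_pi_lambda _ fun j => ?_
    by_cases h : j = i
    · subst h; simpa using measurable_snd
    · simp only [Function.update_of_ne h]; fun_prop
  refine (Measure.pi_eq fun s hs => ?_).symm
  rw [Measure.map_apply hm (MeasurableSet.univ_pi hs)]
  have : (fun a : (∀ i, X i) × X i => Function.update a.1 i a.2) ⁻¹' (Set.univ.pi s) =
      (Set.univ.pi (Function.update s i Set.univ)) ×ˢ s i := by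
    ext ⟨g, x⟩
    simp only [Set.mem_preimage, Set.mem_univ_pi, Set.mem_prod]
    constructor
    · refine fun h => ⟨fun j => ?_, by simpa using h i⟩
      by_cases hj : j = i
      · subst hj; simp
      · simpa [hj] using h j
    · rintro ⟨h1, h2⟩ j
      by_cases hj : j = i
      · subst hj; simpa using h2
      · simpa [hj] using h1 j
  rw [this, Measure.prod_prod, Measure.pi_pi, ← Finset.prod_erase_mul _ _ (Finset.mem_univ i),
    ← Finset.prod_erase_mul (s := Finset.univ) (f := fun j => μ j (s j)) (Finset.mem_univ i)]
  simp only [Function.update_self, measure_univ, mul_one]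
  congr 1
  refine Finset.prod_congr rfl fun j hj => ?_
  rw [Function.update_of_ne (Finset.ne_of_mem_erase hj)]

/-- Resampling one coordinate does not change a product law, so by Fubini a set is null once its
slices in that coordinate are null. -/
theorem pi_eq_zero_of_update (μ : ∀ i, Measure (X i)) [∀ i, IsProbabilityMeasure (μ i)] (i : ι)
    {B : Set (∀ i, X i)} (hB : MeasurableSet B)
    (h : ∀ g, μ i {x | Function.update g i x ∈ B} = 0) : Measure.pi μ B = 0 := by
  have hm : Measurable fun a : (∀ i, X i) × X i => Function.update a.1 i a.2 := by
    refine measurable_pi_lambda _ fun j => ?_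
    by_cases h : j = i
    · subst h; simpa using measurable_snd
    · simp only [Function.update_of_ne h]; fun_prop
  rw [← pi_map_update μ i, Measure.map_apply hm hB, Measure.prod_apply (hB.preimage hm)]
  exact (lintegral_congr fun g => h g).trans (by simp)
end Resample

open Matrix in
/-- A nontrivial linear condition has Gaussian measure zero. -/
theorem gaussian_linear_null {N : ℕ} {A : Matrix (Fin N) (Fin N) ℝ} (hA : A ≠ 0) :
    (Measure.pi fun _ : Fin N => gaussianReal 0 1) {g | A *ᵥ g = 0} = 0 := by
  have : NullSingletonClass (gaussianReal 0 1) := nullSingletonClass_gaussianReal one_ne_zero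
  -- With all coordinates but `j` fixed, equation `i` determines `g j`, and a single point has
  -- Gaussian measure zero.
  obtain ⟨i, j, hij⟩ : ∃ i j, A i j ≠ 0 := by
    by_contra hcon
    push Not at hcon
    exact hA (by ext i j; exact hcon i j)
  have hm : Measurable fun g : Fin N → ℝ => A *ᵥ g :=
    measurable_pi_lambda _ fun i => by simp only [mulVec, dotProduct]; fun_prop
  refine pi_eq_zero_of_update _ j (hm (measurableSet_singleton 0)) fun g => ?_
  refine Set.Subsingleton.measure_zero (fun x hx y hy => ?_) _
  have hx' : A *ᵥ Function.update g j x = 0 := hx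
  have hy' : A *ᵥ Function.update g j y = 0 := hy
  have e : ∀ z, (A *ᵥ Function.update g j z) i = A i j * z + ∑ l ∈ Finset.univ.erase j, A i l * g l := by
    intro z
    simp only [mulVec, dotProduct]
    rw [← Finset.add_sum_erase _ _ (Finset.mem_univ j), Function.update_self]
    congr 1
    refine Finset.sum_congr rfl fun l hl => ?_
    rw [Function.update_of_ne (Finset.ne_of_mem_erase hl)]
  have h1 := congrFun hx' i
  have h2 := congrFun hy' i
  rw [e] at h1 h2
  have : A i j * x = A i j * y := by
    simp only [Pi.zero_apply] at h1 h2; linarith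
  exact mul_left_cancel₀ hij this

open Matrix in
theorem dotProduct_mulVec_orthogonal {N : ℕ} {U : Matrix (Fin N) (Fin N) ℝ} (hU : Uᵀ * U = 1)
    (x y : Fin N → ℝ) : (U *ᵥ x) ⬝ᵥ (U *ᵥ y) = x ⬝ᵥ y := by
  rw [dotProduct_mulVec, ← mulVec_transpose, mulVec_mulVec, hU, one_mulVec]

open Matrix in
/-- A standard Gaussian vector is invariant under orthogonal maps. -/
theorem pi_gaussian_map_mulVec {N : ℕ} {U : Matrix (Fin N) (Fin N) ℝ} (hU : Uᵀ * U = 1) :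
    (Measure.pi fun _ : Fin N => gaussianReal 0 1).map (fun g => U *ᵥ g) =
      Measure.pi fun _ : Fin N => gaussianReal 0 1 := by
  let L : EuclideanSpace ℝ (Fin N) →ₗᵢ[ℝ] EuclideanSpace ℝ (Fin N) :=
    { toLinearMap := Matrix.toEuclideanLin U
      norm_map' := fun x => by
        have : ‖Matrix.toEuclideanLin U x‖ ^ 2 = ‖x‖ ^ 2 := by
          rw [EuclideanSpace.real_norm_sq_eq, EuclideanSpace.real_norm_sq_eq]
          have := dotProduct_mulVec_orthogonal hU x.ofLp x.ofLp
          simp only [dotProduct, ← pow_two] at this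
          simpa [Matrix.toLpLin_apply] using this
        exact (pow_left_inj₀ (norm_nonneg _) (norm_nonneg _) two_ne_zero).1 this }
  have h := stdGaussian_map (L.toLinearIsometryEquiv rfl)
  rw [← map_pi_eq_stdGaussian, Measure.map_map (by fun_prop) (by fun_prop)] at h
  have h2 := congrArg (Measure.map (WithLp.ofLp)) h
  rw [Measure.map_map (by fun_prop) (by fun_prop), Measure.map_map (by fun_prop) (by fun_prop)] at h2
  have e1 : (WithLp.ofLp ∘ (L.toLinearIsometryEquiv rfl) ∘ WithLp.toLp 2) =
      fun g : Fin N → ℝ => U *ᵥ g := by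
    funext g
    simp [L, Matrix.toLpLin_apply]
  have e2 : (WithLp.ofLp ∘ WithLp.toLp 2) = (id : (Fin N → ℝ) → _) := rfl
  rwa [e1, e2, Measure.map_id] at h2

open Matrix in
theorem gaussianMatrix_map_mulVec {N : ℕ} {U : Matrix (Fin N) (Fin N) ℝ} (hU : Uᵀ * U = 1) :
    (gaussianMatrix N).map (fun G t => U *ᵥ G t) = gaussianMatrix N := by
  have hm : Measurable fun g : Fin N → ℝ => U *ᵥ g :=
    measurable_pi_lambda _ fun i => by simp only [mulVec, dotProduct]; fun_prop
  unfold gaussianMatrix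
  have : ∀ i : Fin N, SigmaFinite ((Measure.pi fun _ : Fin N => gaussianReal 0 1).map
      (fun g => U *ᵥ g)) := fun i => by rw [pi_gaussian_map_mulVec hU]; infer_instance
  rw [Measure.pi_map_pi (f := fun _ g => U *ᵥ g) fun i => hm.aemeasurable]
  simp only [pi_gaussian_map_mulVec hU]

open Matrix in
/-- Two vectors of the same norm are related by an orthogonal matrix. -/
theorem exists_orthogonal_mulVec_eq {N : ℕ} {u v : Fin N → ℝ} (h : u ⬝ᵥ u = v ⬝ᵥ v) :
    ∃ U : Matrix.orthogonalGroup (Fin N) ℝ, (U : Matrix (Fin N) (Fin N) ℝ)ᵀ *ᵥ u = v := by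
  by_cases huv : u = v
  · exact ⟨1, by simp [huv]⟩
  set w := u - v with hw
  have hw0 : w ⬝ᵥ w ≠ 0 := by
    rw [Ne, dotProduct_self_eq_zero]; exact sub_ne_zero.2 huv
  have hwu : w ⬝ᵥ w = 2 * (w ⬝ᵥ u) := by
    simp only [hw, sub_dotProduct, dotProduct_sub, dotProduct_comm v u]
    linarith
  -- The Householder reflection in `w = u - v`. Equality of the norms gives `w ⬝ᵥ w = 2 (w ⬝ᵥ u)`,
  -- so that it sends `u` to `u - w = v`.
  let O : Matrix (Fin N) (Fin N) ℝ := 1 - (2 / (w ⬝ᵥ w)) • vecMulVec w w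
  have hT : Oᵀ = O := by
    simp [O, transpose_vecMulVec]
  have hvv : vecMulVec w w * vecMulVec w w = (w ⬝ᵥ w) • vecMulVec w w := by
    rw [vecMulVec_mul_vecMulVec]
    ext i j; simp [vecMulVec_apply]; ring
  refine ⟨⟨O, ?_⟩, ?_⟩
  · rw [mem_orthogonalGroup_iff, hT]
    simp only [O, mul_sub, sub_mul, one_mul, mul_one, smul_mul_smul_comm, hvv, smul_smul]
    rw [show 2 / w ⬝ᵥ w * (2 / w ⬝ᵥ w) * w ⬝ᵥ w = 2 / w ⬝ᵥ w + 2 / w ⬝ᵥ w by field_simp; ring,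
      add_smul]
    abel
  · change Oᵀ *ᵥ u = v
    rw [hT, sub_mulVec, one_mulVec, smul_mulVec, vecMulVec_mulVec]
    ext i
    simp only [Pi.sub_apply, Pi.smul_apply, smul_eq_mul, MulOpposite.smul_eq_mul_unop,
      MulOpposite.unop_op]
    have : 2 / w ⬝ᵥ w * (w i * w ⬝ᵥ u) = w i := by
      rw [hwu]
      rw [hwu] at hw0
      have hne : w ⬝ᵥ u ≠ 0 := right_ne_zero_of_mul hw0
      field_simp
    rw [this]; simp [hw]
end

/-! ### Gram–Schmidt on a Gaussian matrix produces Haar measure -/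

noncomputable section

open Matrix

/-- The component of `g` orthogonal to the orthonormal columns of `R`. -/
def gsResidual {N : ℕ} (R : Matrix (Fin N) (Fin N) ℝ) (g : Fin N → ℝ) : Fin N → ℝ :=
  g - R *ᵥ (Rᵀ *ᵥ g)

/-- Gram–Schmidt applied to the first `t` rows of `G`; the results are the columns. -/
def gsMat {N : ℕ} (G : Fin N → Fin N → ℝ) : ℕ → Matrix (Fin N) (Fin N) ℝ
  | 0 => 0
  | t + 1 => if h : t < N then
      (gsMat G t).updateCol ⟨t, h⟩ fun i => gsResidual (gsMat G t) (G ⟨t, h⟩) i /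
        √(∑ a, gsResidual (gsMat G t) (G ⟨t, h⟩) a ^ 2)
    else gsMat G t

theorem gsMat_succ {N : ℕ} (G : Fin N → Fin N → ℝ) {t : ℕ} (h : t < N) :
    gsMat G (t + 1) = (gsMat G t).updateCol ⟨t, h⟩ fun i =>
      gsResidual (gsMat G t) (G ⟨t, h⟩) i /
        √(∑ a, gsResidual (gsMat G t) (G ⟨t, h⟩) a ^ 2) := by
  rw [gsMat, dif_pos h]

/-- The first `t` columns ignore row `t`, which can therefore be resampled as a fresh Gaussian
vector. -/
theorem gsMat_congr {N : ℕ} {G G' : Fin N → Fin N → ℝ} {t : ℕ}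
    (h : ∀ s : Fin N, s.1 < t → G s = G' s) : gsMat G t = gsMat G' t := by
  induction t with
  | zero => rfl
  | succ t ih =>
    have e := ih fun s hs => h s (by omega)
    by_cases ht : t < N
    · rw [gsMat_succ _ ht, gsMat_succ _ ht, e, h ⟨t, ht⟩ (by simp)]
    · rw [gsMat, gsMat, dif_neg ht, dif_neg ht, e]

theorem gsResidual_mulVec {N : ℕ} {U : Matrix (Fin N) (Fin N) ℝ} (hU : Uᵀ * U = 1)
    (R : Matrix (Fin N) (Fin N) ℝ) (g : Fin N → ℝ) :
    gsResidual (U * R) (U *ᵥ g) = U *ᵥ gsResidual R g := by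
  simp only [gsResidual, mulVec_sub, transpose_mul, mulVec_mulVec]
  rw [show Rᵀ * Uᵀ * U = Rᵀ by rw [Matrix.mul_assoc, hU, Matrix.mul_one], Matrix.mul_assoc U]

/-- Projections and norms are preserved by orthogonal maps, so each step of Gram–Schmidt commutes
with `U`. This is the source of left invariance. -/
theorem gsMat_mulVec {N : ℕ} {U : Matrix (Fin N) (Fin N) ℝ} (hU : Uᵀ * U = 1)
    (G : Fin N → Fin N → ℝ) (t : ℕ) : gsMat (fun s => U *ᵥ G s) t = U * gsMat G t := by
  induction t with
  | zero => simp [gsMat]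
  | succ t ih =>
    by_cases ht : t < N
    · rw [gsMat_succ _ ht, gsMat_succ _ ht, ih, mul_updateCol, gsResidual_mulVec hU]
      set r := gsResidual (gsMat G t) (G ⟨t, ht⟩)
      have hn : ∑ a, (U *ᵥ r) a ^ 2 = ∑ a, r a ^ 2 := by
        have := dotProduct_mulVec_orthogonal hU r r
        simpa only [dotProduct, ← pow_two] using this
      rw [hn]
      congr 1
      have e : (fun i => r i / √(∑ a, r a ^ 2)) = (√(∑ a, r a ^ 2))⁻¹ • r := by
        ext i; simp [div_eq_inv_mul]
      rw [e, mulVec_smul]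
      ext i; simp [div_eq_inv_mul]
    · rw [gsMat, gsMat, dif_neg ht, dif_neg ht, ih]

/-- The first `t` columns are orthonormal and the others vanish. -/
def GsOrthonormal {N : ℕ} (R : Matrix (Fin N) (Fin N) ℝ) (t : ℕ) : Prop :=
  Rᵀ * R = diagonal fun l => if l.1 < t then 1 else 0

theorem GsOrthonormal.col_eq_zero {N : ℕ} {R : Matrix (Fin N) (Fin N) ℝ} {t : ℕ}
    (h : GsOrthonormal R t) {l : Fin N} (hl : t ≤ l.1) (i : Fin N) : R i l = 0 := by
  have h1 := congrFun (congrFun h l) l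
  rw [diagonal_apply_eq, if_neg (by omega), mul_apply] at h1
  simp only [transpose_apply] at h1
  exact mul_self_eq_zero.1 ((Finset.sum_eq_zero_iff_of_nonneg fun i _ => mul_self_nonneg _).1 h1 i
    (Finset.mem_univ i))

/-- `Rᵀ R` acts as the identity on the first `t` coordinates, where the two terms cancel; in the
others `Rᵀ *ᵥ g` is zero because the columns of `R` are. -/
theorem GsOrthonormal.transpose_mulVec_residual {N : ℕ} {R : Matrix (Fin N) (Fin N) ℝ} {t : ℕ}
    (h : GsOrthonormal R t) (g : Fin N → ℝ) : Rᵀ *ᵥ gsResidual R g = 0 := by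
  rw [gsResidual, mulVec_sub, mulVec_mulVec, h]
  ext l
  rw [Pi.sub_apply, mulVec_diagonal]
  split_ifs with hl
  · simp
  · have : (Rᵀ *ᵥ g) l = 0 := by
      simp only [mulVec, dotProduct, transpose_apply]
      exact Finset.sum_eq_zero fun i _ => by rw [h.col_eq_zero (not_lt.1 hl), zero_mul]
    simp [this]

theorem GsOrthonormal.updateCol {N : ℕ} {R : Matrix (Fin N) (Fin N) ℝ} {t : ℕ} (ht : t < N)
    (h : GsOrthonormal R t) {v : Fin N → ℝ} (hv : Rᵀ *ᵥ v = 0) (h0 : v ≠ 0) :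
    GsOrthonormal (R.updateCol ⟨t, ht⟩ fun i => v i / √(∑ a, v a ^ 2)) (t + 1) := by
  have hpos : 0 < ∑ a, v a ^ 2 := by
    have := dotProduct_self_eq_zero.not.2 h0
    simp only [dotProduct, ← pow_two] at this
    exact lt_of_le_of_ne (Finset.sum_nonneg fun i _ => sq_nonneg _) (Ne.symm this)
  have hv' : ∀ l, ∑ i, R i l * v i = 0 := fun l => by
    have := congrFun hv l; simpa [mulVec, dotProduct] using this
  have hR : ∀ l m, ∑ i, R i l * R i m = if l = m then (if l.1 < t then 1 else 0) else 0 :=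
    fun l m => by
      have := congrFun (congrFun h l) m
      simpa [mul_apply, diagonal_apply] using this
  unfold GsOrthonormal
  ext l m
  simp only [mul_apply, transpose_apply, updateCol_apply, diagonal_apply]
  by_cases hl : l = ⟨t, ht⟩ <;> by_cases hm : m = ⟨t, ht⟩
  · subst hl; subst hm
    simp only [if_true, Nat.lt_succ_self]
    have : ∀ i, v i / √(∑ a, v a ^ 2) * (v i / √(∑ a, v a ^ 2)) =
        v i ^ 2 / ∑ a, v a ^ 2 := fun i => by
      rw [div_mul_div_comm, Real.mul_self_sqrt hpos.le, pow_two]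
    simp only [this]
    rw [← Finset.sum_div, div_self hpos.ne']
  · subst hl
    rw [if_neg (Ne.symm hm)]
    simp only [if_true, hm, if_false]
    rw [← Finset.sum_congr rfl fun i _ => (by rw [div_mul_eq_mul_div, mul_comm] :
      R i m * v i / √(∑ a, v a ^ 2) = v i / √(∑ a, v a ^ 2) * R i m), ← Finset.sum_div, hv',
      zero_div]
  · subst hm
    rw [if_neg hl]
    simp only [if_true, hl, if_false]
    simp only [← mul_div_assoc]
    rw [← Finset.sum_div, hv', zero_div]
  · simp only [hl, hm, if_false]
    rw [hR]
    have : l.1 ≠ t := fun h => hl (Fin.ext h)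
    have e : (l.1 < t + 1) = (l.1 < t) := by
      rw [Nat.lt_succ_iff]; exact propext ⟨fun h => lt_of_le_of_ne h this, le_of_lt⟩
    simp only [e]

theorem measurable_gsMat {N : ℕ} (t : ℕ) (i j : Fin N) :
    Measurable fun G : Fin N → Fin N → ℝ => gsMat G t i j := by
  induction t generalizing i j with
  | zero => simp only [gsMat]; exact measurable_const
  | succ t ih =>
    by_cases ht : t < N
    · have hr : ∀ i, Measurable fun G : Fin N → Fin N → ℝ =>
          gsResidual (gsMat G t) (G ⟨t, ht⟩) i := fun i => by
        simp only [gsResidual, Pi.sub_apply, mulVec, dotProduct, transpose_apply]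
        fun_prop
      simp only [gsMat_succ _ ht, updateCol_apply]
      split_ifs
      · fun_prop
      · exact ih i j
    · simp only [gsMat, dif_neg ht]; exact ih i j

/-- If `R Rᵀ = 1` then `Rᵀ R = 1` as well, but column `t` of `R` is still zero. So a vanishing
residual is a nontrivial linear condition on the new row. -/
theorem GsOrthonormal.one_sub_ne_zero {N : ℕ} {R : Matrix (Fin N) (Fin N) ℝ} {t : ℕ} (ht : t < N)
    (h : GsOrthonormal R t) : 1 - R * Rᵀ ≠ 0 := by
  intro h0
  have h1 : R * Rᵀ = 1 := (sub_eq_zero.1 h0).symm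
  have h2 : Rᵀ * R = 1 := mul_eq_one_comm.1 h1
  have h3 := congrFun (congrFun (h.symm.trans h2) ⟨t, ht⟩) ⟨t, ht⟩
  simp at h3

theorem gsResidual_eq_mulVec {N : ℕ} (R : Matrix (Fin N) (Fin N) ℝ) (g : Fin N → ℝ) :
    gsResidual R g = (1 - R * Rᵀ) *ᵥ g := by
  rw [gsResidual, sub_mulVec, one_mulVec, mulVec_mulVec]

theorem measurableSet_gsOrthonormal {N : ℕ} (t : ℕ) :
    MeasurableSet {G : Fin N → Fin N → ℝ | GsOrthonormal (gsMat G t) t} := by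
  have : {G : Fin N → Fin N → ℝ | GsOrthonormal (gsMat G t) t} = ⋂ i, ⋂ j,
      {G | ∑ a, gsMat G t a i * gsMat G t a j =
        diagonal (fun l : Fin N => if l.1 < t then (1 : ℝ) else 0) i j} := by
    ext G
    simp only [GsOrthonormal, Set.mem_iInter, ← Matrix.ext_iff]
    rfl
  rw [this]
  refine MeasurableSet.iInter fun i => MeasurableSet.iInter fun j => ?_
  have := fun a b => measurable_gsMat (N := N) t a b
  exact measurableSet_eq_fun (by fun_prop) measurable_const

instance isProbabilityMeasure_gaussianMatrix (N : ℕ) : IsProbabilityMeasure (gaussianMatrix N) := by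
  unfold gaussianMatrix; infer_instance

/-- Gram–Schmidt succeeds almost surely on Gaussian vectors. -/
theorem ae_gsOrthonormal {N : ℕ} {t : ℕ} (ht : t ≤ N) :
    ∀ᵐ G ∂gaussianMatrix N, GsOrthonormal (gsMat G t) t := by
  induction t with
  | zero =>
    refine Filter.Eventually.of_forall fun G => ?_
    simp [GsOrthonormal, gsMat]
  | succ t ih =>
    have htN : t < N := ht
    -- Gram–Schmidt can fail at step `t` only if the residual of row `t` vanishes. With the other
    -- rows fixed, this is a nonzero linear system in a Gaussian vector.
    have hnull : gaussianMatrix N {G | GsOrthonormal (gsMat G t) t ∧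
        gsResidual (gsMat G t) (G ⟨t, htN⟩) = 0} = 0 := by
      have hr : ∀ i, Measurable fun G : Fin N → Fin N → ℝ =>
          gsResidual (gsMat G t) (G ⟨t, htN⟩) i := fun i => by
        have := fun a b => measurable_gsMat (N := N) t a b
        simp only [gsResidual, Pi.sub_apply, mulVec, dotProduct, transpose_apply]
        fun_prop
      refine pi_eq_zero_of_update _ ⟨t, htN⟩ ((measurableSet_gsOrthonormal t).inter
        ((measurable_pi_lambda _ hr) (measurableSet_singleton 0))) fun G => ?_
      have e : ∀ x, gsMat (Function.update G ⟨t, htN⟩ x) t = gsMat G t := fun x =>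
        gsMat_congr fun s hs => Function.update_of_ne (fun h => by simp [h] at hs) _ _
      by_cases hG : GsOrthonormal (gsMat G t) t
      · refine measure_mono_null (fun x hx => ?_) (gaussian_linear_null (hG.one_sub_ne_zero htN))
        have hx2 : gsResidual (gsMat (Function.update G ⟨t, htN⟩ x) t)
          (Function.update G ⟨t, htN⟩ x ⟨t, htN⟩) = 0 := hx.2
        rwa [e, Function.update_self, gsResidual_eq_mulVec] at hx2
      · convert measure_empty (μ := Measure.pi fun _ : Fin N => gaussianReal 0 1)
        ext x
        simp only [Set.mem_ofPred_eq, Set.mem_empty_iff_false, iff_false]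
        rintro ⟨hx, -⟩
        have hx' : GsOrthonormal (gsMat (Function.update G ⟨t, htN⟩ x) t) t := hx
        rw [e] at hx'
        exact hG hx'
    filter_upwards [ih htN.le, compl_mem_ae_iff.2 hnull] with G h1 h2
    rw [gsMat_succ _ htN]
    exact h1.updateCol htN (h1.transpose_mulVec_residual _) fun h0 => h2 ⟨h1, h0⟩

open Classical in
/-- The orthogonal matrix produced by Gram–Schmidt. -/
def gsOrth {N : ℕ} (G : Fin N → Fin N → ℝ) : Matrix.orthogonalGroup (Fin N) ℝ :=
  if h : gsMat G N ∈ Matrix.orthogonalGroup (Fin N) ℝ then ⟨gsMat G N, h⟩ else 1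

theorem ae_coe_gsOrth (N : ℕ) :
    ∀ᵐ G ∂gaussianMatrix N, (gsOrth G : Matrix (Fin N) (Fin N) ℝ) = gsMat G N ∧
      gsMat G N ∈ Matrix.orthogonalGroup (Fin N) ℝ := by
  filter_upwards [ae_gsOrthonormal (le_refl N)] with G hG
  have : gsMat G N ∈ Matrix.orthogonalGroup (Fin N) ℝ := by
    rw [mem_orthogonalGroup_iff', ]
    refine Eq.trans hG ?_
    simp
  exact ⟨by rw [gsOrth, dif_pos this], this⟩

/-- The topology is induced from the matrix entries, hence so is the Borel σ-algebra. -/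
theorem measurable_orthogonalGroup_mk {α : Type*} [MeasurableSpace α] {N : ℕ}
    {f : α → Matrix.orthogonalGroup (Fin N) ℝ}
    (hf : ∀ i j, Measurable fun a => (f a : Matrix (Fin N) (Fin N) ℝ) i j) : Measurable f := by
  let c : Matrix.orthogonalGroup (Fin N) ℝ → Fin N → Fin N → ℝ := fun R i j => R.1 i j
  have hc : orthogonalGroup_measurableSpace N = MeasurableSpace.comap c inferInstance := by
    rw [BorelSpace.measurable_eq (α := Fin N → Fin N → ℝ)]
    exact borel_comap (f := c)
  rw [hc]
  exact measurable_comap_iff.2 (measurable_pi_lambda _ fun i => measurable_pi_lambda _ (hf i))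

theorem measurable_orthogonalGroup_apply {N : ℕ} (i j : Fin N) :
    Measurable fun R : Matrix.orthogonalGroup (Fin N) ℝ => R.1 i j := by
  have : Continuous fun R : Matrix.orthogonalGroup (Fin N) ℝ => R.1 i j :=
    (continuous_apply_apply i j).comp (continuous_subtype_val (p := (· ∈ orthogonalGroup _ _)))
  exact this.measurable

theorem measurable_gsOrth {N : ℕ} : Measurable (gsOrth (N := N)) := by
  classical
  refine measurable_orthogonalGroup_mk fun i j => ?_
  have hS : MeasurableSet {G : Fin N → Fin N → ℝ | gsMat G N ∈ Matrix.orthogonalGroup (Fin N) ℝ} := by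
    have : {G : Fin N → Fin N → ℝ | gsMat G N ∈ Matrix.orthogonalGroup (Fin N) ℝ} =
        {G | GsOrthonormal (gsMat G N) N} := by
      ext G
      simp only [Set.mem_ofPred_eq, mem_orthogonalGroup_iff', GsOrthonormal, Fin.is_lt, if_true]
      rw [diagonal_one]
    rw [this]; exact measurableSet_gsOrthonormal N
  have : (fun G : Fin N → Fin N → ℝ => (gsOrth G : Matrix (Fin N) (Fin N) ℝ) i j) = fun G =>
      if G ∈ {G : Fin N → Fin N → ℝ | gsMat G N ∈ Matrix.orthogonalGroup (Fin N) ℝ} then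
        gsMat G N i j else (1 : Matrix (Fin N) (Fin N) ℝ) i j := by
    funext G
    by_cases h : gsMat G N ∈ Matrix.orthogonalGroup (Fin N) ℝ
    · have h1 : gsOrth G = ⟨gsMat G N, h⟩ := dif_pos h
      rw [h1]; exact (if_pos h).symm
    · have h1 : gsOrth G = 1 := dif_neg h
      rw [h1]; exact (if_neg h).symm
  rw [this]
  exact Measurable.ite hS (measurable_gsMat N i j) measurable_const

instance isProbabilityMeasure_haarOrthogonal (N : ℕ) : IsProbabilityMeasure (haarOrthogonal N) :=
  ⟨Measure.haarMeasure_self⟩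

/-- Gram–Schmidt turns a Gaussian matrix into a Haar orthogonal matrix. -/
theorem gaussianMatrix_map_gsOrth (N : ℕ) : (gaussianMatrix N).map gsOrth = haarOrthogonal N := by
  have hsc : SecondCountableTopology (Matrix (Fin N) (Fin N) ℝ) :=
    inferInstanceAs (SecondCountableTopology (Fin N → Fin N → ℝ))
  have : IsProbabilityMeasure ((gaussianMatrix N).map gsOrth) :=
    Measure.isProbabilityMeasure_map measurable_gsOrth.aemeasurable
  -- `U * gsOrth G` and `gsOrth` of the rows `U *ᵥ G t` agree off the null set where `gsOrth` takes
  -- its default value, and the rotated rows are again Gaussian. Uniqueness of the invariant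
  -- probability measure then concludes.
  have hinv : ((gaussianMatrix N).map gsOrth).IsMulLeftInvariant := by
    refine ⟨fun U => ?_⟩
    have hU : U.1ᵀ * U.1 = 1 := (mem_orthogonalGroup_iff' _ _).1 U.2
    have hm : Measurable fun G : Fin N → Fin N → ℝ => fun t => U.1 *ᵥ G t :=
      measurable_pi_lambda _ fun t => measurable_pi_lambda _ fun i => by
        simp only [mulVec, dotProduct]; fun_prop
    rw [Measure.map_map (measurable_const_mul U) measurable_gsOrth]
    conv_rhs => rw [← gaussianMatrix_map_mulVec hU, Measure.map_map measurable_gsOrth hm]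
    refine Measure.map_congr ?_
    filter_upwards [ae_coe_gsOrth N] with G hG
    have h2 : gsMat (fun t => U.1 *ᵥ G t) N ∈ Matrix.orthogonalGroup (Fin N) ℝ := by
      rw [gsMat_mulVec hU]; exact mul_mem U.2 hG.2
    refine Subtype.ext ?_
    change U.1 * (gsOrth G).1 = (gsOrth fun t => U.1 *ᵥ G t).1
    have h3 : gsOrth (fun t => U.1 *ᵥ G t) = ⟨_, h2⟩ := dif_pos h2
    rw [hG.1, h3]
    exact (gsMat_mulVec hU G N).symm
  have : SecondCountableTopology (Matrix.orthogonalGroup (Fin N) ℝ) :=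
    TopologicalSpace.Subtype.secondCountableTopology
      (s := (Matrix.orthogonalGroup (Fin N) ℝ : Set (Matrix (Fin N) (Fin N) ℝ)))
  rw [haarOrthogonal]
  exact ((Measure.haarMeasure_eq_iff ⊤ _).2 measure_univ).symm
end

noncomputable section

open Matrix

/-! ### Products, the `χ²` tail and the spiked covariance law -/

theorem pi_prod_pi_map {γ α β σ : Type*} [Fintype γ] [MeasurableSpace α] [MeasurableSpace β]
    [MeasurableSpace σ] (μ : γ → Measure α) (ν : γ → Measure β) [∀ i, IsProbabilityMeasure (μ i)]
    [∀ i, IsProbabilityMeasure (ν i)] {F : γ → α → β → σ}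
    (hF : ∀ i, Measurable fun a : α × β => F i a.1 a.2) :
    ((Measure.pi μ).prod (Measure.pi ν)).map (fun a i => F i (a.1 i) (a.2 i)) =
      Measure.pi fun i => ((μ i).prod (ν i)).map fun a => F i a.1 a.2 := by
  have : ∀ i, IsProbabilityMeasure (((μ i).prod (ν i)).map fun a => F i a.1 a.2) := fun i =>
    Measure.isProbabilityMeasure_map (hF i).aemeasurable
  rw [← (measurePreserving_arrowProdEquivProdArrow α β γ μ ν).map_eq, Measure.map_map ?_
    (MeasurableEquiv.measurable _), ← Measure.pi_map_pi (f := fun i (a : α × β) => F i a.1 a.2)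
    fun i => (hF i).aemeasurable]
  · rfl
  · exact measurable_pi_lambda _ fun i => (hF i).comp (f := fun a : (γ → α) × (γ → β) =>
      (a.1 i, a.2 i)) (by fun_prop)

/-- `exp (3x²/8)` times the `N(0, 1)` density is twice the `N(0, 4)` density. The value `3/8` is the
optimal Chernoff parameter for the event that `χ²(m)` exceeds `4 m`. -/
theorem lintegral_exp_sq_gaussian :
    ∫⁻ x, ENNReal.ofReal (Real.exp (3 / 8 * x ^ 2)) ∂gaussianReal 0 1 = 2 := by
  rw [lintegral_gaussianReal_eq (by fun_prop)]
  have h4 : (4 : NNReal) ≠ 0 := by norm_num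
  calc _ = ∫⁻ x, 2 * ENNReal.ofReal (gaussianPDFReal 0 4 x) := by
        refine lintegral_congr fun x => ?_
        rw [← ENNReal.ofReal_mul (Real.exp_nonneg _),
          show (2 : ENNReal) = ENNReal.ofReal 2 by simp, ← ENNReal.ofReal_mul (by norm_num)]
        congr 1
        simp only [gaussianPDFReal, NNReal.coe_one, NNReal.coe_ofNat, mul_one]
        have hs : √(2 * Real.pi * 4) = 2 * √(2 * Real.pi) := by
          rw [show 2 * Real.pi * 4 = 2 ^ 2 * (2 * Real.pi) by ring,
            Real.sqrt_mul (by norm_num : (0 : ℝ) ≤ 2 ^ 2), Real.sqrt_sq (by norm_num)]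
        rw [hs, mul_left_comm,
          ← Real.exp_add, mul_inv, ← mul_assoc, ← mul_assoc, mul_inv_cancel₀ two_ne_zero, one_mul]
        congr 2
        ring
    _ = _ := by
        rw [lintegral_const_mul _ (by fun_prop), lintegral_gaussianPDFReal_eq_one _ h4, mul_one]

theorem lintegral_pi_prod {ι : Type*} [Fintype ι] {α : Type*} [MeasurableSpace α]
    (μ : ι → Measure α) [∀ i, IsProbabilityMeasure (μ i)] {f : α → ENNReal}
    (hf : Measurable f) :
    ∫⁻ x, ∏ i, f (x i) ∂Measure.pi μ = ∏ i, ∫⁻ y, f y ∂μ i := by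
  have := lintegral_prod_eq_prod_lintegral_of_indepFun (μ := Measure.pi μ) Finset.univ
    (fun i (x : ι → α) => f (x i)) (iIndepFun_pi (fun i => hf.aemeasurable)) (fun i => by fun_prop)
  rw [this]
  refine Finset.prod_congr rfl fun i _ => ?_
  rw [← (measurePreserving_eval μ i).map_eq, lintegral_map hf (measurable_pi_apply i)]

theorem measurable_sqrt_sum_sq (m : ℕ) : Measurable fun g : Fin m → ℝ => √(∑ i, g i ^ 2) := by
  fun_prop

instance isProbabilityMeasure_sqrtChiSq (m : ℕ) : IsProbabilityMeasure (sqrtChiSq m) :=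
  Measure.isProbabilityMeasure_map (measurable_sqrt_sum_sq m).aemeasurable

/-- Chernoff bound for the upper tail of `χ²(m)` at `4 m`. -/
theorem sqrtChiSq_tail (m : ℕ) : sqrtChiSq m {r | 2 * √(m : ℝ) < r} ≤
    ENNReal.ofReal ((4 * Real.exp (-3)) ^ ((m : ℝ) / 2)) := by
  refine (Measure.map_apply (measurable_sqrt_sum_sq m) measurableSet_Ioi).trans_le ?_
  -- Beyond `2 √m` the sum of squares exceeds `4 m`, and `(3/8) · 4 m = (3/2) m`. Markov's
  -- inequality then yields `2 ^ m exp (-3m/2) = (4 exp (-3)) ^ (m/2)`.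
  have hsub : (fun g : Fin m → ℝ => √(∑ i, g i ^ 2)) ⁻¹' Set.Ioi (2 * √(m : ℝ)) ⊆
      {g | ENNReal.ofReal (Real.exp (3 / 2 * m)) ≤
        ∏ i, ENNReal.ofReal (Real.exp (3 / 8 * g i ^ 2))} := by
    intro g hg
    have hg' : 2 * √(m : ℝ) < √(∑ i, g i ^ 2) := hg
    have h2 : (2 * √(m : ℝ)) ^ 2 < √(∑ i, g i ^ 2) ^ 2 := by gcongr
    rw [Real.sq_sqrt (Finset.sum_nonneg fun i _ => sq_nonneg _), mul_pow,
      Real.sq_sqrt (Nat.cast_nonneg m)] at h2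
    simp only [Set.mem_ofPred_eq]
    rw [← ENNReal.ofReal_prod_of_nonneg fun i _ => Real.exp_nonneg _, ← Real.exp_sum,
      ← Finset.mul_sum]
    exact ENNReal.ofReal_le_ofReal (Real.exp_le_exp.2 (by linarith))
  refine (measure_mono hsub).trans ?_
  have hme : Measurable fun x : ℝ => ENNReal.ofReal (Real.exp (3 / 8 * x ^ 2)) := by fun_prop
  have hmp : Measurable fun g : Fin m → ℝ => ∏ i, ENNReal.ofReal (Real.exp (3 / 8 * g i ^ 2)) :=
    Finset.measurable_fun_prod _ fun i _ => hme.comp (measurable_pi_apply i)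
  refine (meas_ge_le_lintegral_div hmp.aemeasurable (by simp [Real.exp_pos]) (by simp)).trans ?_
  rw [lintegral_pi_prod (fun _ : Fin m => gaussianReal 0 1)
    hme,
    Finset.prod_congr rfl fun i _ => lintegral_exp_sq_gaussian]
  simp only [Finset.prod_const, Finset.card_univ, Fintype.card_fin]
  rw [show (2 : ENNReal) = ENNReal.ofReal 2 by simp, ← ENNReal.ofReal_pow (by norm_num),
    ← ENNReal.ofReal_div_of_pos (Real.exp_pos _)]
  refine ENNReal.ofReal_le_ofReal (le_of_eq ?_)
  rw [Real.mul_rpow (by norm_num) (Real.exp_nonneg _), ← Real.exp_mul, div_eq_mul_inv,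
    ← Real.exp_neg, show (4 : ℝ) = 2 ^ (2 : ℝ) by norm_num, ← Real.rpow_mul (by norm_num),
    ← Real.rpow_natCast]
  congr 2 <;> ring

theorem gaussianMatrix_map_mul {N : ℕ} (U : Matrix.orthogonalGroup (Fin N) ℝ) :
    (gaussianMatrix N).map (fun G i j => ∑ l, G i l * U.1 l j) = gaussianMatrix N := by
  have hU : (U.1ᵀ)ᵀ * U.1ᵀ = 1 := by
    rw [transpose_transpose]; exact (mem_orthogonalGroup_iff _ _).1 U.2
  conv_rhs => rw [← gaussianMatrix_map_mulVec hU]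
  congr 1
  ext G i j
  simp [mulVec, dotProduct, mul_comm]

theorem spiked_posSemidef {N : ℕ} {θ : ℝ} (hθ : 0 ≤ θ) (v : Fin N → ℝ) :
    ((1 : Matrix (Fin N) (Fin N) ℝ) + θ • vecMulVec v v).PosSemidef := by
  refine PosSemidef.one.add (PosSemidef.smul ?_ hθ)
  simpa using posSemidef_vecMulVec_self_star v

/-- A standard Gaussian vector plus an independent Gaussian multiple of a fixed vector. -/
theorem map_add_smul_eq_multivariateGaussian {N : ℕ} {θ : ℝ} (hθ : 0 ≤ θ) (v w : Fin N → ℝ)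
    (hw : vecMulVec w w = θ • vecMulVec v v) :
    ((Measure.pi fun _ : Fin N => gaussianReal 0 1).prod (gaussianReal 0 1)).map
      (fun a => WithLp.toLp 2 fun i => a.1 i + w i * a.2) =
    multivariateGaussian (0 : EuclideanSpace ℝ (Fin N))
      ((1 : Matrix (Fin N) (Fin N) ℝ) + θ • vecMulVec v v) := by
  have hm1 : Measurable fun a : Fin N → ℝ => WithLp.toLp 2 a := by fun_prop
  have hm2 : Measurable fun x : ℝ => WithLp.toLp 2 (fun i : Fin N => w i * x) := by fun_prop
  have hsum : (fun a : (Fin N → ℝ) × ℝ => WithLp.toLp 2 fun i => a.1 i + w i * a.2) =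
      (fun b : EuclideanSpace ℝ (Fin N) × EuclideanSpace ℝ (Fin N) => b.1 + b.2) ∘
        Prod.map (WithLp.toLp 2) (fun x : ℝ => WithLp.toLp 2 (fun i : Fin N => w i * x)) := by
    funext a; ext i; simp
  have : IsProbabilityMeasure (((Measure.pi fun _ : Fin N => gaussianReal 0 1).prod
      (gaussianReal 0 1)).map (fun a => WithLp.toLp 2 fun i => a.1 i + w i * a.2)) :=
    Measure.isProbabilityMeasure_map (by fun_prop)
  -- Both characteristic functions at `t` equal `exp (-(‖t‖² + (w ⬝ᵥ t)²) / 2)`.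
  refine Measure.ext_of_charFun ?_
  funext t
  rw [charFun_multivariateGaussian (spiked_posSemidef hθ v), hsum,
    ← Measure.map_map (by fun_prop) (by fun_prop), ← Measure.map_prod_map _ _ hm1 hm2,
    map_pi_eq_stdGaussian]
  have hp : IsProbabilityMeasure ((gaussianReal 0 1).map
      fun x : ℝ => WithLp.toLp 2 (fun i : Fin N => w i * x)) :=
    Measure.isProbabilityMeasure_map hm2.aemeasurable
  rw [charFun_map_add_prod_eq_mul, Pi.mul_apply, charFun_stdGaussian]
  have h2 : charFun ((gaussianReal 0 1).map
      fun x : ℝ => WithLp.toLp 2 (fun i : Fin N => w i * x)) t =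
      charFun (gaussianReal 0 1) (w ⬝ᵥ t.ofLp) := by
    rw [charFun_apply, charFun_apply_real, integral_map hm2.aemeasurable (by fun_prop)]
    refine integral_congr_ae (Filter.Eventually.of_forall fun x => ?_)
    simp only
    congr 2
    rw [PiLp.inner_apply, ← Complex.ofReal_mul]
    congr 1
    simp only [dotProduct, Finset.sum_mul]
    refine Finset.sum_congr rfl fun i _ => ?_
    simp
    ring
  rw [h2, charFun_gaussianReal, ← Complex.exp_add]
  congr 1
  have h3 : t.ofLp ⬝ᵥ (1 + θ • vecMulVec v v) *ᵥ t.ofLp = ‖t‖ ^ 2 + (w ⬝ᵥ t.ofLp) ^ 2 := by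
    rw [← hw, add_mulVec, one_mulVec, vecMulVec_mulVec, dotProduct_add,
      EuclideanSpace.real_norm_sq_eq]
    congr 1
    · simp [dotProduct, pow_two]
    · rw [dotProduct_smul, dotProduct_comm t.ofLp w, pow_two]; simp
  rw [h3]
  simp
  ring

/-- The spiked covariance law as a Gaussian matrix plus an independent rank-one term. -/
theorem map_add_mul_eq_spikedMatrix {N : ℕ} {θ : ℝ} (hθ : 0 ≤ θ) (v w : Fin N → ℝ)
    (hw : vecMulVec w w = θ • vecMulVec v v) :
    ((gaussianMatrix N).prod (Measure.pi fun _ : Fin N => gaussianReal 0 1)).map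
      (fun a (i j : Fin N) => a.1 j i + w i * a.2 j) = spikedMatrix N θ v := by
  rw [spikedMatrix, ← map_add_smul_eq_multivariateGaussian hθ v w hw, gaussianMatrix]
  have hF : Measurable fun a : (Fin N → ℝ) × ℝ => WithLp.toLp 2 fun i => a.1 i + w i * a.2 := by
    fun_prop
  rw [← pi_prod_pi_map (fun _ : Fin N => Measure.pi fun _ : Fin N => gaussianReal 0 1)
    (fun _ : Fin N => gaussianReal 0 1)
    (F := fun _ a b => WithLp.toLp 2 fun i => a i + w i * b) fun _ => hF, Measure.map_map]
  · rfl
  · fun_prop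
  · exact measurable_pi_lambda _ fun j => hF.comp (f := fun a : (Fin N → Fin N → ℝ) × (Fin N → ℝ) =>
      (a.1 j, a.2 j)) (by fun_prop)


/-- Selecting distinct coordinates of an i.i.d. family and arranging them in a matrix. -/
theorem infinitePi_map_matrix {Λ ι κ X : Type*} [Fintype ι] [Fintype κ] [MeasurableSpace X]
    (μ : Measure X) [IsProbabilityMeasure μ] {φ : ι × κ → Λ} (hφ : Function.Injective φ) :
    (Measure.infinitePi fun _ : Λ => μ).map (fun ω i j => ω (φ (i, j))) =
      Measure.pi fun _ : ι => Measure.pi fun _ : κ => μ := by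
  have h1 := Measure.map_infinitePi_infinitePi_of_inj (P := fun _ : Λ => μ) hφ
  have h2 := Measure.infinitePi_map_curry (fun (_ : ι) (_ : κ) => μ)
  rw [← h1, Measure.map_map (MeasurableEquiv.measurable _) (by fun_prop)] at h2
  simp only [← Measure.infinitePi_eq_pi]
  exact h2

theorem gaussianMatrix_map_transpose (N : ℕ) :
    (gaussianMatrix N).map (fun G i j => G j i) = gaussianMatrix N := by
  have h1 := infinitePi_map_matrix (gaussianReal 0 1) (φ := (id : Fin N × Fin N → _))
    Function.injective_id
  have h2 := infinitePi_map_matrix (gaussianReal 0 1) (φ := (Prod.swap : Fin N × Fin N → _))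
    Prod.swap_injective
  unfold gaussianMatrix
  conv_rhs => rw [← h2]
  rw [← h1, Measure.map_map (by fun_prop) (by fun_prop)]
  rfl

theorem infinitePi_map_vector {Λ ι X : Type*} [Fintype ι] [MeasurableSpace X]
    (μ : Measure X) [IsProbabilityMeasure μ] {φ : ι → Λ} (hφ : Function.Injective φ) :
    (Measure.infinitePi fun _ : Λ => μ).map (fun ω i => ω (φ i)) = Measure.pi fun _ : ι => μ := by
  rw [Measure.map_infinitePi_infinitePi_of_inj (P := fun _ : Λ => μ) hφ, Measure.infinitePi_eq_pi]

/-- Rearranging some entries of an i.i.d. matrix into a vector. -/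
theorem pi_pi_map_vector {N M m : ℕ} {e : Fin N → Fin M × Fin m} (he : Function.Injective e) :
    (Measure.pi fun _ : Fin M => Measure.pi fun _ : Fin m => gaussianReal 0 1).map
      (fun g n => g (e n).1 (e n).2) = Measure.pi fun _ : Fin N => gaussianReal 0 1 := by
  have h1 := infinitePi_map_matrix (gaussianReal 0 1) (φ := (id : Fin M × Fin m → _))
    Function.injective_id
  rw [← infinitePi_map_vector (gaussianReal 0 1) he, ← h1,
    Measure.map_map (by fun_prop) (by fun_prop)]
  rfl

end

noncomputable section

open Matrix

/-! ### The random rotation -/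

/-- The product `X R`, entrywise. -/
def mulOut {N : ℕ} (X : Fin N → Fin N → ℝ) (R : Matrix.orthogonalGroup (Fin N) ℝ) :
    Fin N → Fin N → ℝ := fun i j => ∑ l, X i l * R.1 l j

theorem measurable_mulOut {N : ℕ} :
    Measurable fun a : (Fin N → Fin N → ℝ) × Matrix.orthogonalGroup (Fin N) ℝ =>
      mulOut a.1 a.2 := by
  refine measurable_pi_lambda _ fun i => measurable_pi_lambda _ fun j => ?_
  unfold mulOut
  refine Finset.measurable_fun_sum _ fun l _ => Measurable.mul (by fun_prop)
    ((measurable_orthogonalGroup_apply l j).comp measurable_snd)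

/-- Average of `f (X R)` over a Haar orthogonal matrix `R`. -/
def haarAvg {N : ℕ} (f : (Fin N → Fin N → ℝ) → ENNReal) (X : Fin N → Fin N → ℝ) : ENNReal :=
  ∫⁻ R, f (mulOut X R) ∂haarOrthogonal N

theorem measurable_haarAvg {N : ℕ} {f : (Fin N → Fin N → ℝ) → ENNReal} (hf : Measurable f) :
    Measurable (haarAvg f) :=
  (hf.comp measurable_mulOut).lintegral_prod_right'

theorem haarAvg_le_one {N : ℕ} {f : (Fin N → Fin N → ℝ) → ENNReal} (h1 : ∀ x, f x ≤ 1)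
    (X : Fin N → Fin N → ℝ) : haarAvg f X ≤ 1 :=
  (lintegral_mono fun R => h1 _).trans (by simp)

/-- Euclidean norms of the rows. -/
def rowNorms {N m : ℕ} (g : Fin N → Fin m → ℝ) : Fin N → ℝ := fun j => √(∑ i, g j i ^ 2)

/-- The truncated target means of the algorithm. -/
def truncMean (N k : ℕ) (τ : ℝ) (r : Fin N → ℝ) (j : Fin N) : ℝ :=
  1 / 2 * τ * min (r j) (2 * √((N : ℝ) / k)) * √((k : ℝ) / N)

/-- An `N × m` Gaussian matrix. -/
def gaussianRect (N m : ℕ) : Measure (Fin N → Fin m → ℝ) :=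
  Measure.pi fun _ => Measure.pi fun _ => gaussianReal 0 1

instance isProbabilityMeasure_gaussianRect (N m : ℕ) :
    IsProbabilityMeasure (gaussianRect N m) := by
  unfold gaussianRect; infer_instance

instance isProbabilityMeasure_gaussianizeNoise (N : ℕ) (P Q : ℝ) :
    IsProbabilityMeasure (gaussianizeNoise N P Q) := by
  unfold gaussianizeNoise; infer_instance

theorem measurable_rowNorms {N m : ℕ} : Measurable (rowNorms (N := N) (m := m)) :=
  measurable_pi_lambda _ fun j => (measurable_sqrt_sum_sq m).comp (measurable_pi_apply j)

theorem gaussianRect_map_rowNorms (N m : ℕ) :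
    (gaussianRect N m).map rowNorms = Measure.pi fun _ : Fin N => sqrtChiSq m := by
  have : ∀ _ : Fin N, SigmaFinite ((Measure.pi fun _ : Fin m => gaussianReal 0 1).map
      fun g => √(∑ i, g i ^ 2)) := fun _ => by
    have : IsProbabilityMeasure ((Measure.pi fun _ : Fin m => gaussianReal 0 1).map
      fun g => √(∑ i, g i ^ 2)) := isProbabilityMeasure_sqrtChiSq m
    infer_instance
  exact Measure.pi_map_pi (f := fun _ (g : Fin m → ℝ) => √(∑ i, g i ^ 2))
    fun _ => (measurable_sqrt_sum_sq m).aemeasurable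

/-- The matrix of rejection kernel outputs. -/
def rkMatrix (N k : ℕ) (P Q τ : ℝ) (r : Fin N → ℝ) (M : Fin N → Fin N → Bool)
    (ω : Fin N → Fin N → Fin (rkIter N P Q) → ℝ × ℝ) : Fin N → Fin N → ℝ :=
  fun i j => rkRun P Q (truncMean N k τ r j) (M i j) (rkIter N P Q) (ω i j)

theorem measurable_truncMean {N k : ℕ} {τ : ℝ} (j : Fin N) :
    Measurable fun r : Fin N → ℝ => truncMean N k τ r j := by
  unfold truncMean
  have : Measurable fun r : Fin N → ℝ => min (r j) (2 * √((N : ℝ) / k)) :=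
    (measurable_pi_apply j).min measurable_const
  fun_prop

theorem measurable_rkMatrix (N k : ℕ) (P Q τ : ℝ) :
    Measurable fun a : (Fin N → ℝ) × (Fin N → Fin N → Bool) ×
      (Fin N → Fin N → Fin (rkIter N P Q) → ℝ × ℝ) => rkMatrix N k P Q τ a.1 a.2.1 a.2.2 := by
  refine measurable_pi_lambda _ fun i => measurable_pi_lambda _ fun j => ?_
  exact (measurable_rkRun P Q (rkIter N P Q)).comp (f := fun a : (Fin N → ℝ) ×
    (Fin N → Fin N → Bool) × (Fin N → Fin N → Fin (rkIter N P Q) → ℝ × ℝ) =>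
      (truncMean N k τ a.1 j, a.2.1 i j, a.2.2 i j))
    (((measurable_truncMean j).comp measurable_fst).prodMk (by fun_prop))

/-- The radii are realized as norms of Gaussian rows; keeping the rows allows their entries to be
reassembled into one long Gaussian vector. -/
theorem chiSqRandomRotation_eq_map (N k : ℕ) (P Q τ : ℝ) (M : Fin N → Fin N → Bool) :
    chiSqRandomRotation N k P Q τ M =
      ((gaussianRect N (N / k)).prod ((gaussianizeNoise N P Q).prod (haarOrthogonal N))).map
        fun a => mulOut (rkMatrix N k P Q τ (rowNorms a.1) M a.2.1) a.2.2 := by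
  have hm : Measurable fun a : (Fin N → ℝ) × (Fin N → Fin N → Fin (rkIter N P Q) → ℝ × ℝ) ×
      Matrix.orthogonalGroup (Fin N) ℝ => mulOut (rkMatrix N k P Q τ a.1 M a.2.1) a.2.2 :=
    measurable_mulOut.comp (((measurable_rkMatrix N k P Q τ).comp (f := fun a : (Fin N → ℝ) ×
      (Fin N → Fin N → Fin (rkIter N P Q) → ℝ × ℝ) × Matrix.orthogonalGroup (Fin N) ℝ =>
        (a.1, M, a.2.1)) (by fun_prop)).prodMk (by fun_prop))
  have hdef : chiSqRandomRotation N k P Q τ M =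
      ((Measure.pi fun _ : Fin N => sqrtChiSq (N / k)).prod
        ((gaussianizeNoise N P Q).prod (haarOrthogonal N))).map
        fun a => mulOut (rkMatrix N k P Q τ a.1 M a.2.1) a.2.2 := rfl
  have hprod : (Measure.pi fun _ : Fin N => sqrtChiSq (N / k)).prod
      ((gaussianizeNoise N P Q).prod (haarOrthogonal N)) =
      ((gaussianRect N (N / k)).prod ((gaussianizeNoise N P Q).prod (haarOrthogonal N))).map
        (Prod.map rowNorms id) := by
    rw [← Measure.map_prod_map _ _ measurable_rowNorms measurable_id, Measure.map_id,
      gaussianRect_map_rowNorms]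
  rw [hdef, hprod, Measure.map_map hm (measurable_rowNorms.prodMap measurable_id)]
  rfl

theorem measurable_chiIntegrand {N k : ℕ} {P Q τ : ℝ} {Φ : (Fin N → Fin N → ℝ) → ENNReal}
    (hΦ : Measurable Φ) :
    Measurable fun a : ((Fin N → Fin N → Bool) × (Fin N → Fin (N / k) → ℝ)) ×
      (Fin N → Fin N → Fin (rkIter N P Q) → ℝ × ℝ) =>
      Φ (rkMatrix N k P Q τ (rowNorms a.1.2) a.1.1 a.2) :=
  hΦ.comp ((measurable_rkMatrix N k P Q τ).comp (f := fun a : ((Fin N → Fin N → Bool) ×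
      (Fin N → Fin (N / k) → ℝ)) × (Fin N → Fin N → Fin (rkIter N P Q) → ℝ × ℝ) =>
        (rowNorms a.1.2, a.1.1, a.2)) ((measurable_rowNorms.comp (by fun_prop)).prodMk
          (by fun_prop)))

theorem lintegral_chiSqRandomRotation (N k : ℕ) (P Q τ : ℝ) (M : Fin N → Fin N → Bool)
    {f : (Fin N → Fin N → ℝ) → ENNReal} (hf : Measurable f) :
    ∫⁻ Y, f Y ∂chiSqRandomRotation N k P Q τ M =
      ∫⁻ g, ∫⁻ ω, haarAvg f (rkMatrix N k P Q τ (rowNorms g) M ω) ∂gaussianizeNoise N P Q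
        ∂gaussianRect N (N / k) := by
  have hX : Measurable fun a : (Fin N → Fin (N / k) → ℝ) ×
      (Fin N → Fin N → Fin (rkIter N P Q) → ℝ × ℝ) × Matrix.orthogonalGroup (Fin N) ℝ =>
      mulOut (rkMatrix N k P Q τ (rowNorms a.1) M a.2.1) a.2.2 :=
    measurable_mulOut.comp (((measurable_rkMatrix N k P Q τ).comp (f := fun a :
      (Fin N → Fin (N / k) → ℝ) × (Fin N → Fin N → Fin (rkIter N P Q) → ℝ × ℝ) ×
      Matrix.orthogonalGroup (Fin N) ℝ => (rowNorms a.1, M, a.2.1))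
        ((measurable_rowNorms.comp (by fun_prop)).prodMk (by fun_prop))).prodMk (by fun_prop))
  rw [chiSqRandomRotation_eq_map, lintegral_map hf hX,
    lintegral_prod (fun a => f (mulOut _ _)) (hf.comp hX).aemeasurable]
  refine lintegral_congr fun g => ?_
  exact lintegral_prod (fun a => f (mulOut (rkMatrix N k P Q τ (rowNorms g) M a.1) a.2))
    ((hf.comp hX).comp measurable_prodMk_left).aemeasurable

/-- Once `r` is fixed, each entry uses only its own bit and its own noise, so the entries are
independent. -/
theorem pi_pi_rkLaw (N k : ℕ) (P Q τ : ℝ) (r : Fin N → ℝ) (w : Fin N → Fin N → ℝ) :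
    ((Measure.pi fun i => Measure.pi fun j => bern (w i j)).prod (gaussianizeNoise N P Q)).map
      (fun a => rkMatrix N k P Q τ r a.1 a.2) =
    Measure.pi fun i => Measure.pi fun j =>
      rkLaw P Q (truncMean N k τ r j) (w i j) (rkIter N P Q) := by
  have h1 : ∀ j, Measurable fun a : Bool × (Fin (rkIter N P Q) → ℝ × ℝ) =>
      rkRun P Q (truncMean N k τ r j) a.1 (rkIter N P Q) a.2 := fun j =>
    (measurable_rkRun P Q (rkIter N P Q)).comp (f := fun a : Bool × (Fin (rkIter N P Q) → ℝ × ℝ) =>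
      (truncMean N k τ r j, a.1, a.2)) (by fun_prop)
  have h2 : Measurable fun a : (Fin N → Bool) × (Fin N → Fin (rkIter N P Q) → ℝ × ℝ) =>
      fun j => rkRun P Q (truncMean N k τ r j) (a.1 j) (rkIter N P Q) (a.2 j) :=
    measurable_pi_lambda _ fun j => (h1 j).comp (f := fun a : (Fin N → Bool) ×
      (Fin N → Fin (rkIter N P Q) → ℝ × ℝ) => (a.1 j, a.2 j)) (by fun_prop)
  have e := pi_prod_pi_map (fun i => Measure.pi fun j => bern (w i j))
    (fun _ : Fin N => Measure.pi fun _ : Fin N => rkNoise (rkIter N P Q))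
    (F := fun _ b ω j => rkRun P Q (truncMean N k τ r j) (b j) (rkIter N P Q) (ω j)) fun _ => h2
  refine Eq.trans e ?_
  congr 1
  funext i
  exact pi_prod_pi_map (fun j => bern (w i j)) (fun _ : Fin N => rkNoise (rkIter N P Q))
    (F := fun j b ω => rkRun P Q (truncMean N k τ r j) b (rkIter N P Q) ω) h1

theorem gaussianMatrix_map_add {N : ℕ} (m : Fin N → Fin N → ℝ) :
    (gaussianMatrix N).map (fun G i j => G i j + m i j) =
      Measure.pi fun i => Measure.pi fun j => gaussianReal (m i j) 1 := by
  have h1 : ∀ i, (Measure.pi fun _ : Fin N => gaussianReal 0 1).map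
      (fun g j => g j + m i j) = Measure.pi fun j => gaussianReal (m i j) 1 := fun i => by
    have := Measure.pi_map_pi (μ := fun _ : Fin N => gaussianReal 0 1)
      (f := fun j x => x + m i j) fun j => (measurable_add_const _).aemeasurable
    rw [this]
    simp [gaussianReal_map_add_const]
  have : ∀ i, SigmaFinite ((Measure.pi fun _ : Fin N => gaussianReal 0 1).map
      (fun g j => g j + m i j)) := fun i => by rw [h1]; infer_instance
  have h2 := Measure.pi_map_pi (μ := fun _ : Fin N => Measure.pi fun _ : Fin N => gaussianReal 0 1)
    (f := fun i g j => g j + m i j) fun i => Measurable.aemeasurable (by fun_prop)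
  simp only [h1] at h2
  exact h2

/-- Replacing the rejection kernels by Gaussians in the output of the algorithm. -/
theorem lintegral_bind_chiSqRandomRotation_le {N k : ℕ} {P Q τ : ℝ} {w : Fin N → Fin N → ℝ}
    {m : (Fin N → Fin (N / k) → ℝ) → Fin N → Fin N → ℝ} {ε : ENNReal}
    (hTV : ∀ g i j, TVLe (rkLaw P Q (truncMean N k τ (rowNorms g) j) (w i j) (rkIter N P Q))
      (gaussianReal (m g i j) 1) ε)
    {f : (Fin N → Fin N → ℝ) → ENNReal} (hf : Measurable f) (h1 : ∀ x, f x ≤ 1) :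
    ∫⁻ Y, f Y ∂(Measure.pi fun i => Measure.pi fun j => bern (w i j)).bind
        (chiSqRandomRotation N k P Q τ) ≤
      (∫⁻ g, ∫⁻ G, haarAvg f (fun i j => G i j + m g i j) ∂gaussianMatrix N
        ∂gaussianRect N (N / k)) + N * (N * ε) := by
  have hΦ := measurable_haarAvg hf
  rw [Measure.lintegral_bind (Measurable.of_discrete).aemeasurable hf.aemeasurable]
  simp only [lintegral_chiSqRandomRotation N k P Q τ _ hf]
  have hmeas := measurable_chiIntegrand (k := k) (P := P) (Q := Q) (τ := τ) hΦ
  -- The Gaussian rows behind the radii become the outermost variable. Conditionally on them the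
  -- entries are independent, and the hybrid bound is applied over `N` rows of `N` entries, with the
  -- Haar average as test function.
  rw [lintegral_lintegral_swap hmeas.lintegral_prod_right'.aemeasurable]
  calc _ ≤ ∫⁻ g, ((∫⁻ G, haarAvg f (fun i j => G i j + m g i j) ∂gaussianMatrix N) +
        N * (N * ε)) ∂gaussianRect N (N / k) := by
        refine lintegral_mono fun g => ?_
        have hg : Measurable fun a : (Fin N → Fin N → Bool) ×
            (Fin N → Fin N → Fin (rkIter N P Q) → ℝ × ℝ) =>
            rkMatrix N k P Q τ (rowNorms g) a.1 a.2 :=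
          (measurable_rkMatrix N k P Q τ).comp (f := fun a : (Fin N → Fin N → Bool) ×
            (Fin N → Fin N → Fin (rkIter N P Q) → ℝ × ℝ) => (rowNorms g, a.1, a.2)) (by fun_prop)
        have e1 := lintegral_map (μ := (Measure.pi fun i => Measure.pi fun j => bern (w i j)).prod
          (gaussianizeNoise N P Q)) hΦ hg
        rw [lintegral_prod (fun a => haarAvg f (rkMatrix N k P Q τ (rowNorms g) a.1 a.2))
          (hΦ.comp hg).aemeasurable, pi_pi_rkLaw] at e1
        have e2 := lintegral_map (μ := gaussianMatrix N) (g := fun G i j => G i j + m g i j) hΦ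
          (by fun_prop)
        rw [← e1, ← e2, gaussianMatrix_map_add]
        have hlaw : ∀ i j, IsProbabilityMeasure
            (rkLaw P Q (truncMean N k τ (rowNorms g) j) (w i j) (rkIter N P Q)) := fun i j =>
          Measure.isProbabilityMeasure_map ((measurable_rkRun P Q (rkIter N P Q)).comp
            (f := fun a : Bool × (Fin (rkIter N P Q) → ℝ × ℝ) =>
              (truncMean N k τ (rowNorms g) j, a.1, a.2)) (by fun_prop)).aemeasurable
        exact TVLe.pi_fin _ _ _ (fun i => TVLe.pi_fin _ _ _ fun j => hTV g i j) _ hΦ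
          (haarAvg_le_one h1)
    _ = _ := by rw [lintegral_add_right _ measurable_const]; simp

/-- Right multiplication by any fixed orthogonal matrix preserves the Gaussian law, so averaging
over rotations changes nothing. -/
theorem lintegral_gaussianMatrix_haarAvg {N : ℕ} {f : (Fin N → Fin N → ℝ) → ENNReal}
    (hf : Measurable f) :
    ∫⁻ G, haarAvg f G ∂gaussianMatrix N = ∫⁻ G, f G ∂gaussianMatrix N := by
  simp only [haarAvg]
  rw [lintegral_lintegral_swap (f := fun G R => f (mulOut G R))
    (hf.comp measurable_mulOut).aemeasurable]
  have : ∀ R : Matrix.orthogonalGroup (Fin N) ℝ, ∫⁻ G, f (mulOut G R) ∂gaussianMatrix N =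
      ∫⁻ G, f G ∂gaussianMatrix N := fun R => by
    conv_rhs => rw [← gaussianMatrix_map_mul R]
    have hm : Measurable fun G : Fin N → Fin N → ℝ => fun i j => ∑ l, G i l * R.1 l j :=
      measurable_mulOut.comp (measurable_id.prodMk measurable_const)
    rw [lintegral_map hf hm]
    rfl
  simp [this]

/-- Haar averages only depend on the norm. -/
theorem lintegral_haar_transpose_mulVec {N : ℕ} {Θ : (Fin N → ℝ) → ENNReal}
    {u v : Fin N → ℝ} (h : u ⬝ᵥ u = v ⬝ᵥ v) :
    ∫⁻ R, Θ (R.1ᵀ *ᵥ u) ∂haarOrthogonal N = ∫⁻ R, Θ (R.1ᵀ *ᵥ v) ∂haarOrthogonal N := by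
  obtain ⟨U, hU⟩ := exists_orthogonal_mulVec_eq h
  have : (haarOrthogonal N).IsMulLeftInvariant := by unfold haarOrthogonal; infer_instance
  -- Translating `R` to `U R` turns `Rᵀ u` into `Rᵀ (Uᵀ u) = Rᵀ v`.
  rw [← lintegral_mul_left_eq_self (fun R : Matrix.orthogonalGroup (Fin N) ℝ => Θ (R.1ᵀ *ᵥ u)) U]
  refine lintegral_congr fun R => ?_
  rw [← hU, mulVec_mulVec, ← transpose_mul]
  rfl

/-- After exchanging integrals, each `Rᵀ` preserves the standard Gaussian law of `h`. -/
theorem lintegral_pi_gaussian_haar {N : ℕ} {Θ : (Fin N → ℝ) → ENNReal} (hΘ : Measurable Θ) :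
    ∫⁻ h, ∫⁻ R : Matrix.orthogonalGroup (Fin N) ℝ, Θ (R.1ᵀ *ᵥ h) ∂haarOrthogonal N
      ∂(Measure.pi fun _ : Fin N => gaussianReal 0 1) =
    ∫⁻ h, Θ h ∂(Measure.pi fun _ : Fin N => gaussianReal 0 1) := by
  have hm : Measurable fun a : (Fin N → ℝ) × Matrix.orthogonalGroup (Fin N) ℝ =>
      a.2.1ᵀ *ᵥ a.1 := by
    refine measurable_pi_lambda _ fun i => ?_
    simp only [mulVec, dotProduct, transpose_apply]
    exact Finset.measurable_fun_sum _ fun l _ =>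
      ((measurable_orthogonalGroup_apply l i).comp measurable_snd).mul (by fun_prop)
  rw [lintegral_lintegral_swap (f := fun (h : Fin N → ℝ)
    (R : Matrix.orthogonalGroup (Fin N) ℝ) => Θ (R.1ᵀ *ᵥ h)) (hΘ.comp hm).aemeasurable]
  have : ∀ R : Matrix.orthogonalGroup (Fin N) ℝ,
      ∫⁻ h, Θ (R.1ᵀ *ᵥ h) ∂(Measure.pi fun _ : Fin N => gaussianReal 0 1) =
      ∫⁻ h, Θ h ∂(Measure.pi fun _ : Fin N => gaussianReal 0 1) := fun R => by
    have hR : (R.1ᵀ)ᵀ * R.1ᵀ = 1 := by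
      rw [transpose_transpose]; exact (mem_orthogonalGroup_iff _ _).1 R.2
    conv_rhs => rw [← pi_gaussian_map_mulVec hR]
    have hmr : Measurable fun h : Fin N → ℝ => R.1ᵀ *ᵥ h :=
      hm.comp (measurable_id.prodMk measurable_const)
    rw [lintegral_map hΘ hmr]
  simp [this]

end

/-! ### The rank-one shift under rotation, and the truncation -/

noncomputable section

open Matrix

/-- The output of the rotation step on a rank-one shift whose norm is `χ` distributed. -/
theorem lintegral_rankOne_rotation {N k : ℕ} (hN : 1 ≤ N) (hk : k ∣ N) {τ : ℝ} {S : Finset (Fin N)}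
    (hS : S.card = k) {f : (Fin N → Fin N → ℝ) → ENNReal} (hf : Measurable f) :
    ∫⁻ g, ∫⁻ G, haarAvg f (fun i j => G i j +
        if i ∈ S ∧ j ∈ S then 1 / 2 * τ * rowNorms g j * √((k : ℝ) / N) else 0) ∂gaussianMatrix N
        ∂gaussianRect N (N / k) =
      ∫⁻ Y, f Y ∂spikedMatrix N (τ ^ 2 * (k : ℝ) ^ 2 / (4 * N)) (plantedVec k S) := by
  have hk1 : 1 ≤ k := Nat.pos_of_dvd_of_pos hk hN
  have hkpos : (0 : ℝ) < k := by exact_mod_cast hk1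
  have hNpos : (0 : ℝ) < N := by exact_mod_cast hN
  set σ : ℝ := 1 / 2 * τ * √((k : ℝ) / N) with hσ
  set a : Fin N → ℝ := fun i => if i ∈ S then 1 else 0 with ha
  set u : (Fin N → Fin (N / k) → ℝ) → Fin N → ℝ :=
    fun g j => if j ∈ S then σ * rowNorms g j else 0 with hu
  let Θ : (Fin N → ℝ) → ENNReal := fun v => ∫⁻ G, f (fun i j => G i j + a i * v j) ∂gaussianMatrix N
  have hjoint : Measurable fun b : (Fin N → ℝ) × (Fin N → Fin N → ℝ) =>
      fun i j => b.2 i j + a i * b.1 j := by fun_prop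
  have hΘ : Measurable Θ := (hf.comp hjoint).lintegral_prod_right'
  -- The rows in `S` hold `k · (N/k) = N` Gaussian entries, just enough for one vector `h` of length
  -- `N`. The squared norm of `u` is `σ²` times their sum of squares, whatever the enumeration `e`.
  have hcard : Fintype.card (Fin N) = Fintype.card (S × Fin (N / k)) := by
    simp [hS, Nat.mul_div_cancel' hk]
  let e := Fintype.equivOfCardEq hcard
  let e' : Fin N → Fin N × Fin (N / k) := fun n => ((e n).1.1, (e n).2)
  have he' : Function.Injective e' := fun x y h => by
    simp only [e', Prod.mk.injEq] at h
    exact e.injective (Prod.ext (Subtype.ext h.1) h.2)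
  let h : (Fin N → Fin (N / k) → ℝ) → Fin N → ℝ := fun g n => g (e' n).1 (e' n).2
  have hnorm : ∀ g, u g ⬝ᵥ u g = (σ • h g) ⬝ᵥ (σ • h g) := by
    intro g
    have l1 : u g ⬝ᵥ u g = ∑ j ∈ S, σ ^ 2 * ∑ i, g j i ^ 2 := by
      simp only [dotProduct, hu]
      rw [← Finset.sum_subset (Finset.subset_univ S)]
      · refine Finset.sum_congr rfl fun j hj => ?_
        simp only [hj, if_true, rowNorms]
        rw [mul_mul_mul_comm, Real.mul_self_sqrt (Finset.sum_nonneg fun i _ => sq_nonneg _)]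
        ring
      · intro j _ hj; simp [hj]
    have l2 : (σ • h g) ⬝ᵥ (σ • h g) = ∑ n, σ ^ 2 * (fun b : S × Fin (N / k) => g b.1.1 b.2 ^ 2) (e n) := by
      simp only [dotProduct, h, e', Pi.smul_apply, smul_eq_mul]
      exact Finset.sum_congr rfl fun n _ => by ring
    rw [l1, l2, ← Finset.mul_sum, ← Finset.mul_sum,
      Equiv.sum_comp e (fun b : S × Fin (N / k) => g b.1.1 b.2 ^ 2), Fintype.sum_prod_type,
      ← Finset.sum_coe_sort S]
  -- The shift is `a uᵀ`, so the rotation turns it into `a (Rᵀ u)ᵀ`; for each `R` the rotated noise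
  -- is Gaussian again and the rotation can be removed from it.
  have step1 : ∀ g, ∫⁻ G, haarAvg f (fun i j => G i j +
      if i ∈ S ∧ j ∈ S then 1 / 2 * τ * rowNorms g j * √((k : ℝ) / N) else 0) ∂gaussianMatrix N =
      ∫⁻ R, Θ (R.1ᵀ *ᵥ u g) ∂haarOrthogonal N := by
    intro g
    have hsplit : ∀ (G : Fin N → Fin N → ℝ) (R : Matrix.orthogonalGroup (Fin N) ℝ),
        mulOut (fun i j => G i j +
          if i ∈ S ∧ j ∈ S then 1 / 2 * τ * rowNorms g j * √((k : ℝ) / N) else 0) R =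
        fun i j => mulOut G R i j + a i * (R.1ᵀ *ᵥ u g) j := by
      intro G R
      funext i j
      simp only [mulOut, add_mul, Finset.sum_add_distrib, mulVec, dotProduct, transpose_apply,
        Finset.mul_sum]
      congr 1
      refine Finset.sum_congr rfl fun l _ => ?_
      by_cases hi : i ∈ S <;> by_cases hl : l ∈ S <;> simp [ha, hu, hi, hl, hσ]
      ring
    simp only [haarAvg, hsplit]
    have hm : Measurable fun b : (Fin N → Fin N → ℝ) × Matrix.orthogonalGroup (Fin N) ℝ =>
        fun i j => mulOut b.1 b.2 i j + a i * (b.2.1ᵀ *ᵥ u g) j := by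
      refine measurable_pi_lambda _ fun i => measurable_pi_lambda _ fun j => ?_
      refine Measurable.add (measurable_pi_iff.1 (measurable_pi_iff.1 measurable_mulOut i) j) ?_
      simp only [mulVec, dotProduct, transpose_apply]
      exact (Finset.measurable_fun_sum _ fun l _ =>
        ((measurable_orthogonalGroup_apply l j).comp measurable_snd).mul measurable_const).const_mul _
    rw [lintegral_lintegral_swap (f := fun G R => f (fun i j => mulOut G R i j +
      a i * (R.1ᵀ *ᵥ u g) j)) (hf.comp hm).aemeasurable]
    refine lintegral_congr fun R => ?_
    have h1 : Measurable fun G : Fin N → Fin N → ℝ => fun i j => ∑ l, G i l * R.1 l j :=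
      measurable_mulOut.comp (measurable_id.prodMk measurable_const)
    have h2 : Measurable fun G : Fin N → Fin N → ℝ =>
        f (fun i j => G i j + a i * (R.1ᵀ *ᵥ u g) j) := hf.comp (by fun_prop)
    simp only [Θ]
    conv_rhs => rw [← gaussianMatrix_map_mul R]
    rw [lintegral_map h2 h1]
    rfl
  have hg : Measurable h := by fun_prop
  have hmR : Measurable fun b : (Fin N → ℝ) × Matrix.orthogonalGroup (Fin N) ℝ =>
      Θ (b.2.1ᵀ *ᵥ (σ • b.1)) := by
    refine hΘ.comp (measurable_pi_lambda _ fun i => ?_)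
    simp only [mulVec, dotProduct, transpose_apply, Pi.smul_apply]
    exact Finset.measurable_fun_sum _ fun l _ =>
      ((measurable_orthogonalGroup_apply l i).comp measurable_snd).mul (by fun_prop)
  calc _ = ∫⁻ g, (fun v => ∫⁻ R : Matrix.orthogonalGroup (Fin N) ℝ,
        Θ (R.1ᵀ *ᵥ (σ • v)) ∂haarOrthogonal N) (h g) ∂gaussianRect N (N / k) :=
        lintegral_congr fun g => (step1 g).trans (lintegral_haar_transpose_mulVec (hnorm g))
    _ = ∫⁻ v, ∫⁻ R : Matrix.orthogonalGroup (Fin N) ℝ, Θ (σ • (R.1ᵀ *ᵥ v)) ∂haarOrthogonal N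
        ∂(Measure.pi fun _ : Fin N => gaussianReal 0 1) := by
        rw [← lintegral_map hmR.lintegral_prod_right' hg, gaussianRect, pi_pi_map_vector he']
        simp only [mulVec_smul]
    _ = ∫⁻ v, Θ (σ • v) ∂(Measure.pi fun _ : Fin N => gaussianReal 0 1) :=
        lintegral_pi_gaussian_haar (Θ := fun v => Θ (σ • v)) (hΘ.comp (by fun_prop))
    _ = _ := by
        -- `σ² = τ² k / (4N)`; the extra factor `k` on the right compensates the normalization of
        -- `plantedVec`.
        have hvec : vecMulVec (σ • a) (σ • a) = (τ ^ 2 * (k : ℝ) ^ 2 / (4 * N)) •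
            vecMulVec (plantedVec k S) (plantedVec k S) := by
          ext i j
          have hsk := Real.mul_self_sqrt hkpos.le
          have hσ2 : σ * σ = τ ^ 2 * k / (4 * N) := by
            rw [hσ, mul_mul_mul_comm, Real.mul_self_sqrt (by positivity)]
            field_simp; ring
          simp only [vecMulVec_apply, Matrix.smul_apply, Pi.smul_apply, smul_eq_mul, plantedVec, ha]
          by_cases hi : i ∈ S <;> by_cases hj : j ∈ S <;> simp only [hi, hj, if_true, if_false,
            mul_one, mul_zero, zero_mul]
          rw [hσ2, div_mul_div_comm, hsk]
          field_simp
        rw [← map_add_mul_eq_spikedMatrix (by positivity) _ _ hvec, lintegral_map hf (by fun_prop),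
          lintegral_prod_symm' (fun b : (Fin N → Fin N → ℝ) × (Fin N → ℝ) => f _)
            (hf.comp (by fun_prop))]
        refine lintegral_congr fun v => ?_
        have hF : Measurable fun G : Fin N → Fin N → ℝ => f (fun i j => G i j + a i * (σ • v) j) :=
          hf.comp (by fun_prop)
        simp only [Θ]
        -- In `map_add_mul_eq_spikedMatrix` the samples are rows that become columns, so the
        -- Gaussian part is transposed first.
        conv_lhs => rw [← gaussianMatrix_map_transpose, lintegral_map hF (by fun_prop)]
        refine lintegral_congr fun G => ?_
        congr 1
        funext i j
        simp only [Pi.smul_apply, smul_eq_mul]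
        ring

/-- Removing the truncation of the target means. -/
theorem lintegral_truncMean_le {N k : ℕ} (hN : 1 ≤ N) (hk : k ∣ N) {τ : ℝ} {S : Finset (Fin N)}
    {f : (Fin N → Fin N → ℝ) → ENNReal} (h1 : ∀ x, f x ≤ 1) :
    ∫⁻ g, ∫⁻ G, haarAvg f (fun i j => G i j +
        if i ∈ S ∧ j ∈ S then truncMean N k τ (rowNorms g) j else 0) ∂gaussianMatrix N
        ∂gaussianRect N (N / k) ≤
      (∫⁻ g, ∫⁻ G, haarAvg f (fun i j => G i j +
        if i ∈ S ∧ j ∈ S then 1 / 2 * τ * rowNorms g j * √((k : ℝ) / N) else 0) ∂gaussianMatrix N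
        ∂gaussianRect N (N / k)) +
      S.card * ENNReal.ofReal ((4 * Real.exp (-3)) ^ ((N : ℝ) / (2 * k))) := by
  have hk1 : 1 ≤ k := Nat.pos_of_dvd_of_pos hk hN
  have hkpos : (0 : ℝ) < k := by exact_mod_cast hk1
  have hdiv : ((N / k : ℕ) : ℝ) = (N : ℝ) / k := Nat.cast_div hk hkpos.ne'
  let B : Fin N → Set (Fin N → Fin (N / k) → ℝ) := fun j => {g | 2 * √((N : ℝ) / k) < rowNorms g j}
  have hBm : ∀ j, MeasurableSet (B j) := fun j =>
    measurableSet_lt measurable_const ((measurable_pi_apply j).comp measurable_rowNorms)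
  have hB : ∀ j, gaussianRect N (N / k) (B j) ≤
      ENNReal.ofReal ((4 * Real.exp (-3)) ^ ((N : ℝ) / (2 * k))) := by
    intro j
    have e1 : B j = rowNorms ⁻¹' (Function.eval j ⁻¹' {r | 2 * √((N / k : ℕ) : ℝ) < r}) := by
      simp only [B, hdiv]; rfl
    have hr : MeasurableSet {r : ℝ | 2 * √((N / k : ℕ) : ℝ) < r} := measurableSet_Ioi
    rw [e1, ← Measure.map_apply measurable_rowNorms ((measurable_pi_apply j) hr),
      gaussianRect_map_rowNorms, (measurePreserving_eval _ j).measure_preimage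
        hr.nullMeasurableSet]
    refine (sqrtChiSq_tail (N / k)).trans (le_of_eq ?_)
    rw [hdiv, div_div, mul_comm (k : ℝ)]
  calc _ ≤ ∫⁻ g, ((∫⁻ G, haarAvg f (fun i j => G i j +
        if i ∈ S ∧ j ∈ S then 1 / 2 * τ * rowNorms g j * √((k : ℝ) / N) else 0) ∂gaussianMatrix N) +
        ∑ j ∈ S, (B j).indicator 1 g) ∂gaussianRect N (N / k) := by
        refine lintegral_mono fun g => ?_
        -- Only columns in `S` carry a shift. If one of their radii is cut off, the average is
        -- bounded by `1` and an indicator pays for it; otherwise the two integrands agree.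
        by_cases hg : ∃ j ∈ S, g ∈ B j
        · obtain ⟨j, hj, hgj⟩ := hg
          calc _ ≤ (1 : ENNReal) :=
                (lintegral_mono fun G => haarAvg_le_one h1 _).trans (by simp)
            _ ≤ ∑ j ∈ S, (B j).indicator 1 g := by
                refine le_trans ?_ (Finset.single_le_sum (f := fun j => (B j).indicator 1 g)
                  (fun _ _ => bot_le) hj)
                simp [hgj]
            _ ≤ _ := le_add_self
        · push Not at hg
          refine le_trans (le_of_eq ?_) le_self_add
          refine lintegral_congr fun G => ?_
          congr 1
          funext i j
          congr 1
          by_cases hij : i ∈ S ∧ j ∈ S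
          · have : rowNorms g j ≤ 2 * √((N : ℝ) / k) := not_lt.1 (hg j hij.2)
            simp only [hij, and_self, if_true, truncMean, min_eq_left this]
          · simp only [hij, if_false]
    _ = (∫⁻ g, ∫⁻ G, haarAvg f (fun i j => G i j +
        if i ∈ S ∧ j ∈ S then 1 / 2 * τ * rowNorms g j * √((k : ℝ) / N) else 0) ∂gaussianMatrix N
        ∂gaussianRect N (N / k)) + ∑ j ∈ S, gaussianRect N (N / k) (B j) := by
        rw [lintegral_add_right _ (Finset.measurable_fun_sum _ fun j _ =>
          measurable_one.indicator (hBm j)), lintegral_finsetSum _ fun j _ =>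
          measurable_one.indicator (hBm j)]
        simp only [lintegral_indicator_one (hBm _)]
    _ ≤ _ := by
        gcongr
        refine (Finset.sum_le_card_nsmul _ _ _ fun j _ => hB j).trans ?_
        simp

/-- The cap `2 √(N/k)` cancels the factors `1/2` and `√(k/N)`. Every target mean thus lies in `[0,
τ]`, the range in which the rejection kernel is accurate. -/
theorem truncMean_bounds {N k : ℕ} (hN : 1 ≤ N) (hk : k ∣ N) {τ : ℝ} (hτ : 0 ≤ τ) {r : Fin N → ℝ}
    (j : Fin N) (hr : 0 ≤ r j) : 0 ≤ truncMean N k τ r j ∧ truncMean N k τ r j ≤ τ := by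
  have hk1 : 1 ≤ k := Nat.pos_of_dvd_of_pos hk hN
  have hkpos : (0 : ℝ) < k := by exact_mod_cast hk1
  have hNpos : (0 : ℝ) < N := by exact_mod_cast hN
  have hmin : 0 ≤ min (r j) (2 * √((N : ℝ) / k)) := le_min hr (by positivity)
  refine ⟨by unfold truncMean; positivity, ?_⟩
  have hs : √((N : ℝ) / k) * √((k : ℝ) / N) = 1 := by
    rw [← Real.sqrt_mul (by positivity), div_mul_div_comm, mul_comm (k : ℝ), div_self (by positivity),
      Real.sqrt_one]
  calc truncMean N k τ r j ≤ 1 / 2 * τ * (2 * √((N : ℝ) / k)) * √((k : ℝ) / N) := by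
        unfold truncMean
        gcongr
        exact min_le_right _ _
    _ = τ * (√((N : ℝ) / k) * √((k : ℝ) / N)) := by ring
    _ = τ := by rw [hs, mul_one]

instance isProbabilityMeasure_chiSqRandomRotation (N k : ℕ) (P Q τ : ℝ)
    (M : Fin N → Fin N → Bool) : IsProbabilityMeasure (chiSqRandomRotation N k P Q τ M) := by
  refine ⟨?_⟩
  have := lintegral_chiSqRandomRotation N k P Q τ M (f := fun _ => 1) measurable_const
  simpa [haarAvg] using this

theorem isProbabilityMeasure_bind_chi {N k : ℕ} {P Q τ : ℝ} (μ : Measure (Fin N → Fin N → Bool))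
    [IsProbabilityMeasure μ] : IsProbabilityMeasure (μ.bind (chiSqRandomRotation N k P Q τ)) :=
  isProbabilityMeasure_bind (Measurable.of_discrete).aemeasurable
    (Filter.Eventually.of_forall fun _ => inferInstance)

instance isProbabilityMeasure_spikedMatrix (N : ℕ) (θ : ℝ) (v : Fin N → ℝ) :
    IsProbabilityMeasure (spikedMatrix N θ v) :=
  Measure.isProbabilityMeasure_map (Measurable.aemeasurable (by fun_prop))

/-! ### The two total variation bounds -/

section Main
variable {N k : ℕ} {P Q τ c : ℝ}

/-- `N²` entries at `4 N⁻³` each give `4/N`, and removing the cap gives the second term. What is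
left is exactly the spiked law. -/
theorem bind_chi_planted_tvLe (hc : 0 < c) (hNc : 1 / c ≤ N) (hN : 1 ≤ N) (hk : k ∣ N)
    (hcQ : c ≤ Q) (hQP : Q < P) (hP : P ≤ 1) (hτ0 : 0 < τ)
    (hτ : τ ≤ rkDelta P Q / (2 * √(6 * Real.log N + 2 * Real.log (P - Q)⁻¹)))
    {S : Finset (Fin N)} (hS : S.card = k) :
    TVLe ((plantedBernoulli N S P Q).bind (chiSqRandomRotation N k P Q τ))
      (spikedMatrix N (τ ^ 2 * (k : ℝ) ^ 2 / (4 * N)) (plantedVec k S))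
      (ENNReal.ofReal (4 * (N : ℝ)⁻¹ + k * (4 * Real.exp (-3)) ^ ((N : ℝ) / (2 * k)))) := by
  intro f hf h1
  have hNpos : (0 : ℝ) < N := by exact_mod_cast hN
  have hTV : ∀ (g : Fin N → Fin (N / k) → ℝ) (i j : Fin N),
      TVLe (rkLaw P Q (truncMean N k τ (rowNorms g) j) (if i ∈ S ∧ j ∈ S then P else Q)
        (rkIter N P Q))
      (gaussianReal (if i ∈ S ∧ j ∈ S then truncMean N k τ (rowNorms g) j else 0) 1)
      (ENNReal.ofReal (4 * ((N : ℝ) ^ 3)⁻¹)) := by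
    intro g i j
    have hb := truncMean_bounds (r := rowNorms g) hN hk hτ0.le j (Real.sqrt_nonneg _)
    refine rkLaw_rkIter_tvLe hc hNc hcQ (by linarith) hQP hP hτ hb.1 hb.2 ?_
    by_cases h : i ∈ S ∧ j ∈ S
    · left; simp [h]
    · right; simp [h]
  refine (lintegral_bind_chiSqRandomRotation_le hTV hf h1).trans ?_
  refine (add_le_add (lintegral_truncMean_le hN hk h1) le_rfl).trans ?_
  rw [lintegral_rankOne_rotation hN hk hS hf, add_assoc]
  refine add_le_add le_rfl (le_of_eq ?_)
  rw [hS, ← ENNReal.ofReal_natCast k, ← ENNReal.ofReal_natCast N,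
    ← ENNReal.ofReal_mul (by positivity), ← ENNReal.ofReal_mul (by positivity),
    ← ENNReal.ofReal_mul (by positivity), ← ENNReal.ofReal_add (by positivity) (by positivity)]
  congr 1
  field_simp
  ring

theorem bind_chi_null_tvLe (hc : 0 < c) (hNc : 1 / c ≤ N) (hN : 1 ≤ N) (hk : k ∣ N)
    (hcQ : c ≤ Q) (hQP : Q < P) (hP : P ≤ 1) (hτ0 : 0 < τ)
    (hτ : τ ≤ rkDelta P Q / (2 * √(6 * Real.log N + 2 * Real.log (P - Q)⁻¹))) :
    TVLe ((nullBernoulli N Q).bind (chiSqRandomRotation N k P Q τ)) (gaussianMatrix N)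
      (ENNReal.ofReal (4 * (N : ℝ)⁻¹)) := by
  intro f hf h1
  have hNpos : (0 : ℝ) < N := by exact_mod_cast hN
  have hTV : ∀ (g : Fin N → Fin (N / k) → ℝ) (i j : Fin N),
      TVLe (rkLaw P Q (truncMean N k τ (rowNorms g) j) ((fun _ _ => Q) i j) (rkIter N P Q))
      (gaussianReal ((fun _ _ _ => 0) g i j) 1) (ENNReal.ofReal (4 * ((N : ℝ) ^ 3)⁻¹)) := by
    intro g i j
    have hb := truncMean_bounds (r := rowNorms g) hN hk hτ0.le j (Real.sqrt_nonneg _)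
    exact rkLaw_rkIter_tvLe hc hNc hcQ (by linarith) hQP hP hτ hb.1 hb.2 (Or.inr ⟨rfl, rfl⟩)
  refine (lintegral_bind_chiSqRandomRotation_le hTV hf h1).trans ?_
  simp only [add_zero, lintegral_const, measure_univ, mul_one]
  rw [lintegral_gaussianMatrix_haarAvg hf]
  refine add_le_add le_rfl (le_of_eq ?_)
  rw [← ENNReal.ofReal_natCast N, ← ENNReal.ofReal_mul (by positivity),
    ← ENNReal.ofReal_mul (by positivity)]
  congr 1
  field_simp
end Main
end

noncomputable section

/-! ### Program logic -/

namespace RealProg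

/-- The variables bound by the loops of a program. -/
def loopVars : RealProg → Set ℕ
  | .skip => ∅
  | .assign _ _ _ _ => ∅
  | .gauss _ _ _ => ∅
  | .unif _ _ _ => ∅
  | .seq c d => c.loopVars ∪ d.loopVars
  | .ite _ _ c d => c.loopVars ∪ d.loopVars
  | .loop v _ c => {v} ∪ c.loopVars

/-- The arrays a program writes to. -/
def arrays : RealProg → Set ℕ
  | .skip => ∅
  | .assign a _ _ _ => {a}
  | .gauss a _ _ => {a}
  | .unif a _ _ => {a}
  | .seq c d => c.arrays ∪ d.arrays
  | .ite _ _ c d => c.arrays ∪ d.arrays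
  | .loop _ _ c => c.arrays

/-- Frame rule for variables; `mem_run` is the one for arrays. They carry facts past subprograms
that do not touch the data concerned. -/
theorem idx_run (ω : ℕ → ℝ × ℝ) (c : RealProg) (s : RealState) {u : ℕ} (hu : u ∉ c.loopVars) :
    (c.run ω s).idx u = s.idx u := by
  induction c generalizing s with
  | skip => rfl
  | assign => rfl
  | gauss => rfl
  | unif => rfl
  | seq c d hc hd =>
    simp only [loopVars, Set.mem_union, not_or] at hu
    exact (hd _ hu.2).trans (hc _ hu.1)
  | ite e f c d hc hd =>
    simp only [loopVars, Set.mem_union, not_or] at hu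
    simp only [run]
    split_ifs
    · exact hc _ hu.1
    · exact hd _ hu.2
  | loop v e c hc =>
    simp only [loopVars, Set.mem_union, not_or, Set.mem_singleton_iff] at hu
    simp only [run]
    generalize ⌈e.eval s.mem s.idx⌉₊ = n
    induction n with
    | zero => rfl
    | succ n ih =>
      refine (hc _ hu.2).trans (Eq.trans ?_ ih)
      exact Function.update_of_ne hu.1 _ _

theorem mem_run (ω : ℕ → ℝ × ℝ) (c : RealProg) (s : RealState) {a : ℕ} (ha : a ∉ c.arrays) :
    (c.run ω s).mem a = s.mem a := by
  induction c generalizing s with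
  | skip => rfl
  | assign a' => exact Function.update_of_ne (by simpa [arrays] using ha) _ _
  | gauss => exact Function.update_of_ne (by simpa [arrays] using ha) _ _
  | unif => exact Function.update_of_ne (by simpa [arrays] using ha) _ _
  | seq c d hc hd =>
    simp only [arrays, Set.mem_union, not_or] at ha
    exact (hd _ ha.2).trans (hc _ ha.1)
  | ite e f c d hc hd =>
    simp only [arrays, Set.mem_union, not_or] at ha
    simp only [run]
    split_ifs
    · exact hc _ ha.1
    · exact hd _ ha.2
  | loop v e c hc =>
    simp only [arrays] at ha
    simp only [run]
    generalize ⌈e.eval s.mem s.idx⌉₊ = n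
    induction n with
    | zero => rfl
    | succ n ih => exact (hc _ ha).trans ih

/-- Loop rule: `I` is an invariant of the memory and every iteration draws `D` samples. -/
theorem run_loop_spec {ω : ℕ → ℝ × ℝ} {v : ℕ} {e : RealExpr} {c : RealProg} {s : RealState} {n D : ℕ}
    (hn : ⌈e.eval s.mem s.idx⌉₊ = n) (I : ℕ → (ℕ → ℕ → ℕ → ℝ) → Prop) (h0 : I 0 s.mem)
    (hstep : ∀ t < n, ∀ s' : RealState, (∀ u ∉ c.loopVars, u ≠ v → s'.idx u = s.idx u) →
      s'.idx v = t → (∀ a ∉ c.arrays, s'.mem a = s.mem a) → s'.drawn = s.drawn + t * D →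
      I t s'.mem → (c.run ω s').drawn = s'.drawn + D ∧ I (t + 1) (c.run ω s').mem) :
    ((RealProg.loop v e c).run ω s).drawn = s.drawn + n * D ∧
      I n ((RealProg.loop v e c).run ω s).mem := by
  simp only [run, hn]
  -- The induction carries the frame facts and the draw count along with `I`, so that the user of
  -- the rule only has to maintain `I`.
  have key : ∀ t ≤ n, ∀ s' : RealState, s' = Nat.rec (motive := fun _ => RealState)
      (s.tick (e.cost s.idx + 1)) (fun t s' => c.run ω ((s'.tick 1).setIdx v t)) t →
      (∀ u ∉ c.loopVars, u ≠ v → s'.idx u = s.idx u) ∧ (∀ a ∉ c.arrays, s'.mem a = s.mem a) ∧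
      s'.drawn = s.drawn + t * D ∧ I t s'.mem := by
    intro t
    induction t with
    | zero => rintro - s' rfl; exact ⟨fun _ _ _ => rfl, fun _ _ => rfl, by simp [RealState.tick], h0⟩
    | succ t ih =>
      intro ht s' hs'
      obtain ⟨h1, h2, h3, h4⟩ := ih (by omega) _ rfl
      set s₁ : RealState := Nat.rec (motive := fun _ => RealState)
        (s.tick (e.cost s.idx + 1)) (fun t s' => c.run ω ((s'.tick 1).setIdx v t)) t
      change s' = c.run ω ((s₁.tick 1).setIdx v t) at hs'
      have hidx : ∀ u, u ≠ v → ((s₁.tick 1).setIdx v t).idx u = s₁.idx u :=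
        fun u hu => Function.update_of_ne hu _ _
      obtain ⟨h5, h6⟩ := hstep t (by omega) ((s₁.tick 1).setIdx v t)
        (fun u hu huv => (hidx u huv).trans (h1 u hu huv)) (Function.update_self _ _ _) h2 h3 h4
      refine ⟨fun u hu huv => ?_, fun a ha => ?_, ?_, ?_⟩
      · rw [hs', idx_run ω c _ hu, hidx u huv, h1 u hu huv]
      · rw [hs', mem_run ω c _ ha]; exact h2 a ha
      · rw [hs', h5]; change s₁.drawn + D = _; rw [h3]; ring
      · rw [hs']; exact h6
  exact ⟨(key n le_rfl _ rfl).2.2.1, (key n le_rfl _ rfl).2.2.2⟩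

end RealProg

theorem RealState.mem_store (s : RealState) (a i j : ℕ) (x : ℝ) (a' i' j' : ℕ) :
    (s.store a i j x).mem a' i' j' = if a' = a ∧ i' = i ∧ j' = j then x else s.mem a' i' j' := by
  simp only [RealState.store, Function.update_apply]
  by_cases ha : a' = a
  · subst ha
    by_cases hi : i' = i
    · subst hi
      by_cases hj : j' = j <;> simp [hj]
    · simp [hi]
  · simp [ha]

/-! ### Running time -/

/-- Every sum has at most `x 0` terms and leaves variable `0` alone. -/
def RealExpr.SmallSums : RealExpr → Prop
  | .lit _ => True
  | .ofNat _ => True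
  | .read _ _ _ => True
  | .add e f => e.SmallSums ∧ f.SmallSums
  | .sub e f => e.SmallSums ∧ f.SmallSums
  | .mul e f => e.SmallSums ∧ f.SmallSums
  | .div e f => e.SmallSums ∧ f.SmallSums
  | .sqrt e => e.SmallSums
  | .exp e => e.SmallSums
  | .log e => e.SmallSums
  | .sum v n e => v ≠ 0 ∧ (∀ x, n.eval x ≤ x 0) ∧ e.SmallSums

/-- Polynomial bounds in `B` are closed under addition. A sum has at most `x 0 ≤ B` terms, which
raises the degree by one, and it does not rebind variable `0`, so the bound still holds inside. -/
theorem RealExpr.exists_cost_le (e : RealExpr) (he : e.SmallSums) :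
    ∃ K d : ℕ, ∀ B x, 1 ≤ B → x 0 ≤ B → e.cost x ≤ K * B ^ d := by
  have two : ∀ {e f : RealExpr}, (∃ K d : ℕ, ∀ B x, 1 ≤ B → x 0 ≤ B → e.cost x ≤ K * B ^ d) →
      (∃ K d : ℕ, ∀ B x, 1 ≤ B → x 0 ≤ B → f.cost x ≤ K * B ^ d) →
      ∃ K d : ℕ, ∀ B x, 1 ≤ B → x 0 ≤ B → e.cost x + f.cost x + 1 ≤ K * B ^ d := by
    rintro e f ⟨K, d, h⟩ ⟨K', d', h'⟩
    refine ⟨K + K' + 1, d + d', fun B x hB hx => ?_⟩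
    have h1 := h B x hB hx
    have h2 := h' B x hB hx
    have h3 : B ^ d ≤ B ^ (d + d') := Nat.pow_le_pow_right hB (by omega)
    have h4 : B ^ d' ≤ B ^ (d + d') := Nat.pow_le_pow_right hB (by omega)
    have h5 : 1 ≤ B ^ (d + d') := Nat.one_le_pow _ _ hB
    nlinarith
  have one : ∀ {e : RealExpr}, (∃ K d : ℕ, ∀ B x, 1 ≤ B → x 0 ≤ B → e.cost x ≤ K * B ^ d) →
      ∃ K d : ℕ, ∀ B x, 1 ≤ B → x 0 ≤ B → e.cost x + 1 ≤ K * B ^ d := by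
    rintro e ⟨K, d, h⟩
    refine ⟨K + 1, d, fun B x hB hx => ?_⟩
    have h5 : 1 ≤ B ^ d := Nat.one_le_pow _ _ hB
    have h1 := h B x hB hx
    nlinarith
  induction e with
  | lit => exact ⟨1, 0, fun _ _ _ _ => by simp [cost]⟩
  | ofNat n => exact ⟨n.cost + 1, 0, fun _ _ _ _ => by simp [cost]⟩
  | read a i j => exact ⟨i.cost + j.cost + 1, 0, fun _ _ _ _ => by simp [cost]⟩
  | add e f h1 h2 => exact two (h1 he.1) (h2 he.2)
  | sub e f h1 h2 => exact two (h1 he.1) (h2 he.2)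
  | mul e f h1 h2 => exact two (h1 he.1) (h2 he.2)
  | div e f h1 h2 => exact two (h1 he.1) (h2 he.2)
  | sqrt e h => exact one (h he)
  | exp e h => exact one (h he)
  | log e h => exact one (h he)
  | sum v n e h =>
    obtain ⟨hv, hn, he'⟩ := he
    obtain ⟨K, d, hK⟩ := one (h he')
    refine ⟨n.cost + 1 + K, d + 1, fun B x hB hx => ?_⟩
    have h1 : ∑ t ∈ Finset.range (n.eval x), (e.cost (Function.update x v t) + 1) ≤
        B * (K * B ^ d) := by
      refine (Finset.sum_le_card_nsmul _ _ (K * B ^ d) fun t _ => hK B _ hB ?_).trans ?_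
      · rwa [Function.update_of_ne hv.symm]
      · rw [Finset.card_range, smul_eq_mul]
        exact Nat.mul_le_mul_right _ ((hn x).trans hx)
    have h5 : 1 ≤ B ^ (d + 1) := Nat.one_le_pow _ _ hB
    simp only [cost]
    calc _ ≤ (n.cost + 1) * B ^ (d + 1) + B * (K * B ^ d) := by nlinarith
      _ = _ := by ring

/-- All loops run at most `N` or `mem a 0 0` times, where `N` is variable `0`. -/
def RealProg.SmallLoops (a : ℕ) : RealProg → Prop
  | .skip => True
  | .assign _ _ _ e => e.SmallSums
  | .gauss _ _ _ => True
  | .unif _ _ _ => True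
  | .seq c d => c.SmallLoops a ∧ d.SmallLoops a
  | .ite e f c d => e.SmallSums ∧ f.SmallSums ∧ c.SmallLoops a ∧ d.SmallLoops a
  | .loop v e c => v ≠ 0 ∧ ((∃ n, e = .ofNat n ∧ ∀ x, n.eval x ≤ x 0) ∨
      e = .read a (.lit 0) (.lit 0)) ∧ c.SmallLoops a

theorem RealProg.SmallLoops.zero_notMem {a : ℕ} {c : RealProg} (hc : c.SmallLoops a) :
    0 ∉ c.loopVars := by
  induction c with
  | seq c d h1 h2 => exact fun h => h.elim (h1 hc.1) (h2 hc.2)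
  | ite e f c d h1 h2 => exact fun h => h.elim (h1 hc.2.2.1) (h2 hc.2.2.2)
  | loop v e c h1 => exact fun h => h.elim (fun h => hc.1 h.symm) (h1 hc.2.2)
  | _ => exact Set.notMem_empty _

/-- One `B` bounds both kinds of loop length. The program changes neither variable `0` nor array
`a`, so the same `B` serves at every nesting level and each loop raises the degree by one. The bound
is uniform in the tape. -/
theorem RealProg.exists_steps_le (a : ℕ) (c : RealProg) (hc : c.SmallLoops a)
    (ha : a ∉ c.arrays) : ∃ K d : ℕ, ∀ (ω : ℕ → ℝ × ℝ) (s : RealState) (B : ℕ), 1 ≤ B →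
      s.idx 0 ≤ B → ⌈s.mem a 0 0⌉₊ ≤ B → (c.run ω s).steps ≤ s.steps + K * B ^ d := by
  induction c with
  | skip => exact ⟨1, 0, fun ω s B _ _ _ => by simp [run, RealState.tick]⟩
  | assign a i j e =>
    obtain ⟨K, d, h⟩ := e.exists_cost_le hc
    refine ⟨i.cost + j.cost + 1 + K, d, fun ω s B hB hs _ => ?_⟩
    have h1 := h B s.idx hB hs
    have h5 : 1 ≤ B ^ d := Nat.one_le_pow _ _ hB
    change s.steps + (i.cost + j.cost + e.cost s.idx + 1) ≤ _
    nlinarith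
  | gauss a i j => exact ⟨i.cost + j.cost + 1, 0, fun ω s B _ _ _ => by
      simp [run, RealState.tick, RealState.draw, RealState.store]⟩
  | unif a i j => exact ⟨i.cost + j.cost + 1, 0, fun ω s B _ _ _ => by
      simp [run, RealState.tick, RealState.draw, RealState.store]⟩
  | seq c d h1 h2 =>
    simp only [arrays, Set.mem_union, not_or] at ha
    obtain ⟨K, e, h1⟩ := h1 hc.1 ha.1
    obtain ⟨K', e', h2⟩ := h2 hc.2 ha.2
    refine ⟨K + K', e + e', fun ω s B hB hs hm => ?_⟩
    have h3 := h1 ω s B hB hs hm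
    have h4 := h2 ω (c.run ω s) B hB (by rwa [idx_run _ _ _ hc.1.zero_notMem])
      (by rwa [mem_run _ _ _ ha.1])
    have h5 : B ^ e ≤ B ^ (e + e') := Nat.pow_le_pow_right hB (by omega)
    have h6 : B ^ e' ≤ B ^ (e + e') := Nat.pow_le_pow_right hB (by omega)
    simp only [run]
    nlinarith
  | ite e f c d h1 h2 =>
    simp only [arrays, Set.mem_union, not_or] at ha
    obtain ⟨K₁, e₁, h1⟩ := h1 hc.2.2.1 ha.1
    obtain ⟨K₂, e₂, h2⟩ := h2 hc.2.2.2 ha.2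
    obtain ⟨K₃, e₃, h3⟩ := e.exists_cost_le hc.1
    obtain ⟨K₄, e₄, h4⟩ := f.exists_cost_le hc.2.1
    refine ⟨K₁ + K₂ + K₃ + K₄ + 1, e₁ + e₂ + e₃ + e₄, fun ω s B hB hs hm => ?_⟩
    set s' := s.tick (e.cost s.idx + f.cost s.idx + 1) with hs'
    have b1 := h1 ω s' B hB hs hm
    have b2 := h2 ω s' B hB hs hm
    have b3 := h3 B s.idx hB hs
    have b4 := h4 B s.idx hB hs
    have b5 : s'.steps = s.steps + (e.cost s.idx + f.cost s.idx + 1) := rfl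
    have c1 : B ^ e₁ ≤ B ^ (e₁ + e₂ + e₃ + e₄) := Nat.pow_le_pow_right hB (by omega)
    have c2 : B ^ e₂ ≤ B ^ (e₁ + e₂ + e₃ + e₄) := Nat.pow_le_pow_right hB (by omega)
    have c3 : B ^ e₃ ≤ B ^ (e₁ + e₂ + e₃ + e₄) := Nat.pow_le_pow_right hB (by omega)
    have c4 : B ^ e₄ ≤ B ^ (e₁ + e₂ + e₃ + e₄) := Nat.pow_le_pow_right hB (by omega)
    have c5 : 1 ≤ B ^ (e₁ + e₂ + e₃ + e₄) := Nat.one_le_pow _ _ hB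
    have g1 := Nat.mul_le_mul_left K₁ c1
    have g2 := Nat.mul_le_mul_left K₂ c2
    have g3 := Nat.mul_le_mul_left K₃ c3
    have g4 := Nat.mul_le_mul_left K₄ c4
    simp only [run, ← hs', add_mul, one_mul]
    split_ifs <;> omega
  | loop v e c h1 =>
    obtain ⟨hv, he, hc⟩ := hc
    simp only [arrays] at ha
    obtain ⟨K, d, h1⟩ := h1 hc ha
    have hce : ∃ K₀, ∀ x, e.cost x ≤ K₀ := by
      rcases he with ⟨n, rfl, -⟩ | rfl
      · exact ⟨_, fun x => le_rfl⟩
      · exact ⟨_, fun x => le_rfl⟩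
    obtain ⟨K₀, hK₀⟩ := hce
    refine ⟨K₀ + 2 + K, d + 1, fun ω s B hB hs hm => ?_⟩
    have hn : ⌈e.eval s.mem s.idx⌉₊ ≤ B := by
      rcases he with ⟨n, rfl, hn⟩ | rfl
      · simp only [RealExpr.eval, Nat.ceil_natCast]; exact (hn _).trans hs
      · exact hm
    have key : ∀ t, ∀ s' : RealState, s' = Nat.rec (motive := fun _ => RealState)
        (s.tick (e.cost s.idx + 1)) (fun t s' => c.run ω ((s'.tick 1).setIdx v t)) t →
        s'.idx 0 = s.idx 0 ∧ s'.mem a = s.mem a ∧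
        s'.steps ≤ s.steps + (e.cost s.idx + 1) + t * (K * B ^ d + 1) := by
      intro t
      induction t with
      | zero => rintro s' rfl; exact ⟨rfl, rfl, by simp [RealState.tick]⟩
      | succ t ih =>
        intro s' hs'
        obtain ⟨i1, i2, i3⟩ := ih _ rfl
        set s₁ : RealState := Nat.rec (motive := fun _ => RealState)
          (s.tick (e.cost s.idx + 1)) (fun t s' => c.run ω ((s'.tick 1).setIdx v t)) t
        change s' = c.run ω ((s₁.tick 1).setIdx v t) at hs'
        have hidx : ((s₁.tick 1).setIdx v t).idx 0 = s₁.idx 0 :=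
          Function.update_of_ne hv.symm _ _
        have hmem : ((s₁.tick 1).setIdx v t).mem a = s₁.mem a := rfl
        refine ⟨?_, ?_, ?_⟩
        · rw [hs', idx_run _ _ _ hc.zero_notMem, hidx, i1]
        · rw [hs', mem_run _ _ _ ha, hmem, i2]
        · have := h1 ω ((s₁.tick 1).setIdx v t) B hB (by rw [hidx, i1]; exact hs)
            (by rw [hmem, i2]; exact hm)
          rw [hs']
          refine this.trans ?_
          change s₁.steps + 1 + K * B ^ d ≤ _
          rw [add_mul]
          omega
    have h2 := (key ⌈e.eval s.mem s.idx⌉₊ _ rfl).2.2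
    simp only [run]
    refine h2.trans ?_
    have h3 : ⌈e.eval s.mem s.idx⌉₊ * (K * B ^ d + 1) ≤ B * (K * B ^ d + 1) :=
      Nat.mul_le_mul_right _ hn
    have h4 := hK₀ s.idx
    have h5 : B ≤ B ^ (d + 1) := by
      calc B = B ^ 1 := (pow_one B).symm
        _ ≤ _ := Nat.pow_le_pow_right hB (by omega)
    have h6 : B * (K * B ^ d + 1) = K * B ^ (d + 1) + B := by ring
    have h7 : (K₀ + 1) * 1 ≤ (K₀ + 1) * B ^ (d + 1) := Nat.mul_le_mul_left _ (hB.trans h5)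
    have h8 : (K₀ + 2 + K) * B ^ (d + 1) = (K₀ + 1) * B ^ (d + 1) + B ^ (d + 1) +
      K * B ^ (d + 1) := by ring
    omega

end

/-! ### The program -/

noncomputable section

section Program
open RealExpr NatExpr RealProg

/-- Stores `6 δ⁻¹ log N` in entry `(0, 0)` of array `3`. -/
def iterProg : RealProg :=
  .seq (.assign 3 (.lit 0) (.lit 0) (.log (.div (.read 1 (.lit 0) (.lit 0)) (.read 1 (.lit 0) (.lit 1)))))
  -- For `P = 1` the second logarithm stands for `+∞` and is left out of the minimum.
  (.seq (.ite (.read 1 (.lit 0) (.lit 0)) (.lit 1)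
      (.seq (.assign 3 (.lit 0) (.lit 1)
          (.log (.div (.sub (.lit 1) (.read 1 (.lit 0) (.lit 1)))
            (.sub (.lit 1) (.read 1 (.lit 0) (.lit 0))))))
        (.ite (.read 3 (.lit 0) (.lit 1)) (.read 3 (.lit 0) (.lit 0))
          (.assign 3 (.lit 0) (.lit 0) (.read 3 (.lit 0) (.lit 1))) .skip)) .skip)
    (.assign 3 (.lit 0) (.lit 0) (.mul (.mul (.lit 6) (.div (.lit 1) (.read 3 (.lit 0) (.lit 0))))
      (.log (.ofNat (.var 0))))))

/-- Fills the first `e` entries of the first `N` rows of array `a` with Gaussian samples. -/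
def fillProg (a : ℕ) (e : NatExpr) : RealProg :=
  .loop 2 (.ofNat (.var 0)) (.loop 3 (.ofNat e) (.gauss a (.var 2) (.var 3)))

/-- Stores the truncated target means in row `0` of array `5`. -/
def meanProg : RealProg :=
  .seq (.assign 6 (.lit 0) (.lit 0)
    (.mul (.lit 2) (.sqrt (.div (.ofNat (.var 0)) (.ofNat (.var 1))))))
  (.loop 2 (.ofNat (.var 0)) (.seq
    (.assign 5 (.lit 0) (.var 2) (.sqrt (.sum 5 (.div (.var 0) (.var 1))
      (.mul (.read 4 (.var 2) (.var 5)) (.read 4 (.var 2) (.var 5))))))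
    (.seq (.ite (.read 6 (.lit 0) (.lit 0)) (.read 5 (.lit 0) (.var 2))
        (.assign 5 (.lit 0) (.var 2) (.read 6 (.lit 0) (.lit 0))) .skip)
      (.assign 5 (.lit 0) (.var 2) (.mul (.mul (.mul (.lit (1 / 2)) (.read 1 (.lit 0) (.lit 2)))
        (.read 5 (.lit 0) (.var 2))) (.sqrt (.div (.ofNat (.var 1)) (.ofNat (.var 0)))))))))

/-- One iteration of the rejection kernel for entry `(i, j)`, the variables `2` and `3`. -/
def tryProg : RealProg :=
  .seq (.gauss 6 (.lit 0) (.lit 0)) (.seq (.unif 6 (.lit 0) (.lit 1)) (.seq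
    (.ite (.lit 0) (.read 0 (.var 2) (.var 3))
      (.seq (.assign 6 (.lit 0) (.lit 2)
          (.add (.read 6 (.lit 0) (.lit 0)) (.read 5 (.lit 0) (.var 3))))
        (.assign 6 (.lit 0) (.lit 3) (.div
          (.mul (.sub (.lit 1) (.read 1 (.lit 0) (.lit 0)))
            (.exp (.div (.mul (.read 6 (.lit 0) (.lit 2)) (.read 6 (.lit 0) (.lit 2))) (.lit (-2)))))
          (.mul (.sub (.lit 1) (.read 1 (.lit 0) (.lit 1)))
            (.exp (.div (.mul (.sub (.read 6 (.lit 0) (.lit 2)) (.read 5 (.lit 0) (.var 3)))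
              (.sub (.read 6 (.lit 0) (.lit 2)) (.read 5 (.lit 0) (.var 3)))) (.lit (-2))))))))
      (.seq (.assign 6 (.lit 0) (.lit 2) (.read 6 (.lit 0) (.lit 0)))
        (.assign 6 (.lit 0) (.lit 3) (.div
          (.mul (.read 1 (.lit 0) (.lit 1))
            (.exp (.div (.mul (.sub (.read 6 (.lit 0) (.lit 2)) (.read 5 (.lit 0) (.var 3)))
              (.sub (.read 6 (.lit 0) (.lit 2)) (.read 5 (.lit 0) (.var 3)))) (.lit (-2)))))
          (.mul (.read 1 (.lit 0) (.lit 0))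
            (.exp (.div (.mul (.read 6 (.lit 0) (.lit 2)) (.read 6 (.lit 0) (.lit 2)))
              (.lit (-2)))))))))
    -- A ratio above `1` means that the density comparison fails. An accepted value overwrites
    -- earlier ones, so the last acceptance survives.
    (.ite (.lit 1) (.read 6 (.lit 0) (.lit 3)) .skip
      (.ite (.read 6 (.lit 0) (.lit 1)) (.sub (.lit 1) (.read 6 (.lit 0) (.lit 3)))
        (.assign 7 (.var 2) (.var 3) (.read 6 (.lit 0) (.lit 2))) .skip))))

/-- Stores the outputs of the rejection kernels in array `7`. -/
def kernelProg : RealProg :=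
  .loop 2 (.ofNat (.var 0)) (.loop 3 (.ofNat (.var 0))
    (.seq (.assign 7 (.var 2) (.var 3) (.lit 0))
      (.loop 4 (.read 3 (.lit 0) (.lit 0)) tryProg)))

/-- Gram–Schmidt orthonormalization of the rows of array `8` into the columns of array `10`. -/
def gramSchmidtProg : RealProg :=
  .loop 2 (.ofNat (.var 0)) (.seq
    (.loop 3 (.ofNat (.var 0)) (.assign 9 (.lit 0) (.var 3)
      (.sub (.read 8 (.var 2) (.var 3)) (.sum 5 (.var 0) (.mul (.read 10 (.var 3) (.var 5))
        (.sum 6 (.var 0) (.mul (.read 10 (.var 6) (.var 5)) (.read 8 (.var 2) (.var 6)))))))))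
    (.loop 3 (.ofNat (.var 0)) (.assign 10 (.var 3) (.var 2)
      (.div (.read 9 (.lit 0) (.var 3)) (.sqrt (.sum 5 (.var 0)
        (.mul (.read 9 (.lit 0) (.var 5)) (.read 9 (.lit 0) (.var 5)))))))))

/-- Stores the product of arrays `7` and `10` in array `2`. -/
def productProg : RealProg :=
  .loop 3 (.ofNat (.var 0)) (.loop 4 (.ofNat (.var 0)) (.assign 2 (.var 3) (.var 4)
    (.sum 5 (.var 0) (.mul (.read 7 (.var 3) (.var 5)) (.read 10 (.var 5) (.var 4))))))

end Program

@[simp] theorem RealState.mem_tick (s : RealState) (n : ℕ) : (s.tick n).mem = s.mem := rfl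
@[simp] theorem RealState.idx_tick (s : RealState) (n : ℕ) : (s.tick n).idx = s.idx := rfl
@[simp] theorem RealState.drawn_tick (s : RealState) (n : ℕ) : (s.tick n).drawn = s.drawn := rfl
@[simp] theorem RealState.mem_draw (s : RealState) : s.draw.mem = s.mem := rfl
@[simp] theorem RealState.idx_draw (s : RealState) : s.draw.idx = s.idx := rfl
@[simp] theorem RealState.drawn_draw (s : RealState) : s.draw.drawn = s.drawn + 1 := rfl
@[simp] theorem RealState.idx_store (s : RealState) (a i j : ℕ) (x : ℝ) :
    (s.store a i j x).idx = s.idx := rfl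
@[simp] theorem RealState.drawn_store (s : RealState) (a i j : ℕ) (x : ℝ) :
    (s.store a i j x).drawn = s.drawn := rfl

/-! ### Correctness of the elementary subprograms -/

section Correctness
variable {ω : ℕ → ℝ × ℝ} {s : RealState} {N k : ℕ}

theorem run_iterProg {P Q : ℝ} (h0 : s.idx 0 = N) (hP : s.mem 1 0 0 = P) (hQ : s.mem 1 0 1 = Q)
    (hP1 : P ≤ 1) : (iterProg.run ω s).drawn = s.drawn ∧
      (iterProg.run ω s).mem 3 0 0 = 6 * (rkDelta P Q)⁻¹ * Real.log N := by
  rcases hP1.eq_or_lt with h | h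
  · have h' : ¬ P < 1 := by simp [h]
    simp [iterProg, RealProg.run, RealExpr.eval, NatExpr.eval, RealState.mem_store, hP, hQ, h0,
      rkDelta, h]
  · by_cases hlt : Real.log ((1 - Q) / (1 - P)) < Real.log (P / Q)
    · simp [iterProg, RealProg.run, RealExpr.eval, NatExpr.eval, RealState.mem_store, hP, hQ, h0,
        rkDelta, h, h.ne, hlt, min_eq_right hlt.le]
    · simp [iterProg, RealProg.run, RealExpr.eval, NatExpr.eval, RealState.mem_store, hP, hQ, h0,
        rkDelta, h, h.ne, hlt, min_eq_left (not_lt.1 hlt)]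

/-- The exact tape addresses are recorded because independence of the blocks is later deduced from
their disjointness. -/
theorem run_fillProg {a m : ℕ} {e : NatExpr} (h0 : s.idx 0 = N) (h1 : s.idx 1 = k)
    (he : ∀ x, x 0 = N → x 1 = k → e.eval x = m) :
    ((fillProg a e).run ω s).drawn = s.drawn + N * m ∧
      ∀ j < N, ∀ i < m, ((fillProg a e).run ω s).mem a j i = (ω (s.drawn + j * m + i)).1 := by
  refine RealProg.run_loop_spec (by simp [RealExpr.eval, NatExpr.eval, h0])
    (fun t mem => ∀ j < t, ∀ i < m, mem a j i = (ω (s.drawn + j * m + i)).1) (by simp) ?_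
  intro t _ s' hidx h2 _ hd hI
  have e0 : s'.idx 0 = N := (hidx 0 (by simp [RealProg.loopVars]) (by simp)).trans h0
  have e1 : s'.idx 1 = k := (hidx 1 (by simp [RealProg.loopVars]) (by simp)).trans h1
  have key := RealProg.run_loop_spec (ω := ω) (v := 3) (e := .ofNat e)
    (c := .gauss a (.var 2) (.var 3)) (s := s') (n := m) (D := 1)
    (by simp [RealExpr.eval, he _ e0 e1])
    (fun u mem => (∀ i < u, mem a t i = (ω (s'.drawn + i)).1) ∧
      ∀ j, j ≠ t → mem a j = s'.mem a j) (by simp) (by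
      intro u _ s'' hidx' h3 _ hd' ⟨hI1, hI2⟩
      have e2 : s''.idx 2 = t := (hidx' 2 (by simp [RealProg.loopVars]) (by simp)).trans h2
      refine ⟨by simp [RealProg.run], fun i hi => ?_, fun j hj => ?_⟩
      · simp only [RealProg.run, RealState.mem_draw, RealState.mem_tick, RealState.mem_store,
          NatExpr.eval, e2, h3, true_and, hd', mul_one]
        split_ifs with hc
        · rw [hc]
        · exact hI1 i (by omega)
      · funext i
        simp only [RealProg.run, RealState.mem_draw, RealState.mem_tick, RealState.mem_store,
          NatExpr.eval, e2, hj, false_and, and_false, if_false, hI2 j hj])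
  refine ⟨by rw [key.1, mul_one], fun j hj i hi => ?_⟩
  rcases Nat.lt_succ_iff_lt_or_eq.1 hj with h | h
  · rw [key.2.2 j h.ne, hI j h i hi]
  · rw [h, key.2.1 i hi, hd]

theorem run_meanProg {τ : ℝ} (h0 : s.idx 0 = N) (h1 : s.idx 1 = k) (hτ : s.mem 1 0 2 = τ) :
    (meanProg.run ω s).drawn = s.drawn ∧ ∀ j : Fin N, (meanProg.run ω s).mem 5 0 j =
      truncMean N k τ (rowNorms fun (j : Fin N) (i : Fin (N / k)) => s.mem 4 j i) j := by
  set r : ℕ → ℝ := fun j => √(∑ i : Fin (N / k), s.mem 4 j i ^ 2) with hr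
  obtain ⟨b, hb⟩ : ∃ b, 2 * √((N : ℝ) / k) = b := ⟨_, rfl⟩
  rw [meanProg, RealProg.run]
  set s₁ := RealProg.run ω (.assign 6 (.lit 0) (.lit 0)
    (.mul (.lit 2) (.sqrt (.div (.ofNat (.var 0)) (.ofNat (.var 1)))))) s with hs₁
  have a0 : s₁.idx = s.idx := rfl
  have am : ∀ a, a ≠ 6 → s₁.mem a = s.mem a := fun a ha =>
    RealProg.mem_run _ _ _ (by simpa [RealProg.arrays] using ha)
  have a6 : s₁.mem 6 0 0 = b := by
    simp [← hb, hs₁, RealProg.run, RealState.mem_store, NatExpr.eval, RealExpr.eval, h0, h1]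
  have key := RealProg.run_loop_spec (ω := ω) (v := 2) (e := .ofNat (.var 0)) (c := .seq
    (.assign 5 (.lit 0) (.var 2) (.sqrt (.sum 5 (.div (.var 0) (.var 1))
      (.mul (.read 4 (.var 2) (.var 5)) (.read 4 (.var 2) (.var 5))))))
    (.seq (.ite (.read 6 (.lit 0) (.lit 0)) (.read 5 (.lit 0) (.var 2))
        (.assign 5 (.lit 0) (.var 2) (.read 6 (.lit 0) (.lit 0))) .skip)
      (.assign 5 (.lit 0) (.var 2) (.mul (.mul (.mul (.lit (1 / 2)) (.read 1 (.lit 0) (.lit 2)))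
        (.read 5 (.lit 0) (.var 2))) (.sqrt (.div (.ofNat (.var 1)) (.ofNat (.var 0))))))))
    (s := s₁) (n := N) (D := 0) (by simp [RealExpr.eval, NatExpr.eval, a0, h0])
    (fun t mem => ∀ j < t, mem 5 0 j = 1 / 2 * τ * min (r j) b * √((k : ℝ) / N))
    (by simp) (by
      intro t _ s' hidx h2 hm hd hI
      have e0 : s'.idx 0 = N := (hidx 0 (by simp [RealProg.loopVars]) (by simp)).trans h0
      have e1 : s'.idx 1 = k := (hidx 1 (by simp [RealProg.loopVars]) (by simp)).trans h1
      have e4 : s'.mem 4 = s.mem 4 := (hm 4 (by simp [RealProg.arrays])).trans (am 4 (by simp))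
      have e6 : s'.mem 6 = s₁.mem 6 := hm 6 (by simp [RealProg.arrays])
      have e7 : s'.mem 1 = s.mem 1 := (hm 1 (by simp [RealProg.arrays])).trans (am 1 (by simp))
      have hsum : √(∑ i ∈ Finset.range (N / k), s.mem 4 t i * s.mem 4 t i) = r t := by
        rw [hr, Finset.sum_range]; simp only [← pow_two]
      by_cases hlt : b < r t
      · refine ⟨?_, fun j hj => ?_⟩
        · simp [RealProg.run, RealState.mem_store, NatExpr.eval, RealExpr.eval, h2, e0, e1, e4, e6,
            e7, a6, hsum, hlt, hτ]
        · rcases Nat.lt_succ_iff_lt_or_eq.1 hj with h | h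
          · simp [RealProg.run, RealState.mem_store, NatExpr.eval, RealExpr.eval, h2, e0, e1, e4, e6,
              e7, a6, hsum, hlt, hτ, h.ne, hI j h]
          · simp [RealProg.run, RealState.mem_store, NatExpr.eval, RealExpr.eval, h2, e0, e1, e4, e6,
              e7, a6, hsum, hlt, hτ, h, min_eq_right hlt.le]
      · refine ⟨?_, fun j hj => ?_⟩
        · simp [RealProg.run, RealState.mem_store, NatExpr.eval, RealExpr.eval, h2, e0, e1, e4, e6,
            e7, a6, hsum, hlt, hτ]
        · rcases Nat.lt_succ_iff_lt_or_eq.1 hj with h | h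
          · simp [RealProg.run, RealState.mem_store, NatExpr.eval, RealExpr.eval, h2, e0, e1, e4, e6,
              e7, a6, hsum, hlt, hτ, h.ne, hI j h]
          · simp [RealProg.run, RealState.mem_store, NatExpr.eval, RealExpr.eval, h2, e0, e1, e4, e6,
              e7, a6, hsum, hlt, hτ, h, min_eq_left (not_lt.1 hlt)])
  exact ⟨key.1, fun j => (key.2 j j.2).trans (by rw [← hb]; rfl)⟩

theorem run_productProg (h0 : s.idx 0 = N) (i j : Fin N) :
    (productProg.run ω s).mem 2 i j = ∑ l : Fin N, s.mem 7 i l * s.mem 10 l j := by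
  refine (RealProg.run_loop_spec (D := 0) (by simp [RealExpr.eval, NatExpr.eval, h0])
    (fun t mem => ∀ i < t, ∀ j < N, mem 2 i j = ∑ l : Fin N, s.mem 7 i l * s.mem 10 l j)
    (by simp) ?_).2 i i.2 j j.2
  intro t _ s' hidx h2 hm _ hI
  have e0 : s'.idx 0 = N := (hidx 0 (by simp [RealProg.loopVars]) (by simp)).trans h0
  have key := RealProg.run_loop_spec (ω := ω) (v := 4) (e := .ofNat (.var 0))
    (c := .assign 2 (.var 3) (.var 4)
      (.sum 5 (.var 0) (.mul (.read 7 (.var 3) (.var 5)) (.read 10 (.var 5) (.var 4)))))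
    (s := s') (n := N) (D := 0) (by simp [RealExpr.eval, NatExpr.eval, e0])
    (fun u mem => (∀ j < u, mem 2 t j = ∑ l : Fin N, s.mem 7 t l * s.mem 10 l j) ∧
      ∀ i, i ≠ t → mem 2 i = s'.mem 2 i) (by simp) (by
      intro u _ s'' hidx' h3 hm' _ ⟨hI1, hI2⟩
      have e2 : s''.idx 3 = t := (hidx' 3 (by simp [RealProg.loopVars]) (by simp)).trans h2
      have e0' : s''.idx 0 = N := (hidx' 0 (by simp [RealProg.loopVars]) (by simp)).trans e0
      have e7 : s''.mem 7 = s.mem 7 :=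
        (hm' 7 (by simp [RealProg.arrays])).trans (hm 7 (by simp [RealProg.arrays]))
      have e10 : s''.mem 10 = s.mem 10 :=
        (hm' 10 (by simp [RealProg.arrays])).trans (hm 10 (by simp [RealProg.arrays]))
      refine ⟨by simp [RealProg.run], fun i hi => ?_, fun j hj => ?_⟩
      · simp only [RealProg.run, RealState.mem_tick, RealState.mem_store,
          NatExpr.eval, RealExpr.eval, e2, h3, true_and, e0', e7, e10]
        split_ifs with hc
        · rw [hc, Finset.sum_range]
          simp [e2, h3]
        · exact hI1 i (by omega)
      · funext i
        simp only [RealProg.run, RealState.mem_tick, RealState.mem_store,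
          NatExpr.eval, e2, hj, false_and, and_false, if_false, hI2 j hj])
  refine ⟨key.1.trans (by simp), fun j hj i hi => ?_⟩
  rcases Nat.lt_succ_iff_lt_or_eq.1 hj with h | h
  · rw [key.2.2 j h.ne, hI j h i hi]
  · rw [h, key.2.1 i hi]

end Correctness
end

/-! ### Correctness of the rejection loops, of Gram–Schmidt and of the whole program -/

noncomputable section

open Matrix

theorem gaussianPDFReal_eq_exp (μ x : ℝ) :
    gaussianPDFReal μ 1 x = (√(2 * Real.pi))⁻¹ * Real.exp ((x - μ) * (x - μ) / (-2)) := by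
  simp only [gaussianPDFReal, NNReal.coe_one, mul_one]
  congr 2
  ring

/-- The Gaussian normalizing constants cancel, so the machine needs only `exp`. -/
theorem rkRatio_true_eq (p q μ x : ℝ) : rkRatio p q μ true x =
    (1 - p) * Real.exp (x * x / (-2)) / ((1 - q) * Real.exp ((x - μ) * (x - μ) / (-2))) := by
  have h : (√(2 * Real.pi))⁻¹ ≠ 0 := by positivity
  simp only [rkRatio, if_true, gaussianPDFReal_eq_exp, sub_zero]
  rw [mul_left_comm, mul_left_comm (1 - q), mul_div_mul_left _ _ h]

theorem rkRatio_false_eq (p q μ x : ℝ) : rkRatio p q μ false x =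
    q * Real.exp ((x - μ) * (x - μ) / (-2)) / (p * Real.exp (x * x / (-2))) := by
  have h : (√(2 * Real.pi))⁻¹ ≠ 0 := by positivity
  simp only [rkRatio, Bool.false_eq_true, if_false, gaussianPDFReal_eq_exp, sub_zero]
  rw [mul_left_comm, mul_left_comm p, mul_div_mul_left _ _ h]

/-- The denominators are positive, so comparing the densities amounts to testing whether the ratio
exceeds `1`, which is the test in `tryProg`. -/
theorem rkAccept_iff {p q μ : ℝ} (hp : 0 < p) (hq : q < 1) (b : Bool) (z u : ℝ) :
    rkAccept p q μ b z u ↔ ¬ 1 < rkRatio p q μ b (rkProposal μ b z) ∧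
      u < 1 - rkRatio p q μ b (rkProposal μ b z) := by
  unfold rkAccept
  refine and_congr_left fun _ => ?_
  rw [not_lt]
  cases b
  · simp only [Bool.false_eq_true, if_false, rkRatio, rkProposal, ge_iff_le]
    rw [div_le_one (mul_pos hp (gaussianPDFReal_pos _ _ _ one_ne_zero))]
  · simp only [if_true, rkRatio, rkProposal, ge_iff_le]
    rw [div_le_one (mul_pos (sub_pos.2 hq) (gaussianPDFReal_pos _ _ _ one_ne_zero))]

section Correctness
variable {ω : ℕ → ℝ × ℝ} {s : RealState} {N k : ℕ}

open Classical in
theorem run_tryProg {P Q μ : ℝ} {i j : ℕ} {b : Bool} (hPpos : 0 < P) (hQ1 : Q < 1)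
    (h2 : s.idx 2 = i) (h3 : s.idx 3 = j) (hP : s.mem 1 0 0 = P) (hQ : s.mem 1 0 1 = Q)
    (hμ : s.mem 5 0 j = μ) (hb : 0 < s.mem 0 i j ↔ b = true) :
    (tryProg.run ω s).drawn = s.drawn + 2 ∧ ∀ i' j', (tryProg.run ω s).mem 7 i' j' =
      if (i' = i ∧ j' = j) ∧ rkAccept P Q μ b (ω s.drawn).1 (ω (s.drawn + 1)).2 then
        rkProposal μ b (ω s.drawn).1 else s.mem 7 i' j' := by
  simp only [rkAccept_iff hPpos hQ1]
  cases b
  · simp only [Bool.false_eq_true, iff_false] at hb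
    by_cases c1 : 1 < rkRatio P Q μ false (rkProposal μ false (ω s.drawn).1) <;>
    by_cases c2 : (ω (s.drawn + 1)).2 < 1 - rkRatio P Q μ false (rkProposal μ false (ω s.drawn).1) <;>
    simp only [rkRatio_false_eq, rkProposal, Bool.false_eq_true, if_false] at c1 c2 ⊢ <;>
    simp [tryProg, RealProg.run, RealState.mem_store, NatExpr.eval, RealExpr.eval, h2, h3, hP, hQ,
      hμ, hb, c1, c2]
  · simp only [iff_true] at hb
    by_cases c1 : 1 < rkRatio P Q μ true (rkProposal μ true (ω s.drawn).1) <;>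
    by_cases c2 : (ω (s.drawn + 1)).2 < 1 - rkRatio P Q μ true (rkProposal μ true (ω s.drawn).1) <;>
    simp only [rkRatio_true_eq, rkProposal, if_true, add_sub_cancel_right] at c1 c2 ⊢ <;>
    simp [tryProg, RealProg.run, RealState.mem_store, NatExpr.eval, RealExpr.eval, h2, h3, hP, hQ,
      hμ, hb, c1, c2]

/-- The noise of a rejection kernel whose samples start at position `a` of the tape; the last
accepted value is the one kept by the program, so the order is reversed. -/
def tapeNoise (ω : ℕ → ℝ × ℝ) (a n : ℕ) (l : Fin n) : ℝ × ℝ :=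
  ((ω (a + (n - 1 - l) * 2)).1, (ω (a + (n - 1 - l) * 2 + 1)).2)

/-- Because `tapeNoise` lists trials backwards, running one more trial prepends it to the list. The
last accepted trial on the tape is thus the first accepted one for `rkRun`. -/
theorem rkRun_tapeNoise_succ (p q μ : ℝ) (b : Bool) (ω : ℕ → ℝ × ℝ) (a n : ℕ)
    [Decidable (rkAccept p q μ b (ω (a + n * 2)).1 (ω (a + n * 2 + 1)).2)] :
    rkRun p q μ b (n + 1) (tapeNoise ω a (n + 1)) =
      if rkAccept p q μ b (ω (a + n * 2)).1 (ω (a + n * 2 + 1)).2 then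
        rkProposal μ b (ω (a + n * 2)).1 else rkRun p q μ b n (tapeNoise ω a n) := by
  have h0 : tapeNoise ω a (n + 1) 0 = ((ω (a + n * 2)).1, (ω (a + n * 2 + 1)).2) := by
    simp [tapeNoise]
  have ht : Fin.tail (tapeNoise ω a (n + 1)) = tapeNoise ω a n := by
    funext l
    have : n + 1 - 1 - (l.1 + 1) = n - 1 - l.1 := by omega
    simp only [Fin.tail, tapeNoise, Fin.val_succ, this]
  rw [rkRun_succ, h0, ht]
  split_ifs <;> rfl

/-- Every trial draws exactly two samples, accepted or not, so the trials of entry `(i, j)` begin at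
an address independent of the outcomes. -/
theorem run_kernelProg {P Q : ℝ} {n : ℕ} {b : ℕ → ℕ → Bool} (hPpos : 0 < P) (hQ1 : Q < 1)
    (h0 : s.idx 0 = N) (hn : ⌈s.mem 3 0 0⌉₊ = n) (hP : s.mem 1 0 0 = P) (hQ : s.mem 1 0 1 = Q)
    (hb : ∀ i < N, ∀ j < N, 0 < s.mem 0 i j ↔ b i j = true) :
    (kernelProg.run ω s).drawn = s.drawn + N * (N * (n * 2)) ∧ ∀ i < N, ∀ j < N,
      (kernelProg.run ω s).mem 7 i j = rkRun P Q (s.mem 5 0 j) (b i j) n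
        (tapeNoise ω (s.drawn + i * (N * (n * 2)) + j * (n * 2)) n) := by
  classical
  refine RealProg.run_loop_spec (by simp [RealExpr.eval, NatExpr.eval, h0])
    (fun t mem => ∀ i < t, ∀ j < N, mem 7 i j = rkRun P Q (s.mem 5 0 j) (b i j) n
        (tapeNoise ω (s.drawn + i * (N * (n * 2)) + j * (n * 2)) n)) (by simp) ?_
  intro i hiN s₁ hidx₁ h2 hm₁ hd₁ hI
  have e0 : s₁.idx 0 = N :=
    (hidx₁ 0 (by simp [RealProg.loopVars, tryProg]) (by simp)).trans h0
  have key := RealProg.run_loop_spec (ω := ω) (v := 3) (e := .ofNat (.var 0))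
    (c := .seq (.assign 7 (.var 2) (.var 3) (.lit 0))
      (.loop 4 (.read 3 (.lit 0) (.lit 0)) tryProg)) (s := s₁) (n := N) (D := n * 2)
    (by simp [RealExpr.eval, NatExpr.eval, e0])
    (fun t mem => (∀ j < t, mem 7 i j = rkRun P Q (s.mem 5 0 j) (b i j) n
      (tapeNoise ω (s₁.drawn + j * (n * 2)) n)) ∧ ∀ i', i' ≠ i → mem 7 i' = s₁.mem 7 i')
    (by simp) (by
      intro j hjN s₂ hidx₂ h3 hm₂ hd₂ ⟨hI1, hI2⟩
      have f2 : s₂.idx 2 = i :=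
        (hidx₂ 2 (by simp [RealProg.loopVars, tryProg]) (by simp)).trans h2
      have fm : ∀ a, a ≠ 7 → a ≠ 6 → s₂.mem a = s.mem a := fun a h7 h6 =>
        (hm₂ a (by simp [RealProg.arrays, tryProg, h7, h6])).trans
          (hm₁ a (by simp [RealProg.arrays, tryProg, h7, h6]))
      rw [RealProg.run]
      set s₃ := RealProg.run ω (.assign 7 (.var 2) (.var 3) (.lit 0)) s₂ with hs₃
      have g2 : s₃.idx 2 = i := f2
      have g3 : s₃.idx 3 = j := h3
      have gd : s₃.drawn = s₂.drawn := rfl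
      have gm : ∀ a, a ≠ 7 → a ≠ 6 → s₃.mem a = s.mem a := fun a h7 h6 =>
        (RealProg.mem_run _ _ _ (by simpa [RealProg.arrays] using h7)).trans (fm a h7 h6)
      have g7 : ∀ i' j', s₃.mem 7 i' j' = if i' = i ∧ j' = j then 0 else s₂.mem 7 i' j' := by
        intro i' j'
        simp [hs₃, RealProg.run, RealState.mem_store, NatExpr.eval, RealExpr.eval, f2, h3]
      have key := RealProg.run_loop_spec (ω := ω) (v := 4) (e := .read 3 (.lit 0) (.lit 0))
        (c := tryProg) (s := s₃) (n := n) (D := 2)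
        (by simpa [RealExpr.eval, NatExpr.eval, gm 3 (by simp) (by simp)] using hn)
        (fun t mem => mem 7 i j = rkRun P Q (s.mem 5 0 j) (b i j) t (tapeNoise ω s₂.drawn t) ∧
          ∀ i' j', ¬ (i' = i ∧ j' = j) → mem 7 i' j' = s₂.mem 7 i' j')
        ⟨by simp [g7, rkRun], fun i' j' h => by simp [g7, h]⟩ (by
          intro t _ s₄ hidx₄ _ hm₄ hd₄ ⟨hJ1, hJ2⟩
          have km : ∀ a, a ≠ 7 → a ≠ 6 → s₄.mem a = s.mem a := fun a h7 h6 =>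
            (hm₄ a (by simp [RealProg.arrays, tryProg, h7, h6])).trans (gm a h7 h6)
          have ht := run_tryProg (ω := ω) (s := s₄) (μ := s.mem 5 0 j) (b := b i j) hPpos hQ1
            ((hidx₄ 2 (by simp [RealProg.loopVars, tryProg]) (by simp)).trans g2)
            ((hidx₄ 3 (by simp [RealProg.loopVars, tryProg]) (by simp)).trans g3)
            (by rw [km 1 (by simp) (by simp), hP]) (by rw [km 1 (by simp) (by simp), hQ])
            (by rw [km 5 (by simp) (by simp)])
            (by rw [km 0 (by simp) (by simp)]; exact hb i hiN j hjN)
          refine ⟨ht.1, ?_, fun i' j' h => ?_⟩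
          · rw [ht.2, rkRun_tapeNoise_succ, hJ1, hd₄, gd]
            simp only [and_self, true_and]
          · rw [ht.2, if_neg fun h' => h h'.1, hJ2 i' j' h])
      refine ⟨by rw [key.1, gd], fun j' hj' => ?_, fun i' hi' => ?_⟩
      · rcases Nat.lt_succ_iff_lt_or_eq.1 hj' with h | h
        · rw [key.2.2 i j' (fun h' => h.ne h'.2), hI1 j' h]
        · rw [h, key.2.1, hd₂]
      · funext j'
        rw [key.2.2 i' j' (fun h' => hi' h'.1), hI2 i' hi'])
  refine ⟨key.1, fun i' hi' j hj => ?_⟩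
  rcases Nat.lt_succ_iff_lt_or_eq.1 hi' with h | h
  · rw [key.2.2 i' h.ne, hI i' h j hj]
  · rw [h, key.2.1 j hj, hd₁]

theorem gsResidual_apply {N : ℕ} (R : Matrix (Fin N) (Fin N) ℝ) (g : Fin N → ℝ) (i : Fin N) :
    gsResidual R g i = g i - ∑ l, R i l * ∑ a, R a l * g a := by
  simp only [gsResidual, mulVec, dotProduct, Pi.sub_apply, transpose_apply]

/-- The sums run over all `N` columns, as in `gsMat`: columns not yet produced are still zero. Array
`9` holds the residual while the new column of array `10` is being written. -/
theorem run_gramSchmidtProg (h0 : s.idx 0 = N) (h10 : ∀ i j : Fin N, s.mem 10 i j = 0)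
    (i j : Fin N) : (gramSchmidtProg.run ω s).mem 10 i j =
      gsMat (fun (t i : Fin N) => s.mem 8 t i) N i j := by
  set G : Fin N → Fin N → ℝ := fun t i => s.mem 8 t i with hG
  refine (RealProg.run_loop_spec (D := 0) (by simp [RealExpr.eval, NatExpr.eval, h0])
    (fun t mem => ∀ i j : Fin N, mem 10 i j = gsMat G t i j) (fun i j => by simp [h10, gsMat])
    ?_).2 i j
  intro t ht s₁ hidx₁ h2 hm₁ _ hI
  have e0 : s₁.idx 0 = N := (hidx₁ 0 (by simp [RealProg.loopVars]) (by simp)).trans h0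
  have e8 : s₁.mem 8 = s.mem 8 := hm₁ 8 (by simp [RealProg.arrays])
  set r := gsResidual (gsMat G t) (G ⟨t, ht⟩) with hr
  rw [RealProg.run]
  have key := RealProg.run_loop_spec (ω := ω) (v := 3) (e := .ofNat (.var 0))
    (c := .assign 9 (.lit 0) (.var 3)
      (.sub (.read 8 (.var 2) (.var 3)) (.sum 5 (.var 0) (.mul (.read 10 (.var 3) (.var 5))
        (.sum 6 (.var 0) (.mul (.read 10 (.var 6) (.var 5)) (.read 8 (.var 2) (.var 6))))))))
    (s := s₁) (n := N) (D := 0) (by simp [RealExpr.eval, NatExpr.eval, e0])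
    (fun u mem => ∀ i : Fin N, i.1 < u → mem 9 0 i = r i) (by simp) (by
      intro u hu s₂ hidx₂ h3 hm₂ _ hI1
      have f2 : s₂.idx 2 = t := (hidx₂ 2 (by simp [RealProg.loopVars]) (by simp)).trans h2
      have f0 : s₂.idx 0 = N := (hidx₂ 0 (by simp [RealProg.loopVars]) (by simp)).trans e0
      have f8 : s₂.mem 8 = s.mem 8 := (hm₂ 8 (by simp [RealProg.arrays])).trans e8
      have f10 : s₂.mem 10 = s₁.mem 10 := hm₂ 10 (by simp [RealProg.arrays])
      refine ⟨by simp [RealProg.run], fun i hi => ?_⟩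
      rcases Nat.lt_succ_iff_lt_or_eq.1 hi with h | h
      · simp [RealProg.run, RealState.mem_store, NatExpr.eval, h3, h.ne, hI1 i h]
      · have hu' : u = i := h.symm
        simp [RealProg.run, RealState.mem_store, NatExpr.eval, RealExpr.eval, h3, hu', f2, f0, f8,
          f10, Finset.sum_range, hI, hr, gsResidual_apply, hG])
  set s₃ := RealProg.run ω (.loop 3 (.ofNat (.var 0)) (.assign 9 (.lit 0) (.var 3)
      (.sub (.read 8 (.var 2) (.var 3)) (.sum 5 (.var 0) (.mul (.read 10 (.var 3) (.var 5))
        (.sum 6 (.var 0) (.mul (.read 10 (.var 6) (.var 5)) (.read 8 (.var 2) (.var 6))))))))) s₁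
    with hs₃
  have g0 : s₃.idx 0 = N :=
    (RealProg.idx_run _ _ _ (by simp [RealProg.loopVars])).trans e0
  have g2 : s₃.idx 2 = t :=
    (RealProg.idx_run _ _ _ (by simp [RealProg.loopVars])).trans h2
  have g10 : s₃.mem 10 = s₁.mem 10 := RealProg.mem_run _ _ _ (by simp [RealProg.arrays])
  have key' := RealProg.run_loop_spec (ω := ω) (v := 3) (e := .ofNat (.var 0))
    (c := .assign 10 (.var 3) (.var 2) (.div (.read 9 (.lit 0) (.var 3)) (.sqrt (.sum 5 (.var 0)
        (.mul (.read 9 (.lit 0) (.var 5)) (.read 9 (.lit 0) (.var 5)))))))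
    (s := s₃) (n := N) (D := 0) (by simp [RealExpr.eval, NatExpr.eval, g0])
    (fun u mem => ∀ i j : Fin N, mem 10 i j =
      if i.1 < u ∧ j.1 = t then r i / √(∑ a, r a ^ 2) else gsMat G t i j)
    (by simp [g10, hI]) (by
      intro u hu s₄ hidx₄ h3 hm₄ _ hI1
      have f2 : s₄.idx 2 = t := (hidx₄ 2 (by simp [RealProg.loopVars]) (by simp)).trans g2
      have f0 : s₄.idx 0 = N := (hidx₄ 0 (by simp [RealProg.loopVars]) (by simp)).trans g0
      have f9 : s₄.mem 9 = s₃.mem 9 := hm₄ 9 (by simp [RealProg.arrays])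
      have hr9 : ∀ i : Fin N, s₃.mem 9 0 i = r i := fun i => key.2 i i.2
      refine ⟨by simp [RealProg.run], fun i j => ?_⟩
      by_cases hj : j.1 = t
      · by_cases hi : i.1 = u
        · have hu' : u = i := hi.symm
          simp [RealProg.run, RealState.mem_store, NatExpr.eval, RealExpr.eval, h3, hu', hj, f2, f0,
            f9, hr9, Finset.sum_range, ← pow_two]
        · have hiff : i.1 < u + 1 ↔ i.1 < u := by omega
          simp [RealProg.run, RealState.mem_store, NatExpr.eval, h3, hi, hiff, hI1]
      · simp [RealProg.run, RealState.mem_store, NatExpr.eval, hj, f2, hI1])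
  refine ⟨by rw [key'.1, key.1]; simp, fun i j => ?_⟩
  rw [key'.2 i j, gsMat_succ _ ht, updateCol_apply]
  simp [Fin.ext_iff, hr]

/-- The program `χ²`-Random-Rotation. -/
def chiSqProg : RealProg :=
  .seq (fillProg 4 (.div (.var 0) (.var 1))) (.seq meanProg (.seq kernelProg
    (.seq (fillProg 8 (.var 0)) (.seq gramSchmidtProg productProg))))

/-- The output as an explicit function of the tape: Gaussian rows for the radii, then the trials,
then the Gaussian matrix for Gram–Schmidt, in consecutive blocks. -/
theorem run_chiSqProg {P Q τ : ℝ} {M : Fin N → Fin N → Bool} (hPpos : 0 < P) (hP1 : P ≤ 1)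
    (hQ1 : Q < 1) (i j : Fin N) :
    ((RealProg.seq iterProg chiSqProg).run ω (inputState N k P Q τ M)).mem 2 i j =
      ∑ l, rkMatrix N k P Q τ (rowNorms fun (j : Fin N) (i : Fin (N / k)) =>
          (ω (j * (N / k) + i)).1) M (fun i j => tapeNoise ω (N * (N / k) +
            i * (N * (rkIter N P Q * 2)) + j * (rkIter N P Q * 2)) (rkIter N P Q)) i l *
        gsMat (fun (t i : Fin N) => (ω (N * (N / k) + N * (N * (rkIter N P Q * 2)) +
          t * N + i)).1) N l j := by
  set s₀ := inputState N k P Q τ M with hs₀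
  have m1 : ∀ j, s₀.mem 1 0 j = if j = 0 then P else if j = 1 then Q else if j = 2 then τ else 0 :=
    fun j => by simp [hs₀, inputState]
  have m0 : ∀ i j : Fin N, 0 < s₀.mem 0 i j ↔ M i j = true := fun i j => by
    cases h : M i j <;> simp [hs₀, inputState, h]
  have m10 : ∀ i j, s₀.mem 10 i j = 0 := fun i j => by simp [hs₀, inputState]
  have i0 : s₀.idx 0 = N := by simp [hs₀, inputState]
  have i1 : s₀.idx 1 = k := by simp [hs₀, inputState]
  have hiter := run_iterProg (ω := ω) i0 (m1 0) (m1 1) (by simpa using hP1)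
  simp only [if_true, one_ne_zero, if_false] at hiter
  simp only [chiSqProg, RealProg.run]
  set s₁ := iterProg.run ω s₀ with hs₁
  set s₂ := (fillProg 4 (.div (.var 0) (.var 1))).run ω s₁ with hs₂
  set s₃ := meanProg.run ω s₂ with hs₃
  set s₄ := kernelProg.run ω s₃ with hs₄
  set s₅ := (fillProg 8 (.var 0)).run ω s₄ with hs₅
  set s₆ := gramSchmidtProg.run ω s₅ with hs₆
  have v1 : ∀ u < 2, s₁.idx u = s₀.idx u := fun u hu =>
    RealProg.idx_run _ _ _ (by simp [iterProg, RealProg.loopVars])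
  have v2 : ∀ u < 2, s₂.idx u = s₀.idx u := fun u hu => (RealProg.idx_run _ _ _ (by
    simp [fillProg, RealProg.loopVars]; omega)).trans (v1 u hu)
  have v3 : ∀ u < 2, s₃.idx u = s₀.idx u := fun u hu => (RealProg.idx_run _ _ _ (by
    simp [meanProg, RealProg.loopVars]; omega)).trans (v2 u hu)
  have v4 : ∀ u < 2, s₄.idx u = s₀.idx u := fun u hu => (RealProg.idx_run _ _ _ (by
    simp [kernelProg, tryProg, RealProg.loopVars]; omega)).trans (v3 u hu)
  have v5 : ∀ u < 2, s₅.idx u = s₀.idx u := fun u hu => (RealProg.idx_run _ _ _ (by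
    simp [fillProg, RealProg.loopVars]; omega)).trans (v4 u hu)
  have v6 : ∀ u < 2, s₆.idx u = s₀.idx u := fun u hu => (RealProg.idx_run _ _ _ (by
    simp [gramSchmidtProg, RealProg.loopVars]; omega)).trans (v5 u hu)
  have a1 : ∀ a, a ≠ 3 → s₁.mem a = s₀.mem a := fun a ha =>
    RealProg.mem_run _ _ _ (by simpa [iterProg, RealProg.arrays] using ha)
  have a2 : ∀ a, a ≠ 4 → s₂.mem a = s₁.mem a := fun a ha =>
    RealProg.mem_run _ _ _ (by simpa [fillProg, RealProg.arrays] using ha)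
  have a3 : ∀ a, a ≠ 5 → a ≠ 6 → s₃.mem a = s₂.mem a := fun a ha hb =>
    RealProg.mem_run _ _ _ (by simp [meanProg, RealProg.arrays, ha, hb])
  have a4 : ∀ a, a ≠ 6 → a ≠ 7 → s₄.mem a = s₃.mem a := fun a ha hb =>
    RealProg.mem_run _ _ _ (by simp [kernelProg, tryProg, RealProg.arrays, ha, hb])
  have a5 : ∀ a, a ≠ 8 → s₅.mem a = s₄.mem a := fun a ha =>
    RealProg.mem_run _ _ _ (by simpa [fillProg, RealProg.arrays] using ha)
  have a6 : ∀ a, a ≠ 9 → a ≠ 10 → s₆.mem a = s₅.mem a := fun a ha hb =>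
    RealProg.mem_run _ _ _ (by simp [gramSchmidtProg, RealProg.arrays, ha, hb])
  have hfill := run_fillProg (ω := ω) (s := s₁) (a := 4) (e := .div (.var 0) (.var 1)) (N := N)
    (k := k) (m := N / k) (by rw [v1 0 (by simp), i0]) (by rw [v1 1 (by simp), i1])
    (fun x h0 h1 => by simp [NatExpr.eval, h0, h1])
  have hmean := run_meanProg (ω := ω) (s := s₂) (N := N) (k := k) (τ := τ)
    (by rw [v2 0 (by simp), i0]) (by rw [v2 1 (by simp), i1])
    (by rw [a2 1 (by simp), a1 1 (by simp), m1]; simp)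
  have hker := run_kernelProg (ω := ω) (s := s₃) (N := N) (P := P) (Q := Q) (n := rkIter N P Q)
    (b := fun i j => if h : i < N ∧ j < N then M ⟨i, h.1⟩ ⟨j, h.2⟩ else false) hPpos hQ1
    (by rw [v3 0 (by simp), i0])
    (by rw [a3 3 (by simp) (by simp), a2 3 (by simp), hiter.2, rkIter])
    (by rw [a3 1 (by simp) (by simp), a2 1 (by simp), a1 1 (by simp), m1]; simp)
    (by rw [a3 1 (by simp) (by simp), a2 1 (by simp), a1 1 (by simp), m1]; simp)
    (fun i hi j hj => by
      rw [a3 0 (by simp) (by simp), a2 0 (by simp), a1 0 (by simp), dif_pos ⟨hi, hj⟩]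
      exact m0 ⟨i, hi⟩ ⟨j, hj⟩)
  have hfill' := run_fillProg (ω := ω) (s := s₄) (a := 8) (e := .var 0) (N := N)
    (k := k) (m := N) (by rw [v4 0 (by simp), i0]) (by rw [v4 1 (by simp), i1])
    (fun x h0 _ => h0)
  have hgs := run_gramSchmidtProg (ω := ω) (s := s₅) (N := N) (by rw [v5 0 (by simp), i0])
    (fun i j => by rw [a5 10 (by simp), a4 10 (by simp) (by simp), a3 10 (by simp) (by simp),
      a2 10 (by simp), a1 10 (by simp), m10])
  have d1 : s₁.drawn = 0 := hiter.1
  have d2 : s₂.drawn = N * (N / k) := by rw [hfill.1, d1, zero_add]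
  have d3 : s₃.drawn = N * (N / k) := hmean.1.trans d2
  have d4 : s₄.drawn = N * (N / k) + N * (N * (rkIter N P Q * 2)) := by rw [hker.1, d3]
  rw [run_productProg (N := N) (by rw [v6 0 (by simp), i0])]
  refine Finset.sum_congr rfl fun l _ => ?_
  congr 1
  · rw [a6 7 (by simp) (by simp), a5 7 (by simp), hker.2 i i.2 l l.2, hmean.2 l, d3,
      dif_pos ⟨i.2, l.2⟩, rkMatrix]
    have hg : (fun (j : Fin N) (i : Fin (N / k)) => s₂.mem 4 j i) =
        fun (j : Fin N) (i : Fin (N / k)) => (ω (j * (N / k) + i)).1 := by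
      funext j i
      rw [hfill.2 j j.2 i i.2, d1, zero_add]
    rw [hg]
  · have hG : (fun t i : Fin N => s₅.mem 8 t i) = fun t i : Fin N =>
        (ω (N * (N / k) + N * (N * (rkIter N P Q * 2)) + t * N + i)).1 := by
      funext t i
      rw [hfill'.2 t t.2 i i.2, d4]
    rw [hgs, hG]

theorem smallLoops_chiSqProg : chiSqProg.SmallLoops 3 := by
  simp [chiSqProg, fillProg, meanProg, kernelProg, tryProg, gramSchmidtProg, productProg,
    RealProg.SmallLoops, RealExpr.SmallSums, NatExpr.eval, Nat.div_le_self]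

/-- `iterProg` is treated apart because it writes the loop bound in array `3`, which must stay fixed
while the rest is counted. -/
theorem exists_steps_chiSqProg : ∃ K d : ℕ, ∀ (ω : ℕ → ℝ × ℝ) (N k : ℕ) (P Q τ : ℝ)
    (M : Fin N → Fin N → Bool), 1 ≤ N → P ≤ 1 →
    (RealProg.seq iterProg chiSqProg).time N k P Q τ M ω ≤ K * (N + rkIter N P Q) ^ d := by
  obtain ⟨K, d, h⟩ := RealProg.exists_steps_le 3 chiSqProg smallLoops_chiSqProg (by
    simp [chiSqProg, fillProg, meanProg, kernelProg, tryProg, gramSchmidtProg, productProg,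
      RealProg.arrays])
  -- `iterProg` has no loops, so any array it does not write will do; array `11` is zero initially.
  obtain ⟨K', d', h'⟩ := RealProg.exists_steps_le 11 iterProg (by
    simp [iterProg, RealProg.SmallLoops, RealExpr.SmallSums]) (by simp [iterProg, RealProg.arrays])
  refine ⟨K + K', d + d', fun ω N k P Q τ M hN hP1 => ?_⟩
  set s₀ := inputState N k P Q τ M with hs₀
  have i0 : s₀.idx 0 = N := by simp [hs₀, inputState]
  have hiter := (run_iterProg (ω := ω) (s := s₀) (P := P) (Q := Q) i0 (by simp [hs₀, inputState])
    (by simp [hs₀, inputState]) hP1).2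
  set B := N + rkIter N P Q
  have b1 := h' ω s₀ B (by omega) (by omega) (by simp [hs₀, inputState])
  have b2 := h ω (iterProg.run ω s₀) B (by omega)
    (by rw [RealProg.idx_run _ _ _ (by simp [iterProg, RealProg.loopVars])]; omega)
    (by rw [hiter]; exact Nat.le_add_left _ _)
  have z : s₀.steps = 0 := rfl
  have h5 : B ^ d ≤ B ^ (d + d') := Nat.pow_le_pow_right (by omega) (by omega)
  have h6 : B ^ d' ≤ B ^ (d + d') := Nat.pow_le_pow_right (by omega) (by omega)
  simp only [RealProg.time, RealProg.run]
  nlinarith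

end Correctness
end

noncomputable section

open Matrix

/-! ### The output law of the program -/

theorem infinitePi_map_sum {Λ α β X : Type*} [Fintype α] [Fintype β] [MeasurableSpace X]
    (μ : Measure X) [IsProbabilityMeasure μ] {φ : α → Λ} {ψ : β → Λ}
    (h : Function.Injective (Sum.elim φ ψ)) :
    (Measure.infinitePi fun _ : Λ => μ).map (fun ω => (fun a => ω (φ a), fun b => ω (ψ b))) =
      (Measure.pi fun _ : α => μ).prod (Measure.pi fun _ : β => μ) := by
  have h1 := infinitePi_map_vector μ h
  have h2 := (measurePreserving_sumPiEquivProdPi (fun _ : α ⊕ β => μ)).map_eq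
  rw [← h1, Measure.map_map (MeasurableEquiv.measurable _) (by fun_prop)] at h2
  exact h2

theorem pi_map_curry {ι κ X Y : Type*} [Fintype ι] [Fintype κ] [MeasurableSpace X]
    [MeasurableSpace Y] (μ : Measure X) [IsProbabilityMeasure μ] {f : X → Y} (hf : Measurable f) :
    (Measure.pi fun _ : ι × κ => μ).map (fun x i j => f (x (i, j))) =
      Measure.pi fun _ : ι => Measure.pi fun _ : κ => μ.map f := by
  have : IsProbabilityMeasure (μ.map f) := Measure.isProbabilityMeasure_map hf.aemeasurable
  rw [← infinitePi_map_matrix (μ.map f) (φ := (id : ι × κ → _)) Function.injective_id,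
    ← Measure.infinitePi_map_pi (fun _ : ι × κ => μ) (f := fun _ => f) (fun _ => hf),
    Measure.map_map (by fun_prop) (by fun_prop), Measure.infinitePi_eq_pi]
  rfl

/-- A trial takes its Gaussian from one tape entry and its uniform variable from the next.
Discarding the other components leaves an independent pair with the required laws. -/
theorem pi_finTwo_map_fst_snd {X Y : Type*} [MeasurableSpace X] [MeasurableSpace Y]
    (μ : Measure X) (ν : Measure Y) [IsProbabilityMeasure μ] [IsProbabilityMeasure ν] :
    (Measure.pi fun _ : Fin 2 => μ.prod ν).map (fun y => ((y 0).1, (y 1).2)) = μ.prod ν := by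
  have h1 := (measurePreserving_finTwoArrow (μ.prod ν)).map_eq
  have h2 := Measure.map_prod_map (μ.prod ν) (μ.prod ν) measurable_fst measurable_snd
  rw [measurePreserving_fst.map_eq, measurePreserving_snd.map_eq, ← h1,
    Measure.map_map (measurable_fst.prodMap measurable_snd) (MeasurableEquiv.measurable _)] at h2
  exact h2.symm

theorem pi_map_tapeNoise (N n : ℕ) {μ ν : Measure ℝ} [IsProbabilityMeasure μ]
    [IsProbabilityMeasure ν] :
    (Measure.pi fun _ : (Fin N × (Fin N × Fin n)) × Fin 2 => μ.prod ν).map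
      (fun x i j l => ((x ((i, (j, l)), 0)).1, (x ((i, (j, l)), 1)).2)) =
      Measure.pi fun _ : Fin N => Measure.pi fun _ : Fin N => Measure.pi fun _ : Fin n =>
        μ.prod ν := by
  have h1 := pi_map_curry (ι := Fin N × (Fin N × Fin n)) (κ := Fin 2) (μ.prod ν) measurable_id
  have h2 := Measure.pi_map_pi (ι := Fin N × (Fin N × Fin n))
    (μ := fun _ => Measure.pi fun _ : Fin 2 => μ.prod ν)
    (f := fun _ (y : Fin 2 → ℝ × ℝ) => ((y 0).1, (y 1).2)) (hμ := fun _ => by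
      rw [pi_finTwo_map_fst_snd]; infer_instance) (fun _ => by fun_prop)
  have h3 := pi_map_curry (ι := Fin N) (κ := Fin N × Fin n) (μ.prod ν) measurable_id
  have h4 := Measure.pi_map_pi (ι := Fin N)
    (μ := fun _ => Measure.pi fun _ : Fin N × Fin n => μ.prod ν)
    (f := fun _ (y : Fin N × Fin n → ℝ × ℝ) j l => y (j, l)) (hμ := fun _ => by
      have := pi_map_curry (ι := Fin N) (κ := Fin n) (μ.prod ν) measurable_id
      simp only [Measure.map_id, id] at this
      rw [this]; infer_instance) (fun _ => Measurable.aemeasurable (by fun_prop))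
  have h5 := pi_map_curry (ι := Fin N) (κ := Fin n) (μ.prod ν) measurable_id
  simp only [Measure.map_id, id, pi_finTwo_map_fst_snd] at h1 h2 h3 h4 h5
  rw [h5, ← h3, ← h2, ← h1, Measure.map_map (by fun_prop) (by fun_prop),
    Measure.map_map (by fun_prop) (by fun_prop), Measure.map_map (by fun_prop) (by fun_prop)] at h4
  exact h4

/-- Uniqueness of division with remainder; it decodes nested tape addresses digit by digit. -/
theorem mul_add_inj_of_lt {K a b a' b' : ℕ} (hb : b < K) (hb' : b' < K)
    (h : a * K + b = a' * K + b') : a = a' ∧ b = b' := by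
  have hK : 0 < K := by omega
  have h1 := congrArg (· / K) h
  have h2 := congrArg (· % K) h
  simp only [mul_comm _ K, Nat.mul_add_div hK, Nat.div_eq_of_lt hb, Nat.div_eq_of_lt hb',
    Nat.mul_add_mod, Nat.mod_eq_of_lt hb, Nat.mod_eq_of_lt hb', add_zero] at h1 h2
  exact ⟨h1, h2⟩

theorem mul_add_lt_mul {K n a b : ℕ} (ha : a < n) (hb : b < K) : a * K + b < n * K := by
  have : (a + 1) * K ≤ n * K := Nat.mul_le_mul_right _ ha
  rw [add_mul, one_mul] at this
  omega

/-- The random inputs of the algorithm, read off disjoint parts of the tape. -/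
theorem tapeMeasure_map (N m : ℕ) (P Q : ℝ) :
    tapeMeasure.map (fun ω => ((fun (j : Fin N) (i : Fin m) => (ω (j * m + i)).1,
      fun (i j : Fin N) => tapeNoise ω (N * m + i * (N * (rkIter N P Q * 2)) +
        j * (rkIter N P Q * 2)) (rkIter N P Q),
      fun (t i : Fin N) => (ω (N * m + N * (N * (rkIter N P Q * 2)) + t * N + i)).1) :
        (Fin N → Fin m → ℝ) × (Fin N → Fin N → Fin (rkIter N P Q) → ℝ × ℝ) ×
          (Fin N → Fin N → ℝ))) =
      (gaussianRect N m).prod ((gaussianizeNoise N P Q).prod (gaussianMatrix N)) := by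
  set n := rkIter N P Q with hn
  let ν : Measure (ℝ × ℝ) := (gaussianReal 0 1).prod unifMeasure
  -- The addresses of the three blocks, in mixed radix. The bounds `b1`, `b2`, `b3` keep each digit
  -- in range, so every address map is injective and the blocks do not overlap.
  let φ : Fin N × Fin m → ℕ := fun a => a.1 * m + a.2
  let ψ : (Fin N × (Fin N × Fin n)) × Fin 2 → ℕ := fun a => N * m + (a.1.1 * (N * (n * 2)) +
    (a.1.2.1 * (n * 2) + ((n - 1 - a.1.2.2) * 2 + a.2)))
  let χ : Fin N × Fin N → ℕ := fun a => N * m + N * (N * (n * 2)) + (a.1 * N + a.2)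
  have b1 : ∀ a : (Fin N × (Fin N × Fin n)) × Fin 2, (n - 1 - a.1.2.2) * 2 + a.2.1 < n * 2 :=
    fun a => by have := a.1.2.2.2; have := a.2.2; omega
  have b2 : ∀ a : (Fin N × (Fin N × Fin n)) × Fin 2,
      a.1.2.1.1 * (n * 2) + ((n - 1 - a.1.2.2) * 2 + a.2.1) < N * (n * 2) :=
    fun a => mul_add_lt_mul a.1.2.1.2 (b1 a)
  have b3 : ∀ a : (Fin N × (Fin N × Fin n)) × Fin 2, a.1.1.1 * (N * (n * 2)) +
      (a.1.2.1.1 * (n * 2) + ((n - 1 - a.1.2.2) * 2 + a.2.1)) < N * (N * (n * 2)) :=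
    fun a => mul_add_lt_mul a.1.1.2 (b2 a)
  have hφ : Function.Injective φ := fun a b h => by
    obtain ⟨h1, h2⟩ := mul_add_inj_of_lt a.2.2 b.2.2 h
    exact Prod.ext (Fin.ext h1) (Fin.ext h2)
  have hχ : Function.Injective χ := fun a b h => by
    obtain ⟨h1, h2⟩ := mul_add_inj_of_lt a.2.2 b.2.2 (Nat.add_left_cancel h)
    exact Prod.ext (Fin.ext h1) (Fin.ext h2)
  have hψ : Function.Injective ψ := fun a b h => by
    obtain ⟨h1, h2⟩ := mul_add_inj_of_lt (b2 a) (b2 b) (Nat.add_left_cancel h)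
    obtain ⟨h3, h4⟩ := mul_add_inj_of_lt (b1 a) (b1 b) h2
    obtain ⟨h5, h6⟩ := mul_add_inj_of_lt a.2.2 b.2.2 h4
    have := a.1.2.2.2
    have := b.1.2.2.2
    exact Prod.ext (Prod.ext (Fin.ext h1) (Prod.ext (Fin.ext h3) (Fin.ext (by omega)))) (Fin.ext h6)
  have hψχ : Function.Injective (Sum.elim ψ χ) := hψ.sumElim hχ fun a b => by
    have := b3 a
    simp only [ψ, χ]
    omega
  have hall : Function.Injective (Sum.elim φ (Sum.elim ψ χ)) := hφ.sumElim hψχ fun a b => by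
    have h1 := mul_add_lt_mul a.1.2 a.2.2
    rcases b with b | b <;> simp only [φ, ψ, χ, Sum.elim_inl, Sum.elim_inr] <;> omega
  let f₁ : (Fin N × Fin m → ℝ × ℝ) → Fin N → Fin m → ℝ := fun x j i => (x (j, i)).1
  let f₂ : ((Fin N × (Fin N × Fin n)) × Fin 2 → ℝ × ℝ) → Fin N → Fin N → Fin n → ℝ × ℝ :=
    fun x i j l => ((x ((i, (j, l)), 0)).1, (x ((i, (j, l)), 1)).2)
  let f₃ : (Fin N × Fin N → ℝ × ℝ) → Fin N → Fin N → ℝ := fun x j i => (x (j, i)).1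
  have m₁ : Measurable f₁ := by fun_prop
  have m₂ : Measurable f₂ := by fun_prop
  have m₃ : Measurable f₃ := by fun_prop
  have hfst : ν.map Prod.fst = gaussianReal 0 1 := measurePreserving_fst.map_eq
  have e₁ : (Measure.pi fun _ => ν).map f₁ = gaussianRect N m := by
    rw [gaussianRect, ← hfst]; exact pi_map_curry ν measurable_fst
  have e₂ : (Measure.pi fun _ => ν).map f₂ = gaussianizeNoise N P Q := pi_map_tapeNoise N n
  have e₃ : (Measure.pi fun _ => ν).map f₃ = gaussianMatrix N := by
    rw [gaussianMatrix, ← hfst]; exact pi_map_curry ν measurable_fst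
  have hsum : (Measure.pi fun _ => ν).map (fun x : (((Fin N × (Fin N × Fin n)) × Fin 2) ⊕
      (Fin N × Fin N)) → ℝ × ℝ => (fun b => x (Sum.inl b), fun c => x (Sum.inr c))) =
      (Measure.pi fun _ => ν).prod (Measure.pi fun _ => ν) :=
    (measurePreserving_sumPiEquivProdPi (fun _ => ν)).map_eq
  have key := infinitePi_map_sum ν hall
  rw [← e₁, ← e₂, ← e₃, Measure.map_prod_map _ _ m₂ m₃, ← hsum,
    Measure.map_map (m₂.prodMap m₃) (by fun_prop),
    Measure.map_prod_map _ _ m₁ ((m₂.prodMap m₃).comp (by fun_prop)), ← key,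
    Measure.map_map (m₁.prodMap ((m₂.prodMap m₃).comp (by fun_prop))) (by fun_prop), tapeMeasure]
  congr 1
  funext ω
  refine Prod.ext rfl (Prod.ext ?_ ?_)
  · funext i j l
    simp only [tapeNoise, Function.comp_apply, Prod.map, f₂, ψ, Sum.elim_inl, Sum.elim_inr,
      Fin.val_zero, Fin.val_one, add_zero, add_assoc]
    rfl
  · funext t i
    simp only [Function.comp_apply, Prod.map, f₃, χ, Sum.elim_inr, add_assoc]
    rfl

/-- The output is a function of the three independent blocks of the tape. It differs from the one
using `gsOrth` only on the null set where Gram–Schmidt fails, and `gsOrth` of a Gaussian matrix is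
Haar. -/
theorem outputLaw_chiSqProg {N k : ℕ} {P Q τ : ℝ} (M : Fin N → Fin N → Bool) (hPpos : 0 < P)
    (hP1 : P ≤ 1) (hQ1 : Q < 1) :
    (RealProg.seq iterProg chiSqProg).outputLaw N k P Q τ M = chiSqRandomRotation N k P Q τ M := by
  let Φ : (Fin N → Fin (N / k) → ℝ) × (Fin N → Fin N → Fin (rkIter N P Q) → ℝ × ℝ) ×
      (Fin N → Fin N → ℝ) → Fin N → Fin N → ℝ := fun a i j =>
    ∑ l, rkMatrix N k P Q τ (rowNorms a.1) M a.2.1 i l * gsMat a.2.2 N l j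
  have hrk {α : Type} [MeasurableSpace α] : Measurable fun a : (Fin N → Fin (N / k) → ℝ) ×
      (Fin N → Fin N → Fin (rkIter N P Q) → ℝ × ℝ) × α =>
        rkMatrix N k P Q τ (rowNorms a.1) M a.2.1 :=
    (measurable_rkMatrix N k P Q τ).comp (f := fun a : (Fin N → Fin (N / k) → ℝ) ×
      (Fin N → Fin N → Fin (rkIter N P Q) → ℝ × ℝ) × α => (rowNorms a.1, M, a.2.1))
      ((measurable_rowNorms.comp measurable_fst).prodMk (by fun_prop))
  have hΦ : Measurable Φ := by
    refine measurable_pi_lambda _ fun i => measurable_pi_lambda _ fun j => ?_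
    refine Finset.measurable_fun_sum _ fun l _ => Measurable.mul ?_ ?_
    · exact measurable_pi_iff.1 (measurable_pi_iff.1 hrk i) l
    · exact (measurable_gsMat N l j).comp (measurable_snd.comp measurable_snd)
  have hmul : Measurable fun a : (Fin N → Fin (N / k) → ℝ) ×
      (Fin N → Fin N → Fin (rkIter N P Q) → ℝ × ℝ) × Matrix.orthogonalGroup (Fin N) ℝ =>
      mulOut (rkMatrix N k P Q τ (rowNorms a.1) M a.2.1) a.2.2 :=
    measurable_mulOut.comp (f := fun a : (Fin N → Fin (N / k) → ℝ) ×
      (Fin N → Fin N → Fin (rkIter N P Q) → ℝ × ℝ) × Matrix.orthogonalGroup (Fin N) ℝ =>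
      (rkMatrix N k P Q τ (rowNorms a.1) M a.2.1, a.2.2))
      (hrk.prodMk (measurable_snd.comp measurable_snd))
  have hgs : Measurable (Prod.map id (Prod.map id gsOrth) :
      (Fin N → Fin (N / k) → ℝ) × (Fin N → Fin N → Fin (rkIter N P Q) → ℝ × ℝ) ×
        (Fin N → Fin N → ℝ) → _) :=
    measurable_id.prodMap (measurable_id.prodMap measurable_gsOrth)
  have hae : ∀ᵐ a ∂(gaussianRect N (N / k)).prod
      ((gaussianizeNoise N P Q).prod (gaussianMatrix N)), (gsOrth a.2.2).1 = gsMat a.2.2 N :=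
    Measure.quasiMeasurePreserving_snd.ae
      (Measure.quasiMeasurePreserving_snd.ae ((ae_coe_gsOrth N).mono fun _ h => h.1))
  rw [chiSqRandomRotation_eq_map, ← gaussianMatrix_map_gsOrth]
  have hprod : (gaussianRect N (N / k)).prod
      ((gaussianizeNoise N P Q).prod ((gaussianMatrix N).map gsOrth)) =
      ((gaussianRect N (N / k)).prod ((gaussianizeNoise N P Q).prod (gaussianMatrix N))).map
        (Prod.map id (Prod.map id gsOrth)) := by
    have h1 := Measure.map_prod_map (gaussianizeNoise N P Q) (gaussianMatrix N) measurable_id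
      measurable_gsOrth
    have h2 := Measure.map_prod_map (gaussianRect N (N / k))
      ((gaussianizeNoise N P Q).prod (gaussianMatrix N)) measurable_id
      (measurable_id.prodMap measurable_gsOrth)
    rw [Measure.map_id] at h1 h2
    rw [h1, h2]
  rw [hprod, Measure.map_map hmul hgs]
  have hcongr : ((gaussianRect N (N / k)).prod ((gaussianizeNoise N P Q).prod
      (gaussianMatrix N))).map ((fun a : (Fin N → Fin (N / k) → ℝ) ×
      (Fin N → Fin N → Fin (rkIter N P Q) → ℝ × ℝ) × Matrix.orthogonalGroup (Fin N) ℝ =>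
      mulOut (rkMatrix N k P Q τ (rowNorms a.1) M a.2.1) a.2.2) ∘
        Prod.map id (Prod.map id gsOrth)) = ((gaussianRect N (N / k)).prod
      ((gaussianizeNoise N P Q).prod (gaussianMatrix N))).map Φ := by
    refine Measure.map_congr (hae.mono fun a ha => ?_)
    funext i j
    simp only [Function.comp_apply, Prod.map, id, mulOut, Φ, ha]
  rw [hcongr, ← tapeMeasure_map, Measure.map_map hΦ]
  · simp only [RealProg.outputLaw, run_chiSqProg hPpos hP1 hQ1]
    rfl
  · unfold tapeNoise
    fun_prop

/-- `δ⁻¹ ≤ Nᴬ / c` by `sub_le_rkDelta`, and `log N ≤ N`; the rounding up and the summand `N` account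
for the `2`. -/
theorem add_rkIter_le {c P Q : ℝ} {A N : ℕ} (hc : 0 < c) (hN : 1 ≤ N) (hQ : 0 < Q) (hQP : Q < P)
    (hP : P ≤ 1) (hPQ : c * ((N : ℝ) ^ A)⁻¹ ≤ P - Q) :
    ((N + rkIter N P Q : ℕ) : ℝ) ≤ (6 / c + 2) * (N : ℝ) ^ (A + 1) := by
  have hN1 : (1 : ℝ) ≤ N := by exact_mod_cast hN
  have hδ : c * ((N : ℝ) ^ A)⁻¹ ≤ rkDelta P Q := hPQ.trans (sub_le_rkDelta hQ hQP hP)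
  have hpos : 0 < c * ((N : ℝ) ^ A)⁻¹ := by positivity
  have hinv : (rkDelta P Q)⁻¹ ≤ (N : ℝ) ^ A / c := by
    refine (inv_anti₀ hpos hδ).trans (le_of_eq ?_)
    field_simp
  have hlog0 : 0 ≤ Real.log N := Real.log_nonneg hN1
  have hlog : Real.log N ≤ N := (Real.log_le_sub_one_of_pos (by positivity)).trans (by linarith)
  have hδ0 : 0 ≤ (rkDelta P Q)⁻¹ := inv_nonneg.2 (hpos.le.trans hδ)
  have h1 : (rkIter N P Q : ℝ) ≤ 6 * (rkDelta P Q)⁻¹ * Real.log N + 1 :=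
    (Nat.ceil_lt_add_one (by positivity)).le
  have h2 : 6 * (rkDelta P Q)⁻¹ * Real.log N ≤ 6 * ((N : ℝ) ^ A / c) * N := by gcongr
  have h3 : (1 : ℝ) ≤ (N : ℝ) ^ A := one_le_pow₀ hN1
  have h4 : (N : ℝ) ≤ (N : ℝ) ^ (A + 1) := by
    rw [pow_succ]; nlinarith
  push_cast
  calc (N : ℝ) + rkIter N P Q ≤ N + (6 * ((N : ℝ) ^ A / c) * N + 1) := by linarith
    _ = N + 6 / c * (N : ℝ) ^ (A + 1) + 1 := by ring
    _ ≤ _ := by linarith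

instance isProbabilityMeasure_plantedBernoulli (N : ℕ) (S : Finset (Fin N)) (P Q : ℝ) :
    IsProbabilityMeasure (plantedBernoulli N S P Q) := by
  unfold plantedBernoulli; infer_instance

instance isProbabilityMeasure_nullBernoulli (N : ℕ) (Q : ℝ) :
    IsProbabilityMeasure (nullBernoulli N Q) := by
  unfold nullBernoulli; infer_instance

end

/-! ### Assembling the theorem -/

theorem lemma4p5 :
    ∃ prog : RealProg, ∀ (c : ℝ) (A : ℕ), 0 < c → ∃ (C : ℝ) (d : ℕ),
      ∀ (N k : ℕ) (P Q τ : ℝ), 1 ≤ N → k ∣ N →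
        0 < Q → Q < P → P ≤ 1 → c ≤ min Q (1 - Q) → c * ((N : ℝ) ^ A)⁻¹ ≤ P - Q →
        0 < τ → τ ≤ rkDelta P Q / (2 * √(6 * Real.log N + 2 * Real.log (P - Q)⁻¹)) →
        (∀ M : Fin N → Fin N → Bool,
          prog.outputLaw N k P Q τ M = chiSqRandomRotation N k P Q τ M ∧
          ∀ ω, (prog.time N k P Q τ M ω : ℝ) ≤ C * (N : ℝ) ^ d) ∧
        (∀ S : Finset (Fin N), S.card = k →
          tvDist ((plantedBernoulli N S P Q).bind (chiSqRandomRotation N k P Q τ))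
              (spikedMatrix N (τ ^ 2 * (k : ℝ) ^ 2 / (4 * N)) (plantedVec k S)) ≤
            C * (N : ℝ)⁻¹ + k * (4 * Real.exp (-3)) ^ ((N : ℝ) / (2 * k))) ∧
        tvDist ((nullBernoulli N Q).bind (chiSqRandomRotation N k P Q τ))
            (gaussianMatrix N) ≤ C * (N : ℝ)⁻¹ := by
  obtain ⟨K, d, hK⟩ := exists_steps_chiSqProg
  refine ⟨.seq iterProg chiSqProg, fun c A hc => ?_⟩
  -- The three summands of the constant serve `N < 1/c`, the kernel error `4/N` and the running
  -- time, respectively.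
  refine ⟨1 / c + 4 + K * (6 / c + 2) ^ d, (A + 1) * d, ?_⟩
  intro N k P Q τ hN hk hQ hQP hP hcm hPQ hτ0 hτ
  have hcQ : c ≤ Q := hcm.trans (min_le_left _ _)
  have hN1 : (1 : ℝ) ≤ N := by exact_mod_cast hN
  have hNpos : (0 : ℝ) < N := by linarith
  have hc0 : 0 ≤ 1 / c := by positivity
  have hK0 : 0 ≤ K * (6 / c + 2) ^ d := by positivity
  set C := 1 / c + 4 + K * (6 / c + 2) ^ d with hC
  -- For `N < 1/c` the claimed bound is at least `1`, and total variation never exceeds `1`.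
  have hbig : ¬ 1 / c ≤ N → 1 ≤ C * (N : ℝ)⁻¹ := fun h => by
    rw [← div_eq_mul_inv, one_le_div hNpos]
    linarith [not_le.1 h]
  have hfour : 4 * (N : ℝ)⁻¹ ≤ C * (N : ℝ)⁻¹ :=
    mul_le_mul_of_nonneg_right (by linarith) (by positivity)
  have hpow : (0 : ℝ) ≤ k * (4 * Real.exp (-3)) ^ ((N : ℝ) / (2 * k)) := by positivity
  refine ⟨fun M => ⟨outputLaw_chiSqProg M (hQ.trans hQP) hP (hQP.trans_le hP), fun ω => ?_⟩,
    fun S hS => ?_, ?_⟩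
  · have h1 : (((RealProg.seq iterProg chiSqProg).time N k P Q τ M ω : ℕ) : ℝ) ≤
        K * ((N + rkIter N P Q : ℕ) : ℝ) ^ d := by exact_mod_cast hK ω N k P Q τ M hN hP
    have h2 := add_rkIter_le hc hN hQ hQP hP hPQ
    calc _ ≤ K * ((N + rkIter N P Q : ℕ) : ℝ) ^ d := h1
      _ ≤ K * ((6 / c + 2) * (N : ℝ) ^ (A + 1)) ^ d := by gcongr
      _ = K * (6 / c + 2) ^ d * (N : ℝ) ^ ((A + 1) * d) := by rw [mul_pow, ← pow_mul, mul_assoc]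
      _ ≤ _ := by gcongr; linarith
  · have := isProbabilityMeasure_bind_chi (k := k) (P := P) (Q := Q) (τ := τ)
      (plantedBernoulli N S P Q)
    by_cases hNc : 1 / c ≤ N
    · exact ((bind_chi_planted_tvLe hc hNc hN hk hcQ hQP hP hτ0 hτ hS).tvDist_le
        (by positivity)).trans (by linarith)
    · exact (tvDist_le_one _ _).trans (by linarith [hbig hNc])
  · have := isProbabilityMeasure_bind_chi (k := k) (P := P) (Q := Q) (τ := τ) (nullBernoulli N Q)
    by_cases hNc : 1 / c ≤ N
    · exact ((bind_chi_null_tvLe hc hNc hN hk hcQ hQP hP hτ0 hτ).tvDist_le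
        (by positivity)).trans hfour
    · exact (tvDist_le_one _ _).trans (hbig hNc)
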